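/- Let $\kappa=(\kappa_1,\kappa_2)$ with $\kappa_1,\kappa_2>0$, let $\delta_r(x)=(r^{\kappa_1}x_1,r^{\kappa_2}x_2)$ for $r>0$, and let $f\in C^\infty(\mathbb R^2\setminus\{0\})$ be real-valued and $\kappa$-homogeneous of degree one, i.e. $f(\delta_r x)=r f(x)$ for all $x\ne0$, $r>0$. For a function $g$ smooth away from the origin let $\operatorname{ord} g(x)\in\{0,1,\dots,\infty\}$ be the smallest $j\ge 0$ with $D^jg(x)\neq0$, and $\operatorname{ord} g=\sup_{x\neq0}\operatorname{ord} g(x)$. Assume $\operatorname{ord}(\det D^2f)<\infty$, and put $h=\max\{\frac1{\kappa_1+\kappa_2},\operatorname{ord} f\}$. For an integer $n\ge2$ let $G_{f,n}:\mathbb R^2\setminus\{0\}\to[0,\infty)$ be the unique $\kappa$-homogeneous function of degree one with $G_{f,n}(x)=|\nabla f(x)|^{n/(n-1)}$ for $|x|=1$. Let $\|a\|_{L^1_3}$ denote the sum of the $L^1$ norms of the derivatives of $a$ of order at most $3$, and let $x^0\in\mathbb R^2\setminus\{0\}$. (i) Let $j\in\{1,2\}$. If $\kappa_j\neq1$ and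 $\partial_jf(x^0)\neq0$, then there are $\varepsilon>0$, a compact neighbourhood $K$ of $x^0$ and a neighbourhood $U$ of $-\nabla f(x^0)$ such that, for $G_f\equiv1$ and for $G_f=G_{f,n}$ with any integer $n\ge2$, and for every $\alpha\ge0$, there is a constant $C$ with $$\Bigl|\int_{\mathbb R^2}a(x)\,G_f(x)^\alpha e^{i\lambda(f(x)+\sigma\cdot x)}\,dx\Bigr|\le C\,\|a\|_{L^1_3}(1+|\lambda|)^{-(\frac12+\varepsilon)}$$ for all $\sigma\in U$, $\lambda\in\mathbb R$ and all smooth $a:\mathbb R^2\to\mathbb C$ supported in $K$. (ii) If $\nabla f(x^0)=0$, let $G_f=G_{f,n}$ with $n=\operatorname{ord} f(x^0)$ (under the present assumptions, an integer $\ge2$). If $\alpha>\frac12-\frac1h$, then there are $\varepsilon>0$, a compact neighbourhood $K$ of $x^0$, a neighbourhood $U$ of $0$ in $\mathbb R^2$ and a constant $C$ such that the same inequality holds for all $\sigma\in U$, $\lambda\in\mathbb R$ and all smooth $a:\mathbb R^2\to\mathbb C$ supported in $K$. -/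

import Mathlib

open MeasureTheory Set Filter Topology
open scoped ContDiff ENNReal Gradient

namespace MixedHom

/-- The Euclidean plane. -/
abbrev Plane : Type := EuclideanSpace ℝ (Fin 2)

/-- The dilation `δ_r (x₁, x₂) = (r ^ κ₁ x₁, r ^ κ₂ x₂)`. -/
noncomputable def dilation (κ : Fin 2 → ℝ) (r : ℝ) (x : Plane) : Plane :=
  WithLp.toLp 2 (fun i => r ^ κ i * x i)

/-- `f` is `κ`-homogeneous of degree `d` on the punctured plane. -/
def IsKappaHomogeneous (κ : Fin 2 → ℝ) (d : ℝ) (f : Plane → ℝ) : Prop :=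
  ∀ x : Plane, x ≠ 0 → ∀ r : ℝ, 0 < r → f (dilation κ r x) = r ^ d * f x

/-- The partial derivative `∂ⱼ f`. -/
noncomputable def pderiv (j : Fin 2) (f : Plane → ℝ) (x : Plane) : ℝ :=
  fderiv ℝ f x (EuclideanSpace.single j 1)

/-- The determinant of the Hessian matrix of `f`. -/
noncomputable def hess (f : Plane → ℝ) (x : Plane) : ℝ :=
  Matrix.det (Matrix.of fun i j : Fin 2 => pderiv i (pderiv j f) x)

/-- The order of `f` at `x`: the smallest `j` with `Dʲ f(x) ≠ 0` (and `⊤` if there is none). -/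
noncomputable def orderAt (f : Plane → ℝ) (x : Plane) : ℕ∞ :=
  ⨅ (j : ℕ) (_ : iteratedFDeriv ℝ j f x ≠ 0), (j : ℕ∞)

/-- The order of `f`: the supremum of its orders at the points of the punctured plane. -/
noncomputable def order (f : Plane → ℝ) : ℕ∞ :=
  ⨆ (x : Plane) (_ : x ≠ 0), orderAt f x

/-- The height `max {1 / (κ₁ + κ₂), ord f}`. -/
noncomputable def height (κ : Fin 2 → ℝ) (f : Plane → ℝ) : ℝ≥0∞ :=
  max (ENNReal.ofReal (1 / (κ 0 + κ 1))) (order f : ℝ≥0∞)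

/-- The homogeneous radius of `x ≠ 0`: the unique `r > 0` such that `δ_{1/r} x` lies on the
unit circle (existence and uniqueness are `radius_spec` and `radius_eq` below). -/
noncomputable def radius (κ : Fin 2 → ℝ) (x : Plane) : ℝ :=
  sInf {r : ℝ | 0 < r ∧ ‖dilation κ r⁻¹ x‖ = 1}

/-- The damping function with parameter `n`: the unique `κ`-homogeneous function of degree one
on the punctured plane that equals `|∇f| ^ (n / (n - 1))` on the unit circle
(see `damping_homogeneous`, `damping_circle` and `damping_unique` below). -/
noncomputable def damping (κ : Fin 2 → ℝ) (f : Plane → ℝ) (n : ℕ) (x : Plane) : ℝ :=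
  radius κ x * ‖∇ f (dilation κ (radius κ x)⁻¹ x)‖ ^ ((n : ℝ) / ((n : ℝ) - 1))

/-- The norm of the Sobolev space `L¹₃`, for smooth compactly supported functions: the sum of
the `L¹` norms of the total derivatives of order at most three. -/
noncomputable def sobolevNorm (a : Plane → ℂ) : ℝ :=
  ∑ k ∈ Finset.range 4, ∫ x, ‖iteratedFDeriv ℝ k a x‖

/-- The oscillatory integral `∫ a(x) G(x)^α exp(i t (f(x) + σ · x)) dx`. -/
noncomputable def oscIntegral (f G : Plane → ℝ) (α : ℝ) (a : Plane → ℂ) (σ : Plane) (t : ℝ) : ℂ :=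
  ∫ x : Plane, a x * ((G x ^ α : ℝ) : ℂ) *
    Complex.exp (Complex.I * ((t * (f x + inner ℝ σ x) : ℝ) : ℂ))

theorem dilation_apply (κ : Fin 2 → ℝ) (r : ℝ) (x : Plane) (i : Fin 2) :
    dilation κ r x i = r ^ κ i * x i := rfl

theorem dilation_dilation (κ : Fin 2 → ℝ) {r s : ℝ} (hr : 0 < r) (hs : 0 < s) (x : Plane) :
    dilation κ r (dilation κ s x) = dilation κ (r * s) x := by
  ext i
  simp only [dilation_apply]
  rw [Real.mul_rpow hr.le hs.le, mul_assoc]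

theorem dilation_one (κ : Fin 2 → ℝ) (x : Plane) : dilation κ 1 x = x := by
  ext i
  simp [dilation_apply]

theorem norm_dilation_lt (κ : Fin 2 → ℝ) (hκ : ∀ i, 0 < κ i) {x : Plane} (hx : x ≠ 0)
    {r s : ℝ} (hr : 0 < r) (hrs : r < s) : ‖dilation κ r x‖ < ‖dilation κ s x‖ := by
  have h1 : ∀ i, r ^ κ i < s ^ κ i := fun i => Real.rpow_lt_rpow hr.le hrs (hκ i)
  have h0 : ∀ i, 0 < r ^ κ i := fun i => Real.rpow_pos_of_pos hr _
  have h2 : ∀ i, (r ^ κ i) ^ 2 < (s ^ κ i) ^ 2 := fun i =>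
    pow_lt_pow_left₀ (h1 i) (h0 i).le two_ne_zero
  obtain ⟨i, hi⟩ : ∃ i, x i ≠ 0 := by
    by_contra hcon
    push Not at hcon
    exact hx (by ext i; simpa using hcon i)
  rw [EuclideanSpace.norm_eq, EuclideanSpace.norm_eq]
  apply Real.sqrt_lt_sqrt (Finset.sum_nonneg fun _ _ => by positivity)
  apply Finset.sum_lt_sum
  · intro j _
    simp only [dilation_apply, Real.norm_eq_abs, sq_abs, mul_pow]
    exact mul_le_mul_of_nonneg_right (h2 j).le (sq_nonneg _)
  · refine ⟨i, Finset.mem_univ _, ?_⟩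
    simp only [dilation_apply, Real.norm_eq_abs, sq_abs, mul_pow]
    exact mul_lt_mul_of_pos_right (h2 i) (by positivity)

theorem radius_exists (κ : Fin 2 → ℝ) (hκ : ∀ i, 0 < κ i) {x : Plane} (hx : x ≠ 0) :
    ∃ r : ℝ, 0 < r ∧ ‖dilation κ r⁻¹ x‖ = 1 := by
  obtain ⟨i, hi⟩ : ∃ i, x i ≠ 0 := by
    by_contra hcon
    push Not at hcon
    exact hx (by ext i; simpa using hcon i)
  have hcont : Continuous fun r : ℝ => ‖dilation κ r x‖ := by
    refine continuous_norm.comp ((PiLp.continuous_toLp 2 _).comp (continuous_pi fun j => ?_))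
    exact (Real.continuous_rpow_const (hκ j).le).mul continuous_const
  have hzero : ‖dilation κ 0 x‖ = 0 := by
    rw [norm_eq_zero]
    ext j
    simp [dilation_apply, Real.zero_rpow (hκ j).ne']
  set s : ℝ := (|x i|⁻¹) ^ (κ i)⁻¹ with hs
  have hs0 : 0 ≤ s := by positivity
  have hone : 1 ≤ ‖dilation κ s x‖ := by
    refine le_trans ?_ (PiLp.norm_apply_le (dilation κ s x) i)
    rw [dilation_apply, hs, Real.rpow_inv_rpow (by positivity) (hκ i).ne', Real.norm_eq_abs,
      abs_mul, abs_inv, abs_abs, inv_mul_cancel₀ (abs_ne_zero.mpr hi)]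
  obtain ⟨r, hr, hr1⟩ := intermediate_value_Icc hs0 hcont.continuousOn
    (show (1 : ℝ) ∈ Icc ‖dilation κ 0 x‖ ‖dilation κ s x‖ from ⟨by rw [hzero]; norm_num, hone⟩)
  have hr1' : ‖dilation κ r x‖ = 1 := hr1
  have hr0 : 0 < r := by
    rcases hr.1.eq_or_lt with h | h
    · rw [← h, hzero] at hr1'
      norm_num at hr1'
    · exact h
  exact ⟨r⁻¹, inv_pos.mpr hr0, by rw [inv_inv]; exact hr1'⟩

theorem radius_eq (κ : Fin 2 → ℝ) (hκ : ∀ i, 0 < κ i) {x : Plane} (hx : x ≠ 0)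
    {r : ℝ} (hr : 0 < r) (h : ‖dilation κ r⁻¹ x‖ = 1) : radius κ x = r := by
  have : {s : ℝ | 0 < s ∧ ‖dilation κ s⁻¹ x‖ = 1} = {r} := by
    ext s
    simp only [mem_ofPred_eq, mem_singleton_iff]
    constructor
    · rintro ⟨hs, hs1⟩
      rcases lt_trichotomy s⁻¹ r⁻¹ with hlt | heq | hlt
      · have := norm_dilation_lt κ hκ hx (inv_pos.mpr hs) hlt
        linarith
      · exact inv_injective heq
      · have := norm_dilation_lt κ hκ hx (inv_pos.mpr hr) hlt
        linarith
    · rintro rfl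
      exact ⟨hr, h⟩
  rw [radius, this, csInf_singleton]

theorem radius_spec (κ : Fin 2 → ℝ) (hκ : ∀ i, 0 < κ i) {x : Plane} (hx : x ≠ 0) :
    0 < radius κ x ∧ ‖dilation κ (radius κ x)⁻¹ x‖ = 1 := by
  obtain ⟨r, hr, h⟩ := radius_exists κ hκ hx
  rw [radius_eq κ hκ hx hr h]
  exact ⟨hr, h⟩

theorem dilation_ne_zero (κ : Fin 2 → ℝ) {x : Plane} (hx : x ≠ 0) {r : ℝ} (hr : 0 < r) :
    dilation κ r x ≠ 0 := by
  intro h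
  apply hx
  ext i
  have hi : r ^ κ i * x i = 0 := by
    rw [← dilation_apply, h]
    rfl
  simpa [(Real.rpow_pos_of_pos hr (κ i)).ne'] using hi

theorem damping_homogeneous (κ : Fin 2 → ℝ) (hκ : ∀ i, 0 < κ i) (f : Plane → ℝ) (n : ℕ) :
    IsKappaHomogeneous κ 1 (damping κ f n) := by
  intro x hx r hr
  obtain ⟨h0, h1⟩ := radius_spec κ hκ hx
  have hd : dilation κ (r * radius κ x)⁻¹ (dilation κ r x) = dilation κ (radius κ x)⁻¹ x := by
    rw [dilation_dilation κ (by positivity) hr]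
    congr 1
    field_simp
  have hrad : radius κ (dilation κ r x) = r * radius κ x :=
    radius_eq κ hκ (dilation_ne_zero κ hx hr) (by positivity) (by rw [hd]; exact h1)
  rw [damping, damping, hrad, hd, Real.rpow_one, mul_assoc]

theorem damping_circle (κ : Fin 2 → ℝ) (hκ : ∀ i, 0 < κ i) (f : Plane → ℝ) (n : ℕ)
    {x : Plane} (hx : ‖x‖ = 1) :
    damping κ f n x = ‖∇ f x‖ ^ ((n : ℝ) / ((n : ℝ) - 1)) := by
  have hx0 : x ≠ 0 := by
    rintro rfl
    simp at hx
  have hrad : radius κ x = 1 :=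
    radius_eq κ hκ hx0 one_pos (by rw [inv_one, dilation_one]; exact hx)
  rw [damping, hrad, inv_one, dilation_one, one_mul]

theorem damping_unique (κ : Fin 2 → ℝ) (hκ : ∀ i, 0 < κ i) (f : Plane → ℝ) (n : ℕ)
    {G : Plane → ℝ} (hG : IsKappaHomogeneous κ 1 G)
    (hG1 : ∀ x : Plane, ‖x‖ = 1 → G x = ‖∇ f x‖ ^ ((n : ℝ) / ((n : ℝ) - 1)))
    {x : Plane} (hx : x ≠ 0) : G x = damping κ f n x := by
  obtain ⟨h0, h1⟩ := radius_spec κ hκ hx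
  have hy : dilation κ (radius κ x)⁻¹ x ≠ 0 := dilation_ne_zero κ hx (inv_pos.mpr h0)
  have h := hG _ hy _ h0
  rw [dilation_dilation κ h0 (inv_pos.mpr h0), mul_inv_cancel₀ h0.ne', dilation_one,
    Real.rpow_one, hG1 _ h1] at h
  exact h

end MixedHom

open MeasureTheory Set Filter Topology
open scoped ContDiff ENNReal Gradient

namespace MixedHom

/-! Write `φ = f + σ · x` for the phase, fix a frame `v, v'`, and put `Y = ∂_v φ`. The Hamiltonian
field `X = f_vv ∂_v' - f_vv' ∂_v` of `∂_v f` has zero divergence and annihilates `Y` for every `σ`,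
because `σ` changes `∂_v f` only by a constant. All estimates come from integrating by parts along
`v` and along `X`, so they hold uniformly for `σ` in any bounded set.

Split the integral with `1 = (1 - l²) + l²`, where `l = lor (Y / ρ)` and `lor s = 1 / (1 + s²)`.
Integration by parts along `v` bounds the first part by a multiple of `1 / (|t| ρ)`. The second part
lives where `|Y| ≲ ρ`, a region whose area weighted by `f_vv` is `O(ρ)`. Taking `ρ = |t|^(-1/2)`
gives only the exponent `1/2`, that is, the second derivative test. To gain, the second part is
integrated along `X`, on whose orbits `l` is constant. With `P = Xφ`, the identity `sq_mul_hdet_eq`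
expresses `f_vv² det D²f` through `f_vv XP`, `P` and `Y`. Where `P` and `Y` are both small, `XP` is
therefore bounded below in terms of `f_vv` and the Hessian determinant, so `{|P| ≲ η}` is a thin
slice of `{|Y| ≲ ρ}`; off this slice the phase oscillates along `X`. This yields in
`norm_integral_lor_sq_le` a factor of size `1 / (|t| η²) + η + ρ`, at the price of negative powers
of `f_vv` and of the determinant.

Homogeneity makes the degeneracy one-dimensional. In coordinates `(ρ, w)` adapted to the dilations,
a homogeneous function of finite order at `x₀` is a power of `w` times a unit
(`IsDilationChart.factor_or_flat`); so `det D²f = w^M T` with `T(x₀) ≠ 0`. On a dyadic strip `|w| ~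
θ` there are two bounds: one without gain but with a positive power of `θ`, and one with a gain
`|t|^(-δ)` but with a factor `θ^(-L)`. Interpolating between them and summing over the strips
(`exists_dyadic_sum_le`) gives an exponent larger than `1/2`.

The positive power of `θ` has two sources. In case (i), if the determinant vanishes at `x₀`, Euler's
identity for `∂_j f`, which has degree `1 - κ_j ≠ 0`, forces `f_jj ≠ 0` and `Xw ≠ 0`; then `{|Y| ≲
ρ, |w| ≲ θ}` has area `O(ρθ)` (`LocalData.exists_decay`). If the determinant does not vanish, the
same argument applies with `M = 0`. In case (ii), `f = w^n S` with `n ≥ 2`, so `f_vv ~ w^(n-2)` and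
`G^α ~ |w|^(nα)`. The second derivative test on a strip then gives `|t|^(-1/2) θ^(nα - (n-2)/2)`,
whose exponent is positive precisely when `α > 1/2 - 1/n`; this holds because `h ≥ n`
(`LocalData.exists_damped_decay`).

The amplitude enters only through the sup norms of `a` and `Da`, which in the plane are bounded by
the `L¹` norms of `D²a` and `D³a`. -/

theorem hasCompactSupport_of_imp {α β : Type*} [Zero α] [Zero β] {g : Plane → α} {h : Plane → β}
    (hg : HasCompactSupport g) (H : ∀ x, g x = 0 → h x = 0) : HasCompactSupport h :=
  hg.mono fun x hx hgx => hx (H x hgx)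

/-! ### Divergence free vector fields and integration by parts -/

section VectorFields

variable {F : Type*} [NormedAddCommGroup F] [NormedSpace ℝ F]

/-- The derivative of `g` along the vector field `X`. -/
noncomputable def along (X : Plane → Plane) (g : Plane → F) (x : Plane) : F :=
  fderiv ℝ g x (X x)

/-- A continuous vector field along which derivatives of test functions have zero integral. -/
def IsDivFree (X : Plane → Plane) : Prop :=
  Continuous X ∧ ∀ g : Plane → ℂ, ContDiff ℝ 1 g → HasCompactSupport g → ∫ x, along X g x = 0

theorem along_smul {X : Plane → Plane} {r : Plane → ℝ} {g : Plane → F} {x : Plane}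
    (hr : DifferentiableAt ℝ r x) (hg : DifferentiableAt ℝ g x) :
    along X (fun y => r y • g y) x = r x • along X g x + along X r x • g x := by
  simp [along, fderiv_fun_smul hr hg]

theorem along_mul {X : Plane → Plane} {r g : Plane → ℝ} {x : Plane}
    (hr : DifferentiableAt ℝ r x) (hg : DifferentiableAt ℝ g x) :
    along X (fun y => r y * g y) x = r x * along X g x + along X r x * g x :=
  along_smul hr hg

theorem along_mul_complex {X : Plane → Plane} {r g : Plane → ℂ} {x : Plane}
    (hr : DifferentiableAt ℝ r x) (hg : DifferentiableAt ℝ g x) :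
    along X (fun y => r y * g y) x = r x * along X g x + along X r x * g x := by
  simp [along, fderiv_fun_mul hr hg, mul_comm]

theorem along_comp {X : Plane → Plane} {h : ℝ → F} {h' : F} {g : Plane → ℝ} {x : Plane}
    (hh : HasDerivAt h h' (g x)) (hg : DifferentiableAt ℝ g x) :
    along X (fun y => h (g y)) x = along X g x • h' := by
  have := (hh.hasFDerivAt.comp x hg.hasFDerivAt).fderiv
  have h2 : (fun y => h (g y)) = h ∘ g := rfl
  rw [along, h2, this]
  simp [along]

theorem continuous_along {X : Plane → Plane} (hX : Continuous X) {g : Plane → F}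
    (hg : ContDiff ℝ 1 g) : Continuous (along X g) :=
  (hg.continuous_fderiv one_ne_zero).clm_apply hX

theorem hasCompactSupport_along {X : Plane → Plane} {g : Plane → F}
    (hg : HasCompactSupport g) : HasCompactSupport (along X g) := by
  refine (hg.fderiv ℝ).mono fun x hx => ?_
  simp only [along, Function.mem_support] at hx ⊢
  rintro h
  simp [h] at hx

theorem norm_along_le {X : Plane → Plane} {g : Plane → F} {x : Plane} :
    ‖along X g x‖ ≤ ‖fderiv ℝ g x‖ * ‖X x‖ :=
  (fderiv ℝ g x).le_opNorm _

theorem IsDivFree.integral_eq_zero {X : Plane → Plane} (hX : IsDivFree X) {g : Plane → ℝ}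
    (hg : ContDiff ℝ 1 g) (hc : HasCompactSupport g) : ∫ x, along X g x = 0 := by
  have h1 := hX.2 (fun x => (g x : ℂ)) (Complex.ofRealCLM.contDiff.comp hg)
    (hc.comp_left (g := fun r : ℝ => (r : ℂ)) rfl)
  have h2 : (fun x => along X (fun x => (g x : ℂ)) x) = fun x => ((along X g x : ℝ) : ℂ) := by
    ext x
    have := (Complex.ofRealCLM.hasFDerivAt.comp x
      (hg.differentiable one_ne_zero x).hasFDerivAt).fderiv
    have h3 : (fun x => (g x : ℂ)) = Complex.ofRealCLM ∘ g := rfl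
    rw [along, h3, this]
    simp [along]
  rw [h2, integral_complex_ofReal] at h1
  exact_mod_cast h1

theorem integral_fderiv_apply_eq_zero [CompleteSpace F] {g : Plane → F} (hg : ContDiff ℝ 1 g)
    (hc : HasCompactSupport g) (v : Plane) : ∫ x, fderiv ℝ g x v = 0 := by
  have hd : Differentiable ℝ g := hg.differentiable one_ne_zero
  have h := integral_bilinear_fderiv_right_eq_neg_left_of_integrable (μ := (volume : Measure Plane))
    (f := fun _ : Plane => (1 : ℝ)) (g := g) (v := v) (B := ContinuousLinearMap.lsmul ℝ ℝ)
    (by simp) (by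
      simpa using (((hg.continuous_fderiv one_ne_zero).clm_apply
        continuous_const).integrable_of_hasCompactSupport
          (hasCompactSupport_along (X := fun _ => v) hc)))
    (by simpa using hg.continuous.integrable_of_hasCompactSupport hc)
    (fun x _ => by fun_prop) (fun x _ => hd x)
  simpa using h

theorem isDivFree_const (v : Plane) : IsDivFree fun _ => v :=
  ⟨continuous_const, fun _ hg hc => integral_fderiv_apply_eq_zero hg hc v⟩

/-- The Hamiltonian vector field of `p` with respect to the frame `v, v'`. -/
noncomputable def hamField (v v' : Plane) (p : Plane → ℝ) (x : Plane) : Plane :=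
  fderiv ℝ p x v • v' - fderiv ℝ p x v' • v

theorem along_hamField {v v' : Plane} {p : Plane → ℝ} {g : Plane → F} {x : Plane} :
    along (hamField v v' p) g x
      = fderiv ℝ p x v • fderiv ℝ g x v' - fderiv ℝ p x v' • fderiv ℝ g x v := by
  simp [along, hamField]

theorem fderiv_fderiv_comm {p : Plane → ℝ} (hp : ContDiff ℝ 2 p) (v v' x : Plane) :
    fderiv ℝ (fun y => fderiv ℝ p y v) x v' = fderiv ℝ (fun y => fderiv ℝ p y v') x v := by
  have hd : DifferentiableAt ℝ (fderiv ℝ p) x :=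
    (hp.fderiv_right (m := 1) (by norm_num)).differentiable one_ne_zero x
  have hs := (hp.contDiffAt (x := x)).isSymmSndFDerivAt (by simp)
  have h : ∀ a b : Plane, fderiv ℝ (fun y => fderiv ℝ p y a) x b = fderiv ℝ (fderiv ℝ p) x b a := by
    intro a b
    rw [fderiv_clm_apply hd (by fun_prop)]
    simp
  rw [h, h]
  exact hs v' v

theorem contDiff_fderiv_apply {p : Plane → ℝ} {n m : ℕ∞} (hp : ContDiff ℝ n p) (h : m + 1 ≤ n)
    (v : Plane) : ContDiff ℝ m fun y => fderiv ℝ p y v :=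
  (hp.fderiv_right (by exact_mod_cast h)).clm_apply contDiff_const

/-- The derivative of `g` along the field equals `∂_v'(p_v g) - ∂_v(p_v' g)`: the terms containing
second derivatives of `p` cancel by symmetry. Each of the two terms has zero integral. -/
theorem isDivFree_hamField {p : Plane → ℝ} (hp : ContDiff ℝ 2 p) (v v' : Plane) :
    IsDivFree (hamField v v' p) := by
  have h1 : ∀ u, ContDiff ℝ 1 fun y => fderiv ℝ p y u := fun u =>
    contDiff_fderiv_apply (n := 2) (m := 1) hp (by norm_num) u
  refine ⟨?_, fun g hg hc => ?_⟩
  · exact ((h1 v).continuous.smul continuous_const).sub ((h1 v').continuous.smul continuous_const)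
  have hs : ∀ u, HasCompactSupport fun y => fderiv ℝ p y u • g y := fun u =>
    hasCompactSupport_of_imp hc fun x hx => by simp [hx]
  have e1 := integral_fderiv_apply_eq_zero (g := fun y => fderiv ℝ p y v • g y) ((h1 v).smul hg) (hs v) v'
  have e2 := integral_fderiv_apply_eq_zero (g := fun y => fderiv ℝ p y v' • g y) ((h1 v').smul hg) (hs v') v
  have hi : ∀ u u', Integrable fun x => fderiv ℝ (fun y => fderiv ℝ p y u • g y) x u' := by
    intro u u'
    exact (continuous_along (X := fun _ => u') continuous_const
      ((h1 u).smul hg)).integrable_of_hasCompactSupport (hasCompactSupport_along (hs u))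
  have e3 := integral_sub (hi v v') (hi v' v)
  rw [e1, e2, sub_zero] at e3
  rw [← e3]
  congr 1
  ext x
  have hgd := hg.differentiable one_ne_zero x
  have a1 := along_smul (X := fun _ => v') ((h1 v).differentiable one_ne_zero x) hgd
  have a2 := along_smul (X := fun _ => v) ((h1 v').differentiable one_ne_zero x) hgd
  simp only [along] at a1 a2
  rw [a1, a2, along_hamField, fderiv_fderiv_comm hp v v' x]
  abel

end VectorFields

/-! ### Two estimates obtained by integrating by parts -/

theorem abs_arctan_le_two (s : ℝ) : |Real.arctan s| ≤ 2 := by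
  rw [abs_le]
  have := Real.arctan_lt_pi_div_two s
  have := Real.neg_pi_div_two_lt_arctan s
  have := Real.pi_le_four
  constructor <;> linarith

theorem contDiff_lorentz {n : ℕ∞} : ContDiff ℝ n fun s : ℝ => (1 + s ^ 2)⁻¹ :=
  (contDiff_const.add (contDiff_id.pow 2)).inv fun s => by positivity

/-- This is the basic sublevel estimate. Since `lor (P / η) XP = η X(arctan (P / η))`, moving `X`
onto the weight leaves a factor `η` times a bounded function. The factor `c` passes through the
integration by parts because it is constant along `X`. -/
theorem integral_lorentz_mul_along_le {X : Plane → Plane} (hX : IsDivFree X) {m c P : Plane → ℝ}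
    (hm : ContDiff ℝ 1 m) (hmc : HasCompactSupport m) (hc : ContDiff ℝ 1 c)
    (hXc : ∀ x, along X c x = 0) (hc0 : ∀ x, 0 ≤ c x) (hP : ContDiff ℝ 1 P) {η : ℝ} (hη : 0 < η) :
    |∫ x, m x * c x * (1 + (P x / η) ^ 2)⁻¹ * along X P x| ≤ 2 * η * ∫ x, |along X m x| * c x := by
  have hT : ContDiff ℝ 1 fun x => Real.arctan (P x / η) :=
    Real.contDiff_arctan.comp (hP.div_const η)
  have hA : ContDiff ℝ 1 fun x => c x * Real.arctan (P x / η) := hc.mul hT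
  have h0 := hX.integral_eq_zero (hm.mul hA) hmc.mul_right
  have hpt : ∀ x, along X (fun y => m y * (c y * Real.arctan (P y / η))) x
      = m x * c x * (1 + (P x / η) ^ 2)⁻¹ * along X P x / η
        + along X m x * c x * Real.arctan (P x / η) := by
    intro x
    have hd : ∀ {g : Plane → ℝ}, ContDiff ℝ 1 g → DifferentiableAt ℝ g x := fun hg =>
      hg.differentiable one_ne_zero x
    rw [along_mul (hd hm) (hd hA), along_mul (hd hc) (hd hT), hXc]
    have hat : HasDerivAt (fun s => Real.arctan (s / η)) (1 / (1 + (P x / η) ^ 2) * (1 / η)) (P x) :=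
      ((hasDerivAt_id _).div_const η).arctan
    rw [along_comp hat (hd hP)]
    simp only [smul_eq_mul]
    field_simp
    ring
  have hi1 : Integrable fun x => m x * c x * (1 + (P x / η) ^ 2)⁻¹ * along X P x / η := by
    refine Continuous.integrable_of_hasCompactSupport ?_ ?_
    · have h1 := (contDiff_lorentz (n := 0)).continuous.comp (hP.continuous.div_const η)
      exact (((hm.continuous.mul hc.continuous).mul h1).mul (continuous_along hX.1 hP)).div_const η
    · refine hmc.mono fun x hx => ?_
      simp only [Function.mem_support] at hx ⊢
      rintro h
      simp [h] at hx
  have hi2 : Integrable fun x => along X m x * c x * Real.arctan (P x / η) := by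
    refine Continuous.integrable_of_hasCompactSupport ?_ ?_
    · exact ((continuous_along hX.1 hm).mul hc.continuous).mul
        (Real.continuous_arctan.comp (hP.continuous.div_const η))
    · exact ((hasCompactSupport_along hmc).mul_right).mul_right
  have hi3 : Integrable fun x => |along X m x| * c x := by
    refine Continuous.integrable_of_hasCompactSupport ?_ ?_
    · exact (continuous_along hX.1 hm).abs.mul hc.continuous
    · exact (hasCompactSupport_along hmc).abs.mul_right
  have h1 : (∫ x, m x * c x * (1 + (P x / η) ^ 2)⁻¹ * along X P x) / η
      = - ∫ x, along X m x * c x * Real.arctan (P x / η) := by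
    rw [← integral_div, eq_neg_iff_add_eq_zero, ← integral_add hi1 hi2, ← h0]
    exact integral_congr_ae (.of_forall fun x => (hpt x).symm)
  have h2 : |∫ x, along X m x * c x * Real.arctan (P x / η)| ≤ 2 * ∫ x, |along X m x| * c x := by
    rw [← integral_const_mul, ← Real.norm_eq_abs]
    refine norm_integral_le_of_norm_le (hi3.const_mul 2) (.of_forall fun x => ?_)
    rw [Real.norm_eq_abs, abs_mul, abs_mul, abs_of_nonneg (hc0 x), mul_comm]
    exact mul_le_mul_of_nonneg_right (abs_arctan_le_two _) (by have := hc0 x; positivity)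
  have h3 : ∫ x, m x * c x * (1 + (P x / η) ^ 2)⁻¹ * along X P x
      = η * - ∫ x, along X m x * c x * Real.arctan (P x / η) := by
    rw [← h1, mul_div_cancel₀ _ hη.ne']
  rw [h3, abs_mul, abs_neg, abs_of_pos hη]
  nlinarith

/-- The oscillating factor with frequency `t` and phase `φ`. -/
noncomputable def osc (t : ℝ) (φ : Plane → ℝ) (x : Plane) : ℂ :=
  Complex.exp (Complex.I * ((t * φ x : ℝ) : ℂ))

theorem norm_osc (t : ℝ) (φ : Plane → ℝ) (x : Plane) : ‖osc t φ x‖ = 1 := by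
  rw [osc, mul_comm, Complex.norm_exp_ofReal_mul_I]

theorem contDiff_osc {n : ℕ∞} {t : ℝ} {φ : Plane → ℝ} (hφ : ContDiff ℝ n φ) :
    ContDiff ℝ n (osc t φ) :=
  (contDiff_const.mul (Complex.ofRealCLM.contDiff.comp (contDiff_const.mul hφ))).cexp

theorem along_osc {X : Plane → Plane} {t : ℝ} {φ : Plane → ℝ} {x : Plane}
    (hφ : DifferentiableAt ℝ φ x) :
    along X (osc t φ) x = along X φ x • (Complex.I * t * osc t φ x) := by
  have h : HasDerivAt (fun s : ℝ => Complex.exp (Complex.I * ((t * s : ℝ) : ℂ)))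
      (Complex.I * t * Complex.exp (Complex.I * ((t * φ x : ℝ) : ℂ))) (φ x) := by
    have h1 : HasDerivAt (fun s : ℝ => ((t * s : ℝ) : ℂ)) (t : ℂ) (φ x) := by
      simpa using ((hasDerivAt_id (φ x)).const_mul t).ofReal_comp
    convert (h1.const_mul Complex.I).cexp using 1
    ring
  exact along_comp h hφ

/-- From `Xφ = P` it follows that `X(e^(itφ)) = i t η (P / η) e^(itφ)`, which gains `1 / (|t| η)`.
The multiplier `M` supplies the factor vanishing at `P = 0`, so no division by `P` is needed; in
use, `M(s) s` is `1 - lor s` or `1 - lor² s`. When `X` falls on `M(P / η)` it produces the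
Lorentzian term on the right. -/
theorem norm_integral_osc_le {X : Plane → Plane} (hX : IsDivFree X) {M M' : ℝ → ℝ}
    (hM : ∀ s, HasDerivAt M (M' s) s) (hM' : Continuous M') (hM1 : ∀ s, |M s| ≤ 1)
    (hM4 : ∀ s, |M' s| ≤ 4 * (1 + s ^ 2)⁻¹) {b : Plane → ℂ} (hb : ContDiff ℝ 1 b)
    (hbc : HasCompactSupport b) {c φ P : Plane → ℝ} (hc : ContDiff ℝ 1 c)
    (hXc : ∀ x, along X c x = 0) (hc0 : ∀ x, 0 ≤ c x) (hφ : ContDiff ℝ 1 φ)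
    (hP : ContDiff ℝ 1 P) (hφP : ∀ x, along X φ x = P x) {η t : ℝ} (hη : 0 < η) (ht : t ≠ 0) :
    ‖∫ x, (c x * (M (P x / η) * (P x / η))) • (b x * osc t φ x)‖ ≤
      (|t| * η)⁻¹ * ∫ x, (‖along X b x‖ + 4 * ‖b x‖ * (1 + (P x / η) ^ 2)⁻¹ * (|along X P x| / η))
        * c x := by
  have hMc : ContDiff ℝ 1 M := by
    rw [contDiff_one_iff_deriv]
    refine ⟨fun s => (hM s).differentiableAt, ?_⟩
    rwa [show deriv M = M' from funext fun s => (hM s).deriv]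
  have hMP : ContDiff ℝ 1 fun x => M (P x / η) := hMc.comp (hP.div_const η)
  have hcM : ContDiff ℝ 1 fun x => c x * M (P x / η) := hc.mul hMP
  have he : ContDiff ℝ 1 (osc t φ) := contDiff_osc (n := 1) hφ
  have hbe : ContDiff ℝ 1 fun x => b x * osc t φ x := hb.mul he
  have hbz : ∀ {r : Plane → ℝ}, HasCompactSupport fun x => r x • (b x * osc t φ x) := fun {r} =>
    hasCompactSupport_of_imp hbc fun x hx => by simp [hx]
  have h0 := hX.2 (fun x => (c x * M (P x / η)) • (b x * osc t φ x)) (hcM.smul hbe) hbz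
  set R : Plane → ℂ := fun x => (c x * M (P x / η)) • (along X b x * osc t φ x)
      + (c x * (M' (P x / η) * (along X P x / η))) • (b x * osc t φ x) with hR
  have hpt : ∀ x, along X (fun x => (c x * M (P x / η)) • (b x * osc t φ x)) x
      = (Complex.I * t * η) * ((c x * (M (P x / η) * (P x / η))) • (b x * osc t φ x)) + R x := by
    intro x
    have hd : ∀ {g : Plane → ℝ}, ContDiff ℝ 1 g → DifferentiableAt ℝ g x := fun hg =>
      hg.differentiable one_ne_zero x
    have hd' : ∀ {g : Plane → ℂ}, ContDiff ℝ 1 g → DifferentiableAt ℝ g x := fun hg =>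
      hg.differentiable one_ne_zero x
    have hat : HasDerivAt (fun s => M (s / η)) (M' (P x / η) * (1 / η)) (P x) :=
      (hM (P x / η)).comp (P x) ((hasDerivAt_id (P x)).div_const η)
    rw [along_smul (hd hcM) (hd' hbe), along_mul (hd hc) (hd hMP), hXc,
      along_comp hat (hd hP), along_mul_complex (hd' hb) (hd' he), along_osc (hd hφ), hφP, hR]
    simp only [smul_eq_mul, Complex.real_smul]
    push_cast
    have : (η : ℂ) ≠ 0 := by exact_mod_cast hη.ne'
    field_simp
    ring
  have hRi : Integrable R := by
    refine Continuous.integrable_of_hasCompactSupport ?_ ?_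
    · refine (hcM.continuous.smul ((continuous_along hX.1 hb).mul he.continuous)).add
        (Continuous.smul (hc.continuous.mul ((hM'.comp (hP.continuous.div_const η)).mul
          ((continuous_along hX.1 hP).div_const η))) hbe.continuous)
    · refine HasCompactSupport.add (hasCompactSupport_of_imp (hasCompactSupport_along (X := X) hbc)
        fun x hx => ?_) hbz
      simp [hx]
  have hi : Integrable fun x => (c x * (M (P x / η) * (P x / η))) • (b x * osc t φ x) := by
    refine Continuous.integrable_of_hasCompactSupport ?_ hbz
    exact Continuous.smul (hc.continuous.mul (hMP.continuous.mul (hP.continuous.div_const η)))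
      hbe.continuous
  have hmain : (Complex.I * t * η) * ∫ x, (c x * (M (P x / η) * (P x / η))) • (b x * osc t φ x)
      = - ∫ x, R x := by
    rw [← integral_const_mul, eq_neg_iff_add_eq_zero, ← integral_add (hi.const_mul _) hRi, ← h0]
    exact integral_congr_ae (.of_forall fun x => (hpt x).symm)
  have hbd : ‖∫ x, R x‖ ≤ ∫ x, (‖along X b x‖
      + 4 * ‖b x‖ * (1 + (P x / η) ^ 2)⁻¹ * (|along X P x| / η)) * c x := by
    refine norm_integral_le_of_norm_le ?_ (.of_forall fun x => ?_)
    · refine Continuous.integrable_of_hasCompactSupport ?_ ?_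
      · have h1 := (contDiff_lorentz (n := 0)).continuous.comp (hP.continuous.div_const η)
        exact ((continuous_along hX.1 hb).norm.add (((continuous_const.mul hb.continuous.norm).mul
          h1).mul ((continuous_along hX.1 hP).abs.div_const η))).mul hc.continuous
      · refine hbc.mono' fun x hx => ?_
        by_contra h
        have h1 : b x = 0 := image_eq_zero_of_notMem_tsupport h
        have h2 : along X b x = 0 := by
          rw [along, fderiv_of_notMem_tsupport ℝ h]; simp
        simp [h1, h2] at hx
    · have hcx := hc0 x
      refine (norm_add_le _ _).trans ?_
      simp only [norm_smul, norm_mul, norm_osc, norm_div, Real.norm_eq_abs, abs_of_nonneg hcx,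
        abs_of_pos hη]
      have k1 := hM1 (P x / η)
      have k2 := hM4 (P x / η)
      have k3 : c x * |M (P x / η)| * (‖along X b x‖ * 1) ≤ ‖along X b x‖ * c x := by
        have : 0 ≤ c x * ‖along X b x‖ := by positivity
        nlinarith
      have k4 : c x * (|M' (P x / η)| * (|along X P x| / η)) * (‖b x‖ * 1)
          ≤ 4 * ‖b x‖ * (1 + (P x / η) ^ 2)⁻¹ * (|along X P x| / η) * c x := by
        have : 0 ≤ c x * ‖b x‖ * (|along X P x| / η) := by positivity
        nlinarith
      rw [add_mul]
      exact add_le_add k3 k4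
  have hn := congrArg norm hmain
  rw [norm_mul, norm_mul, norm_mul, Complex.norm_I, Complex.norm_real, Complex.norm_real, norm_neg,
    Real.norm_eq_abs, Real.norm_eq_abs, abs_of_pos hη, one_mul] at hn
  have hpos : 0 < |t| * η := by positivity
  rw [inv_mul_eq_div, le_div_iff₀ hpos, mul_comm, hn]
  exact hbd

/-! ### Estimates for the phase `f + σ · x` -/

/-- The Lorentzian `1 / (1 + s ^ 2)`. -/
noncomputable def lor (s : ℝ) : ℝ := (1 + s ^ 2)⁻¹

theorem lor_pos (s : ℝ) : 0 < lor s := by unfold lor; positivity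

theorem lor_le_one (s : ℝ) : lor s ≤ 1 := inv_le_one_of_one_le₀ (by nlinarith [sq_nonneg s])

theorem lor_sq_le (s : ℝ) : lor s ^ 2 ≤ lor s := by
  nlinarith [lor_pos s, lor_le_one s]

theorem abs_mul_lor_le (s : ℝ) : |s| * lor s ≤ 1 := by
  unfold lor
  rw [← div_eq_mul_inv, div_le_one (by positivity), ← sq_abs s]
  nlinarith [sq_nonneg (|s| - 1), abs_nonneg s]

theorem abs_mul_lor_abs_le (s : ℝ) : |s * lor s| ≤ 1 := by
  rw [abs_mul, abs_of_pos (lor_pos s)]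
  exact abs_mul_lor_le s

theorem abs_mul_lor_div_le (s : ℝ) {η : ℝ} (hη : 0 < η) : |s| * lor (s / η) ≤ η := by
  have h := abs_mul_lor_le (s / η)
  rw [abs_div, abs_of_pos hη, div_mul_eq_mul_div, div_le_one hη] at h
  exact h

theorem contDiff_lor {n : ℕ∞} : ContDiff ℝ n lor := contDiff_lorentz

theorem hasDerivAt_lor (s : ℝ) : HasDerivAt lor (-(2 * s) * lor s ^ 2) s := by
  have h : HasDerivAt (fun s : ℝ => 1 + s ^ 2) (2 * s) s := by
    simpa using (hasDerivAt_pow 2 s).const_add 1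
  refine (h.fun_inv (by positivity)).congr_deriv ?_
  unfold lor
  field_simp

theorem hasDerivAt_mul_lor (s : ℝ) :
    HasDerivAt (fun s => s * lor s) (lor s - 2 * s ^ 2 * lor s ^ 2) s := by
  refine ((hasDerivAt_id s).mul (hasDerivAt_lor s)).congr_deriv ?_
  simp only [id]
  ring

theorem sq_mul_lor (s : ℝ) : s ^ 2 * lor s = 1 - lor s := by
  unfold lor
  field_simp
  ring

theorem hasDerivAt_mul_lor_add (s : ℝ) :
    HasDerivAt (fun s => s * lor s + s * lor s ^ 2)
      (lor s - 2 * s ^ 2 * lor s ^ 2 + (lor s ^ 2 - 4 * s ^ 2 * lor s ^ 3)) s := by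
  refine ((hasDerivAt_mul_lor s).add
    ((hasDerivAt_id s).mul ((hasDerivAt_lor s).pow 2))).congr_deriv ?_
  simp only [id, Pi.pow_apply]
  ring

theorem abs_deriv_mul_lor_le (s : ℝ) : |lor s - 2 * s ^ 2 * lor s ^ 2| ≤ 4 * lor s := by
  have h1 := lor_pos s
  have h2 := lor_le_one s
  have h3 := sq_mul_lor s
  have h4 : lor s - 2 * s ^ 2 * lor s ^ 2 = lor s * (2 * lor s - 1) := by
    linear_combination (-2 * lor s) * h3
  rw [h4, abs_le]
  constructor <;> nlinarith

theorem abs_deriv_mul_lor_add_le (s : ℝ) :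
    |lor s - 2 * s ^ 2 * lor s ^ 2 + (lor s ^ 2 - 4 * s ^ 2 * lor s ^ 3)| ≤ 4 * lor s := by
  have h1 := lor_pos s
  have h2 := lor_le_one s
  have h3 := sq_mul_lor s
  have h4 : lor s - 2 * s ^ 2 * lor s ^ 2 + (lor s ^ 2 - 4 * s ^ 2 * lor s ^ 3)
      = lor s * (4 * lor s ^ 2 - lor s - 1) := by
    linear_combination (-2 * lor s - 4 * lor s ^ 2) * h3
  rw [h4, abs_le]
  constructor <;> nlinarith [sq_nonneg (lor s)]

/-! ### The phase, its Hamiltonian field and the determinant identity. -/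

section Phase

/-- The derivative of `f` in the direction `v`. -/
noncomputable def dv {F : Type*} [NormedAddCommGroup F] [NormedSpace ℝ F] (v : Plane)
    (f : Plane → F) (x : Plane) : F := fderiv ℝ f x v

/-- The phase `f + σ · x`. -/
noncomputable def phase (f : Plane → ℝ) (σ : Plane) (x : Plane) : ℝ := f x + inner ℝ σ x

/-- The Hamiltonian field of the derivative of `f` in the direction `v`. -/
noncomputable def ham (v v' : Plane) (f : Plane → ℝ) : Plane → Plane := hamField v v' (dv v f)

/-- The determinant of the Hessian of `f` in the frame `v, v'`. -/
noncomputable def hdet (v v' : Plane) (f : Plane → ℝ) (x : Plane) : ℝ :=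
  dv v (dv v f) x * dv v' (dv v' f) x - dv v' (dv v f) x ^ 2

/-- The coefficient of `∂_v φ` in the second derivative of the phase along `ham v v' f`. -/
noncomputable def remCoeff (v v' : Plane) (f : Plane → ℝ) (x : Plane) : ℝ :=
  along (ham v v' f) (dv v (dv v f)) x * dv v' (dv v f) x
    - dv v (dv v f) x * along (ham v v' f) (dv v' (dv v f)) x

theorem contDiff_dv {f : Plane → ℝ} (hf : ContDiff ℝ ∞ f) (v : Plane) : ContDiff ℝ ∞ (dv v f) :=
  contDiff_fderiv_apply (n := ⊤) (m := ⊤) hf le_top v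

theorem two_le_infty : (2 : WithTop ℕ∞) ≤ ((⊤ : ℕ∞) : WithTop ℕ∞) := by
  rw [show (2 : WithTop ℕ∞) = ((2 : ℕ∞) : WithTop ℕ∞) from rfl]
  exact_mod_cast (le_top : (2 : ℕ∞) ≤ ⊤)

theorem ContDiff.one_of_infty {F : Type*} [NormedAddCommGroup F] [NormedSpace ℝ F] {f : Plane → F}
    (hf : ContDiff ℝ ∞ f) : ContDiff ℝ 1 f :=
  hf.of_le (by exact_mod_cast le_top)

theorem contDiff_ham {f : Plane → ℝ} (hf : ContDiff ℝ ∞ f) (v v' : Plane) :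
    ContDiff ℝ ∞ (ham v v' f) :=
  ((contDiff_dv (contDiff_dv hf v) v).smul contDiff_const).sub
    ((contDiff_dv (contDiff_dv hf v) v').smul contDiff_const)

theorem contDiff_along {X : Plane → Plane} {g : Plane → ℝ} (hX : ContDiff ℝ ∞ X)
    (hg : ContDiff ℝ ∞ g) : ContDiff ℝ ∞ (along X g) :=
  (hg.fderiv_right (m := ∞) (by norm_cast)).clm_apply hX

theorem isDivFree_ham {f : Plane → ℝ} (hf : ContDiff ℝ ∞ f) (v v' : Plane) :
    IsDivFree (ham v v' f) :=
  isDivFree_hamField ((contDiff_dv hf v).of_le two_le_infty) v v'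

theorem contDiff_hdet {f : Plane → ℝ} (hf : ContDiff ℝ ∞ f) (v v' : Plane) :
    ContDiff ℝ ∞ (hdet v v' f) :=
  ((contDiff_dv (contDiff_dv hf v) v).mul (contDiff_dv (contDiff_dv hf v') v')).sub
    ((contDiff_dv (contDiff_dv hf v) v').pow 2)

theorem contDiff_remCoeff {f : Plane → ℝ} (hf : ContDiff ℝ ∞ f) (v v' : Plane) :
    ContDiff ℝ ∞ (remCoeff v v' f) :=
  ((contDiff_along (contDiff_ham hf v v') (contDiff_dv (contDiff_dv hf v) v)).mul
    (contDiff_dv (contDiff_dv hf v) v')).sub ((contDiff_dv (contDiff_dv hf v) v).mul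
    (contDiff_along (contDiff_ham hf v v') (contDiff_dv (contDiff_dv hf v) v')))

theorem contDiff_phase {f : Plane → ℝ} (hf : ContDiff ℝ ∞ f) (σ : Plane) :
    ContDiff ℝ ∞ (phase f σ) :=
  hf.add (contDiff_const.inner ℝ contDiff_id)

theorem dv_phase {f : Plane → ℝ} (hf : ContDiff ℝ ∞ f) (σ v : Plane) :
    dv v (phase f σ) = fun x => dv v f x + inner ℝ σ v := by
  ext x
  have h1 : DifferentiableAt ℝ f x := hf.differentiable (by simp) x
  have h2 : HasFDerivAt (fun x : Plane => inner ℝ σ x) (innerSL ℝ σ) x :=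
    (innerSL ℝ σ).hasFDerivAt
  have := (h1.hasFDerivAt.add h2).fderiv
  have h3 : (f + fun x : Plane => inner ℝ σ x) = phase f σ := rfl
  rw [h3] at this
  rw [dv, this]
  simp [dv]

theorem dv_add_const {f : Plane → ℝ} (v : Plane) (c : ℝ) : dv v (fun x => f x + c) = dv v f := by
  ext x
  simp [dv, fderiv_add_const]

theorem along_ham {F : Type*} [NormedAddCommGroup F] [NormedSpace ℝ F] {v v' : Plane}
    {f : Plane → ℝ} {g : Plane → F} {x : Plane} :
    along (ham v v' f) g x = dv v (dv v f) x • dv v' g x - dv v' (dv v f) x • dv v g x :=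
  along_hamField

theorem along_ham_dv_phase {f : Plane → ℝ} (hf : ContDiff ℝ ∞ f) (v v' σ x : Plane) :
    along (ham v v' f) (dv v (phase f σ)) x = 0 := by
  rw [along_ham, dv_phase hf, dv_add_const, dv_add_const, smul_eq_mul, smul_eq_mul]
  ring

theorem dv_comm {f : Plane → ℝ} (hf : ContDiff ℝ ∞ f) (v v' x : Plane) :
    dv v' (dv v f) x = dv v (dv v' f) x :=
  fderiv_fderiv_comm (hf.of_le two_le_infty) v v' x

/-- The field annihilates `∂_v φ` and sends `∂_v' φ` to the Hessian determinant, so applying it to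
`f_vv ∂_v' φ - f_vv' ∂_v φ` produces the determinant and two terms in which the coefficients are
differentiated. -/
theorem along_ham_along_ham_phase {f : Plane → ℝ} (hf : ContDiff ℝ ∞ f) (v v' σ x : Plane) :
    along (ham v v' f) (along (ham v v' f) (phase f σ)) x
      = dv v (dv v f) x * hdet v v' f x
        + along (ham v v' f) (dv v (dv v f)) x * dv v' (phase f σ) x
        - along (ham v v' f) (dv v' (dv v f)) x * dv v (phase f σ) x := by
  have hd : ∀ {g : Plane → ℝ}, ContDiff ℝ ∞ g → DifferentiableAt ℝ g x := fun hg =>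
    hg.differentiable (by simp) x
  have hφ := contDiff_phase hf σ
  have h1 : along (ham v v' f) (phase f σ) = fun y => dv v (dv v f) y * dv v' (phase f σ) y
      + -(dv v' (dv v f) y * dv v (phase f σ) y) := by
    ext y
    rw [along_ham, smul_eq_mul, smul_eq_mul]
    ring
  have c1 := contDiff_dv (contDiff_dv hf v) v
  have c2 := contDiff_dv (contDiff_dv hf v) v'
  have c3 := contDiff_dv hφ v
  have c4 := contDiff_dv hφ v'
  have h3 : along (ham v v' f) (dv v' (phase f σ)) x = hdet v v' f x := by
    rw [along_ham, dv_phase hf, dv_add_const, dv_add_const, smul_eq_mul, smul_eq_mul, hdet,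
      dv_comm hf v v' x]
    ring
  have e1 := along_mul (X := ham v v' f) (hd c1) (hd c4)
  have e2 := along_mul (X := ham v v' f) (hd c2) (hd c3)
  rw [along_ham_dv_phase hf] at e2
  rw [h3] at e1
  rw [h1, along, fderiv_fun_add (hd (c1.mul c4)) (hd (c2.mul c3)).fun_neg, fderiv_fun_neg]
  simp only [along] at e1 e2
  simp only [_root_.add_apply, _root_.neg_apply, e1, e2, along]
  ring

/-- The formula for `XP` contains `∂_v' φ`, which need not be small. Multiplication by `f_vv`
removes it through `f_vv ∂_v' φ = P + f_vv' Y`, leaving only terms with a factor `XP`, `P` or `Y`.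
-/
theorem sq_mul_hdet_eq {f : Plane → ℝ} (hf : ContDiff ℝ ∞ f) (v v' σ x : Plane) :
    dv v (dv v f) x ^ 2 * hdet v v' f x =
      dv v (dv v f) x * along (ham v v' f) (along (ham v v' f) (phase f σ)) x
      - along (ham v v' f) (dv v (dv v f)) x * along (ham v v' f) (phase f σ) x
      - dv v (phase f σ) x * remCoeff v v' f x := by
  rw [along_ham_along_ham_phase hf, remCoeff, along_ham (g := phase f σ), smul_eq_mul, smul_eq_mul]
  ring

/-! ### Integrals over the regions where `∂_v φ` is large or small. -/

variable {f : Plane → ℝ} {v v' σ : Plane}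

/-- The area of `{|∂_v φ| ≲ ρ}`, weighted by `f_vv`, is `O(ρ)`: the sublevel estimate along the
constant field `v`, with a bound that does not depend on `σ`. -/
theorem integral_lor_mul_le (hf : ContDiff ℝ ∞ f) {m : Plane → ℝ} (hm : ContDiff ℝ 1 m)
    (hmc : HasCompactSupport m) {ρ : ℝ} (hρ : 0 < ρ) :
    |∫ x, m x * dv v (dv v f) x * lor (dv v (phase f σ) x / ρ)| ≤ 2 * ρ * ∫ x, |dv v m x| := by
  have h := integral_lorentz_mul_along_le (isDivFree_const v) hm hmc (c := fun _ => 1)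
    contDiff_const (fun x => by simp [along]) (fun _ => zero_le_one)
    (ContDiff.one_of_infty (contDiff_dv (contDiff_phase hf σ) v)) hρ
  simp only [mul_one] at h
  refine le_trans (le_of_eq ?_) h
  congr 2
  ext x
  have : along (fun _ => v) (dv v (phase f σ)) x = dv v (dv v f) x := by
    change dv v (dv v (phase f σ)) x = _
    rw [dv_phase hf, dv_add_const]
  rw [this, lor]
  ring

theorem continuous_lor_comp {g : Plane → ℝ} (hg : Continuous g) (ρ : ℝ) :
    Continuous fun x => lor (g x / ρ) :=
  (contDiff_lor (n := 0)).continuous.comp (hg.div_const ρ)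

/-- Integration by parts along `v`. The error term carries `‖b‖ |f_vv| lor / ρ`: one factor `f_vv`
is bounded by `B`, and the one contained in `m f_vv` is spent on the area estimate, whose `ρ`
cancels the denominator. -/
theorem norm_integral_one_sub_lor_sq_le (hf : ContDiff ℝ ∞ f) {b : Plane → ℂ}
    (hb : ContDiff ℝ 1 b) (hbc : HasCompactSupport b) {m : Plane → ℝ} (hm : ContDiff ℝ 1 m)
    (hmc : HasCompactSupport m) (hbm : ∀ x, ‖b x‖ ≤ m x * dv v (dv v f) x) {B : ℝ}
    (hB : ∀ x, b x ≠ 0 → |dv v (dv v f) x| ≤ B) (hB0 : 0 ≤ B) {ρ t : ℝ} (hρ : 0 < ρ) (ht : t ≠ 0) :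
    ‖∫ x, (1 - lor (dv v (phase f σ) x / ρ) ^ 2) • (b x * osc t (phase f σ) x)‖ ≤
      (|t| * ρ)⁻¹ * (∫ x, ‖dv v b x‖) + (|t| * ρ)⁻¹ * (8 * B * ∫ x, |dv v m x|) := by
  have hφ := contDiff_phase hf σ
  have hY := contDiff_dv hφ v
  have hlor : Continuous lor := (contDiff_lor (n := 0)).continuous
  -- The multiplier `s lor s + s lor² s` is chosen because its product with `s` is `1 - lor² s`.
  have h := norm_integral_osc_le (isDivFree_const v) hasDerivAt_mul_lor_add (by fun_prop)
    (fun s => by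
      have h1 := abs_mul_lor_le s
      have h2 := lor_pos s
      have h3 := lor_le_one s
      have h4 : (s * lor s + s * lor s ^ 2) ^ 2 ≤ 1 := by
        have h5 := sq_mul_lor s
        have : (s * lor s + s * lor s ^ 2) ^ 2 = (1 - lor s) * lor s * (1 + lor s) ^ 2 := by
          rw [← h5]; ring
        rw [this]
        nlinarith [sq_nonneg (lor s - 1/2), sq_nonneg (lor s), mul_pos h2 h2, sq_nonneg (lor s ^2 - 1/2)]
      exact (sq_le_one_iff_abs_le_one _).mp h4)
    abs_deriv_mul_lor_add_le hb hbc (c := fun _ => 1) contDiff_const (fun x => by simp [along])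
    (fun _ => zero_le_one) (ContDiff.one_of_infty hφ) (ContDiff.one_of_infty hY)
    (fun x => rfl) hρ ht
  have e1 : ∀ s : ℝ, (s * lor s + s * lor s ^ 2) * s = 1 - lor s ^ 2 := fun s => by
    linear_combination (1 + lor s) * sq_mul_lor s
  simp only [e1, one_mul, mul_one] at h
  refine h.trans ?_
  rw [← mul_add]
  refine mul_le_mul_of_nonneg_left ?_ (by positivity)
  have hYd : ∀ x, along (fun _ => v) (dv v (phase f σ)) x = dv v (dv v f) x := by
    intro x
    change dv v (dv v (phase f σ)) x = _
    rw [dv_phase hf, dv_add_const]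
  have hlc := continuous_lor_comp hY.continuous ρ
  have hfc : Continuous (dv v (dv v f)) := (contDiff_dv (contDiff_dv hf v) v).continuous
  have hi1 : Integrable fun x => ‖dv v b x‖ :=
    ((continuous_along (X := fun _ => v) continuous_const hb).integrable_of_hasCompactSupport
      (hasCompactSupport_along hbc)).norm
  have hi2 : Integrable fun x => m x * dv v (dv v f) x * lor (dv v (phase f σ) x / ρ) :=
    ((hm.continuous.mul hfc).mul hlc).integrable_of_hasCompactSupport
      (hasCompactSupport_of_imp hmc fun x hx => by simp [hx])
  have hA := integral_lor_mul_le (v := v) (σ := σ) hf hm hmc hρ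
  calc _ ≤ ∫ x, (‖dv v b x‖ + 4 * B / ρ * (m x * dv v (dv v f) x * lor (dv v (phase f σ) x / ρ))) := by
        refine integral_mono_of_nonneg (.of_forall fun x => by positivity)
          (hi1.add (hi2.const_mul _)) (.of_forall fun x => ?_)
        change ‖dv v b x‖ + _ ≤ _
        refine add_le_add le_rfl ?_
        rw [hYd]
        change 4 * ‖b x‖ * lor (dv v (phase f σ) x / ρ) * (|dv v (dv v f) x| / ρ) ≤ _
        rcases eq_or_ne (b x) 0 with h0 | h0
        · have := hbm x
          rw [h0, norm_zero] at this ⊢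
          have := (lor_pos (dv v (phase f σ) x / ρ)).le
          simp only [mul_zero, zero_mul]
          positivity
        · have k1 := hB x h0
          have k2 := hbm x
          have k3 := (lor_pos (dv v (phase f σ) x / ρ)).le
          calc _ = 4 / ρ * lor (dv v (phase f σ) x / ρ) * (‖b x‖ * |dv v (dv v f) x|) := by ring
            _ ≤ 4 / ρ * lor (dv v (phase f σ) x / ρ) * (m x * dv v (dv v f) x * B) := by
                refine mul_le_mul_of_nonneg_left ?_ (by positivity)
                exact mul_le_mul k2 k1 (abs_nonneg _) ((norm_nonneg _).trans k2)
            _ = _ := by ring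
    _ = (∫ x, ‖dv v b x‖) + 4 * B / ρ * ∫ x, m x * dv v (dv v f) x * lor (dv v (phase f σ) x / ρ) := by
        rw [integral_add hi1 (hi2.const_mul _), integral_const_mul]
    _ ≤ _ := by
        have h2 := (le_abs_self _).trans hA
        have : 4 * B / ρ * (∫ x, m x * dv v (dv v f) x * lor (dv v (phase f σ) x / ρ))
            ≤ 4 * B / ρ * (2 * ρ * ∫ x, |dv v m x|) :=
          mul_le_mul_of_nonneg_left h2 (by positivity)
        have e : 4 * B / ρ * (2 * ρ * ∫ x, |dv v m x|) = 8 * B * ∫ x, |dv v m x| := by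
          field_simp; ring
        linarith

theorem along_ham_lor_sq (hf : ContDiff ℝ ∞ f) (ρ : ℝ) (x : Plane) :
    along (ham v v' f) (fun y => lor (dv v (phase f σ) y / ρ) ^ 2) x = 0 := by
  have hY := contDiff_dv (contDiff_phase hf σ) v
  have hat := ((hasDerivAt_lor (dv v (phase f σ) x / ρ)).comp (dv v (phase f σ) x)
    ((hasDerivAt_id _).div_const ρ)).pow 2
  have := along_comp (X := ham v v' f) hat (hY.differentiable (by simp) x)
  rw [along_ham_dv_phase hf, zero_smul] at this
  exact this

theorem contDiff_lor_sq (hf : ContDiff ℝ ∞ f) (ρ : ℝ) :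
    ContDiff ℝ 1 fun y => lor (dv v (phase f σ) y / ρ) ^ 2 :=
  ((contDiff_lor (n := 1)).comp
    ((ContDiff.one_of_infty (contDiff_dv (contDiff_phase hf σ) v)).div_const ρ)).pow 2

/-- The sublevel estimate for an arbitrary function `w` along the Hamiltonian field, restricted to
`{|∂_v φ| ≲ ρ}` by a factor which that field annihilates. -/
theorem integral_lor_sq_mul_lor_le (hf : ContDiff ℝ ∞ f) {m w : Plane → ℝ} (hm : ContDiff ℝ 1 m)
    (hmc : HasCompactSupport m) (hw : ContDiff ℝ ∞ w) {ρ θ : ℝ} (hθ : 0 < θ) :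
    |∫ x, m x * lor (dv v (phase f σ) x / ρ) ^ 2 * lor (w x / θ) * along (ham v v' f) w x| ≤
      2 * θ * ∫ x, |along (ham v v' f) m x| * lor (dv v (phase f σ) x / ρ) ^ 2 :=
  integral_lorentz_mul_along_le (isDivFree_ham hf v v') hm hmc (contDiff_lor_sq hf ρ)
    (along_ham_lor_sq hf ρ) (fun _ => sq_nonneg _) (ContDiff.one_of_infty hw) hθ

/-- The integral is divided according to the size of `P = Xφ` relative to `η`. Where `P` is large,
oscillation along `X` gives the term with `1 / (|t| η)`. Where `P` is small, the amplitude is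
bounded through `sq_mul_hdet_eq`: the `XP` term by the sublevel estimate, the other two by `|P| lor
(P / η) ≤ η` and `|Y| lor (Y / ρ) ≤ ρ`. The cutoff is squared so that one factor `lor (Y / ρ)` can
absorb `Y` and another survives to measure area. -/
theorem norm_integral_lor_sq_le (hf : ContDiff ℝ ∞ f) {b : Plane → ℂ}
    (hb : ContDiff ℝ 1 b) (hbc : HasCompactSupport b) {m : Plane → ℝ} (hm : ContDiff ℝ 1 m)
    (hmc : HasCompactSupport m)
    (hbm : ∀ x, ‖b x‖ ≤ m x * (dv v (dv v f) x ^ 2 * hdet v v' f x))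
    {ρ η t : ℝ} (hρ : 0 < ρ) (hη : 0 < η) (ht : t ≠ 0) :
    ‖∫ x, (lor (dv v (phase f σ) x / ρ) ^ 2) • (b x * osc t (phase f σ) x)‖ ≤
      (|t| * η)⁻¹ * (∫ x, (‖along (ham v v' f) b x‖
        + 4 * ‖b x‖ * (|along (ham v v' f) (along (ham v v' f) (phase f σ)) x| / η))
          * lor (dv v (phase f σ) x / ρ))
      + ∫ x, (2 * η * |along (ham v v' f) (fun y => dv v (dv v f) y * m y) x|
        + η * |m x * along (ham v v' f) (dv v (dv v f)) x| + ρ * |m x * remCoeff v v' f x|)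
          * lor (dv v (phase f σ) x / ρ) := by
  set X := ham v v' f with hX
  set φ := phase f σ with hφd
  set P := along X φ with hPd
  set Y := dv v φ with hYd
  have hφ : ContDiff ℝ ∞ φ := contDiff_phase hf σ
  have hXs : ContDiff ℝ ∞ X := contDiff_ham hf v v'
  have hXd : IsDivFree X := isDivFree_ham hf v v'
  have hP : ContDiff ℝ ∞ P := contDiff_along hXs hφ
  have hY : ContDiff ℝ ∞ Y := contDiff_dv hφ v
  have hc : ContDiff ℝ 1 fun y => lor (Y y / ρ) ^ 2 := contDiff_lor_sq hf ρ
  have hXc : ∀ x, along X (fun y => lor (Y y / ρ) ^ 2) x = 0 := along_ham_lor_sq hf ρ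
  have hlY := continuous_lor_comp hY.continuous ρ
  have hlP := continuous_lor_comp hP.continuous η
  have hlor : Continuous lor := (contDiff_lor (n := 0)).continuous
  have hvv : ContDiff ℝ ∞ (dv v (dv v f)) := contDiff_dv (contDiff_dv hf v) v
  have hR : ContDiff ℝ ∞ (remCoeff v v' f) := contDiff_remCoeff hf v v'
  have he : Continuous (osc t φ) := (contDiff_osc (n := ⊤) hφ).continuous
  have hB : ContDiff ℝ ∞ (along X (dv v (dv v f))) := contDiff_along hXs hvv
  have hPX : Continuous (along X P) := (contDiff_along hXs hP).continuous
  -- the part away from the zeros of `P`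
  have h1 := norm_integral_osc_le hXd hasDerivAt_mul_lor (by fun_prop) abs_mul_lor_abs_le
    abs_deriv_mul_lor_le hb hbc hc hXc (fun _ => sq_nonneg _) (ContDiff.one_of_infty hφ)
    (ContDiff.one_of_infty hP) (fun x => rfl) hη ht
  have e1 : ∀ s : ℝ, s * lor s * s = 1 - lor s := fun s => by
    linear_combination sq_mul_lor s
  simp only [e1] at h1
  have h1' : ‖∫ x, (lor (Y x / ρ) ^ 2 * (1 - lor (P x / η))) • (b x * osc t φ x)‖ ≤
      (|t| * η)⁻¹ * ∫ x, (‖along X b x‖ + 4 * ‖b x‖ * (|along X P x| / η)) * lor (Y x / ρ) := by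
    refine h1.trans (mul_le_mul_of_nonneg_left ?_ (by positivity))
    refine integral_mono_of_nonneg (.of_forall fun x => by positivity) ?_ (.of_forall fun x => ?_)
    · refine Continuous.integrable_of_hasCompactSupport ?_ ?_
      · exact ((continuous_along hXd.1 hb).norm.add ((continuous_const.mul hb.continuous.norm).mul
          (hPX.abs.div_const η))).mul hlY
      · refine hbc.mono' fun x hx => ?_
        by_contra h
        have h1 : b x = 0 := image_eq_zero_of_notMem_tsupport h
        have h2 : along X b x = 0 := by
          rw [along, fderiv_of_notMem_tsupport ℝ h]; simp
        simp [h1, h2] at hx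
    · have k1 := lor_le_one (P x / η)
      have k2 := lor_pos (P x / η)
      have k3 := lor_pos (Y x / ρ)
      refine mul_le_mul (add_le_add le_rfl ?_) (lor_sq_le _) (sq_nonneg _) (by positivity)
      change 4 * ‖b x‖ * lor (P x / η) * (|along X P x| / η) ≤ _
      have : 0 ≤ 4 * ‖b x‖ * (|along X P x| / η) := by positivity
      nlinarith
  -- the part near the zeros of `P`
  have hvm : ContDiff ℝ 1 fun y => dv v (dv v f) y * m y := (ContDiff.one_of_infty hvv).mul hm
  have hvmc : HasCompactSupport fun y => dv v (dv v f) y * m y :=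
    hasCompactSupport_of_imp hmc fun x hx => by simp [hx]
  have h2 := integral_lorentz_mul_along_le hXd hvm hvmc hc hXc (fun _ => sq_nonneg _)
    (ContDiff.one_of_infty hP) hη
  have hzero : ∀ {g : Plane → ℝ}, Continuous g → Integrable fun x => m x * g x := fun hg =>
    (hm.continuous.mul hg).integrable_of_hasCompactSupport
      (hasCompactSupport_of_imp hmc fun x hx => by simp [hx])
  have hi1 : Integrable fun x => |along X (fun y => dv v (dv v f) y * m y) x| * lor (Y x / ρ) :=
    Continuous.integrable_of_hasCompactSupport ((continuous_along hXd.1 hvm).abs.mul hlY)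
      (hasCompactSupport_of_imp (hasCompactSupport_along (X := X) hvmc) fun x hx => by simp [hx])
  have hi2 : Integrable fun x => |m x * along X (dv v (dv v f)) x| * lor (Y x / ρ) := by
    refine Continuous.integrable_of_hasCompactSupport
      ((hm.continuous.mul hB.continuous).abs.mul hlY)
      (hasCompactSupport_of_imp hmc fun x hx => by simp [hx])
  have hi3 : Integrable fun x => |m x * remCoeff v v' f x| * lor (Y x / ρ) := by
    refine Continuous.integrable_of_hasCompactSupport
      ((hm.continuous.mul hR.continuous).abs.mul hlY)
      (hasCompactSupport_of_imp hmc fun x hx => by simp [hx])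
  have hi4 : Integrable fun x => m x * (dv v (dv v f) x * lor (Y x / ρ) ^ 2 * lor (P x / η)
      * along X P x) :=
    hzero (((hvv.continuous.mul (hlY.pow 2)).mul hlP).mul hPX)
  have hi5 : Integrable fun x => η * (|m x * along X (dv v (dv v f)) x| * lor (Y x / ρ))
      + ρ * (|m x * remCoeff v v' f x| * lor (Y x / ρ)) :=
    (hi2.const_mul η).add (hi3.const_mul ρ)
  have h3 : ‖∫ x, (lor (Y x / ρ) ^ 2 * lor (P x / η)) • (b x * osc t φ x)‖ ≤
      ∫ x, (m x * (dv v (dv v f) x * lor (Y x / ρ) ^ 2 * lor (P x / η) * along X P x)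
        + (η * (|m x * along X (dv v (dv v f)) x| * lor (Y x / ρ))
          + ρ * (|m x * remCoeff v v' f x| * lor (Y x / ρ)))) := by
    refine norm_integral_le_of_norm_le (hi4.add hi5) (.of_forall fun x => ?_)
    have k2 := lor_pos (P x / η)
    have k3 := lor_pos (Y x / ρ)
    have k4 := lor_le_one (P x / η)
    have k5 := lor_sq_le (Y x / ρ)
    have kP := abs_mul_lor_div_le (P x) hη
    have kY := abs_mul_lor_div_le (Y x) hρ
    rw [norm_smul, norm_mul (b x), norm_osc, mul_one, Real.norm_eq_abs, abs_of_pos (by positivity)]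
    have hk := sq_mul_hdet_eq hf v v' σ x
    have hb1 := hbm x
    rw [hk] at hb1
    change ‖b x‖ ≤ m x * (dv v (dv v f) x * along X P x - along X (dv v (dv v f)) x * P x
      - Y x * remCoeff v v' f x) at hb1
    set l1 := lor (Y x / ρ)
    set l2 := lor (P x / η)
    set r := remCoeff v v' f x
    set B := along X (dv v (dv v f)) x
    have k6 : l1 ^ 2 * l2 * -(m x * (B * P x)) ≤ η * (|m x * B| * l1) := by
      calc l1 ^ 2 * l2 * -(m x * (B * P x)) ≤ l1 ^ 2 * l2 * |m x * (B * P x)| :=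
            mul_le_mul_of_nonneg_left (neg_le_abs _) (by positivity)
        _ = |m x * B| * l1 ^ 2 * (|P x| * l2) := by
            rw [← mul_assoc (m x), abs_mul (m x * B)]; ring
        _ ≤ |m x * B| * l1 * η := by
            refine mul_le_mul (mul_le_mul_of_nonneg_left k5 (abs_nonneg _)) kP (by positivity)
              (by positivity)
        _ = _ := by ring
    have k7 : l1 ^ 2 * l2 * -(m x * (Y x * r)) ≤ ρ * (|m x * r| * l1) := by
      calc l1 ^ 2 * l2 * -(m x * (Y x * r)) ≤ l1 ^ 2 * l2 * |m x * (Y x * r)| :=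
            mul_le_mul_of_nonneg_left (neg_le_abs _) (by positivity)
        _ = |m x * r| * l1 * (|Y x| * l1) * l2 := by
            rw [abs_mul, abs_mul, abs_mul]; ring
        _ ≤ |m x * r| * l1 * ρ * 1 := by
            refine mul_le_mul (mul_le_mul_of_nonneg_left kY (by positivity)) k4 k2.le
              (by positivity)
        _ = _ := by ring
    have k8 := mul_le_mul_of_nonneg_left hb1 (show 0 ≤ l1 ^ 2 * l2 by positivity)
    nlinarith
  rw [integral_add hi4 hi5] at h3
  have h4 : ∫ x, m x * (dv v (dv v f) x * lor (Y x / ρ) ^ 2 * lor (P x / η) * along X P x)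
      ≤ 2 * η * ∫ x, |along X (fun y => dv v (dv v f) y * m y) x| * lor (Y x / ρ) := by
    refine le_trans (le_of_eq ?_) ((le_abs_self _).trans (h2.trans ?_))
    · congr 1
      ext x
      simp only [lor]
      ring
    · refine mul_le_mul_of_nonneg_left (integral_mono_of_nonneg (.of_forall fun x => by positivity)
        hi1 (.of_forall fun x => ?_)) (by positivity)
      exact mul_le_mul_of_nonneg_left (lor_sq_le _) (abs_nonneg _)
  have hsplit : ∫ x, (lor (Y x / ρ) ^ 2) • (b x * osc t φ x)
      = (∫ x, (lor (Y x / ρ) ^ 2 * (1 - lor (P x / η))) • (b x * osc t φ x))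
        + ∫ x, (lor (Y x / ρ) ^ 2 * lor (P x / η)) • (b x * osc t φ x) := by
    have hI : ∀ {g : Plane → ℝ}, Continuous g → Integrable fun x => g x • (b x * osc t φ x) :=
      fun hg => Continuous.integrable_of_hasCompactSupport (hg.smul (hb.continuous.mul he))
        (hasCompactSupport_of_imp hbc fun x hx => by simp [hx])
    rw [← integral_add (hI (g := fun x => lor (Y x / ρ) ^ 2 * (1 - lor (P x / η))) (by fun_prop))
      (hI (g := fun x => lor (Y x / ρ) ^ 2 * lor (P x / η)) (by fun_prop))]
    congr 1
    ext x
    rw [← add_smul]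
    congr 1
    ring
  rw [hsplit]
  refine (norm_add_le _ _).trans (add_le_add h1' (h3.trans ?_))
  have e5 : ∫ x, (2 * η * |along X (fun y => dv v (dv v f) y * m y) x|
        + η * |m x * along X (dv v (dv v f)) x| + ρ * |m x * remCoeff v v' f x|) * lor (Y x / ρ)
      = 2 * η * (∫ x, |along X (fun y => dv v (dv v f) y * m y) x| * lor (Y x / ρ))
        + ∫ x, (η * (|m x * along X (dv v (dv v f)) x| * lor (Y x / ρ))
          + ρ * (|m x * remCoeff v v' f x| * lor (Y x / ρ))) := by
    rw [← integral_const_mul, ← integral_add (hi1.const_mul _) hi5]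
    congr 1
    ext x
    ring
  rw [e5]
  exact add_le_add h4 le_rfl

end Phase

/-! ### Weights localized to dyadic strips -/

/-- Smooth functions with values in `[0, 1]` supported in `[1/4, 4]`. -/
structure IsProfile (ζ : ℝ → ℝ) : Prop where
  smooth : ContDiff ℝ ∞ ζ
  nonneg : ∀ z, 0 ≤ ζ z
  le_one : ∀ z, ζ z ≤ 1
  supp : ∀ z, ζ z ≠ 0 → 1 / 4 ≤ z ∧ z ≤ 4

/-- Smooth cutoff functions with values in `[0, 1]` and compact support in `U`. -/
structure IsCutoff (κ : Plane → ℝ) (U : Set Plane) : Prop where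
  smooth : ContDiff ℝ ∞ κ
  compact : HasCompactSupport κ
  supp : tsupport κ ⊆ U
  nonneg : ∀ x, 0 ≤ κ x
  le_one : ∀ x, κ x ≤ 1

theorem IsProfile.sq {ζ : ℝ → ℝ} (hζ : IsProfile ζ) : IsProfile fun z => ζ z ^ 2 where
  smooth := hζ.smooth.pow 2
  nonneg _ := sq_nonneg _
  le_one z := pow_le_one₀ (hζ.nonneg z) (hζ.le_one z)
  supp z hz := hζ.supp z fun h => hz (by simp [h])

theorem IsCutoff.sq {κ : Plane → ℝ} {U : Set Plane} (hκ : IsCutoff κ U) :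
    IsCutoff (fun x => κ x ^ 2) U where
  smooth := hκ.smooth.pow 2
  compact := hasCompactSupport_of_imp hκ.compact fun x hx => by simp [hx]
  supp := by
    refine (closure_mono fun x hx => ?_).trans hκ.supp
    simp only [Function.mem_support] at hx ⊢
    exact fun h => hx (by simp [h])
  nonneg _ := sq_nonneg _
  le_one z := pow_le_one₀ (hκ.nonneg z) (hκ.le_one z)

theorem exists_bound_tsupport {F : Type*} [NormedAddCommGroup F] {κ : Plane → ℝ}
    (hκ : HasCompactSupport κ) {g : Plane → F} (hg : Continuous g) :
    ∃ C, 0 ≤ C ∧ ∀ x ∈ tsupport κ, ‖g x‖ ≤ C := by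
  obtain ⟨C, hC⟩ := hκ.isCompact.exists_bound_of_continuousOn hg.continuousOn
  exact ⟨max C 0, le_max_right _ _, fun x hx => (hC x hx).trans (le_max_left _ _)⟩

theorem mem_tsupport_of_ne {κ : Plane → ℝ} {x : Plane} (h : κ x ≠ 0) : x ∈ tsupport κ :=
  subset_tsupport κ h

/-- The profile `ζ ^ 2 z ^ (-l)`. -/
noncomputable def profilePow (ζ : ℝ → ℝ) (l : ℕ) (z : ℝ) : ℝ := ζ z ^ 2 * (z⁻¹) ^ l

theorem IsProfile.exists_bound_deriv {ζ : ℝ → ℝ} (hζ : IsProfile ζ) :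
    ∃ C, 0 ≤ C ∧ ∀ z, |deriv ζ z| ≤ C := by
  have hc : HasCompactSupport ζ := by
    refine HasCompactSupport.of_support_subset_isCompact (isCompact_Icc (a := (1 / 4 : ℝ)) (b := 4)) ?_
    intro z hz
    exact hζ.supp z hz
  obtain ⟨C, hC⟩ := hc.deriv.exists_bound_of_continuous (hζ.smooth.continuous_deriv (by simp))
  exact ⟨C, (norm_nonneg _).trans (hC 0), hC⟩

theorem hasDerivAt_profilePow {ζ : ℝ → ℝ} (hζ : IsProfile ζ) (l : ℕ) {z : ℝ} (hz : z ≠ 0) :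
    HasDerivAt (profilePow ζ l)
      (2 * ζ z * deriv ζ z * (z⁻¹) ^ l - l * ζ z ^ 2 * (z⁻¹) ^ (l + 1)) z := by
  have h1 := (hζ.smooth.differentiable (by simp) z).hasDerivAt
  have h2 : HasDerivAt (fun z : ℝ => (z⁻¹) ^ l) (l * (z⁻¹) ^ (l - 1) * (-(z ^ 2)⁻¹)) z :=
    (hasDerivAt_inv hz).pow l
  refine ((h1.pow 2).mul h2).congr_deriv ?_
  rcases l with _ | l
  · simp
  · simp only [Pi.pow_apply, Nat.add_sub_cancel]
    rw [← inv_pow]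
    push_cast
    ring

theorem profilePow_eventually_zero {ζ : ℝ → ℝ} (hζ : IsProfile ζ) (l : ℕ) {z : ℝ} (hz : z < 1 / 4) :
    profilePow ζ l =ᶠ[𝓝 z] fun _ => 0 := by
  filter_upwards [Iio_mem_nhds hz] with y hy
  have : ζ y = 0 := by
    by_contra h
    exact absurd (hζ.supp y h).1 (not_le.mpr hy)
  simp [profilePow, this]

theorem contDiff_profilePow {ζ : ℝ → ℝ} (hζ : IsProfile ζ) (l : ℕ) :
    ContDiff ℝ 1 (profilePow ζ l) := by
  rw [contDiff_iff_contDiffAt]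
  intro z
  rcases eq_or_ne z 0 with rfl | hz
  · exact contDiffAt_const.congr_of_eventuallyEq (profilePow_eventually_zero hζ l (by norm_num))
  · exact (((hζ.smooth.of_le (by exact_mod_cast le_top)).contDiffAt).pow 2).mul
      ((contDiffAt_inv ℝ hz).pow l)

/-- The profile enters squared so that its derivative `2 ζ ζ'` is still dominated by `ζ`. Negative
powers of `z` are harmless because `z ≥ 1/4` on the support. -/
theorem exists_profilePow_bound {ζ : ℝ → ℝ} (hζ : IsProfile ζ) (l : ℕ) :
    ∃ C, 0 ≤ C ∧ ∀ z, |profilePow ζ l z| ≤ C * ζ z ∧ |deriv (profilePow ζ l) z| ≤ C * ζ z := by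
  obtain ⟨C, hC0, hC⟩ := hζ.exists_bound_deriv
  refine ⟨4 ^ l + (2 * C * 4 ^ l + l * 4 ^ (l + 1)), by positivity, fun z => ?_⟩
  have h0 := hζ.nonneg z
  have h1 := hζ.le_one z
  rcases lt_or_ge z (1 / 4) with hz | hz
  · have hz0 : ζ z = 0 := by
      by_contra h
      exact absurd (hζ.supp z h).1 (not_le.mpr hz)
    rw [(profilePow_eventually_zero hζ l hz).deriv_eq, (profilePow_eventually_zero hζ l hz).eq_of_nhds]
    simp [hz0]
  · have hzp : 0 < z := by linarith
    have hi : z⁻¹ ≤ 4 := by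
      rw [inv_le_comm₀ hzp (by norm_num)]
      linarith
    have hi0 : 0 ≤ z⁻¹ := by positivity
    have hl : ∀ j : ℕ, (z⁻¹) ^ j ≤ 4 ^ j := fun j => pow_le_pow_left₀ hi0 hi j
    have hl0 : ∀ j : ℕ, 0 ≤ (z⁻¹) ^ j := fun j => by positivity
    have hsq : ζ z ^ 2 ≤ ζ z := by nlinarith
    have ka : ζ z ^ 2 * (z⁻¹) ^ l ≤ ζ z * 4 ^ l := mul_le_mul hsq (hl l) (hl0 l) h0
    have kb : 2 * ζ z * |deriv ζ z| * (z⁻¹) ^ l ≤ 2 * ζ z * C * 4 ^ l :=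
      mul_le_mul (mul_le_mul_of_nonneg_left (hC z) (by positivity)) (hl l) (hl0 l) (by positivity)
    have kc : l * ζ z ^ 2 * (z⁻¹) ^ (l + 1) ≤ l * ζ z * 4 ^ (l + 1) :=
      mul_le_mul (mul_le_mul_of_nonneg_left hsq (by positivity)) (hl _) (hl0 _) (by positivity)
    have p1 : 0 ≤ ζ z * 4 ^ l := by positivity
    have p2 : 0 ≤ 2 * ζ z * C * 4 ^ l := by positivity
    have p3 : 0 ≤ l * ζ z * 4 ^ (l + 1) := by positivity
    constructor
    · rw [profilePow, abs_of_nonneg (by positivity)]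
      linarith
    · rw [(hasDerivAt_profilePow hζ l hzp.ne').deriv]
      refine (abs_sub _ _).trans ?_
      rw [abs_mul, abs_mul, abs_mul, abs_mul, abs_mul, abs_of_nonneg h0, abs_of_nonneg (hl0 l),
        abs_of_nonneg (hl0 (l + 1)), abs_of_nonneg (sq_nonneg (ζ z)), abs_two, Nat.abs_cast]
      linarith

/-- The weight `κ ^ 2 h ζ(w / θ) ^ 2 (w / θ) ^ (-l)`. -/
noncomputable def wt (κ : Plane → ℝ) (ζ : ℝ → ℝ) (h w : Plane → ℝ) (l : ℕ) (θ : ℝ) (x : Plane) : ℝ :=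
  κ x ^ 2 * h x * profilePow ζ l (w x / θ)

theorem fderiv_comp_div {g : ℝ → ℝ} (hg : ContDiff ℝ 1 g) {w : Plane → ℝ} (hw : ContDiff ℝ 1 w)
    (θ : ℝ) (x : Plane) :
    HasFDerivAt (fun y => g (w y / θ)) ((deriv g (w x / θ) * θ⁻¹) • fderiv ℝ w x) x := by
  have h1 : HasDerivAt g (deriv g (w x / θ)) (w x / θ) :=
    (hg.differentiable one_ne_zero _).hasDerivAt
  have h2 : HasFDerivAt (fun y => w y / θ) (θ⁻¹ • fderiv ℝ w x) x := by
    simpa [div_eq_mul_inv] using (hw.differentiable one_ne_zero x).hasFDerivAt.mul_const θ⁻¹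
  have := h1.comp_hasFDerivAt x h2
  rwa [smul_smul] at this

theorem wt_spec {κ : Plane → ℝ} {U : Set Plane} (hκ : IsCutoff κ U) {ζ : ℝ → ℝ} (hζ : IsProfile ζ)
    {h w : Plane → ℝ} (hh : ContDiff ℝ 1 h) (hw : ContDiff ℝ 1 w) (l : ℕ) (θ : ℝ) :
    ContDiff ℝ 1 (wt κ ζ h w l θ) ∧ HasCompactSupport (wt κ ζ h w l θ) := by
  refine ⟨?_, hasCompactSupport_of_imp hκ.compact fun x hx => by simp [wt, hx]⟩
  exact (((ContDiff.one_of_infty hκ.smooth).pow 2).mul hh).mul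
    ((contDiff_profilePow hζ l).comp (hw.div_const θ))

/-- A derivative costs one factor `1 / θ`. Because the weight contains squares of both cutoffs, it
and its derivative are controlled by the cutoffs themselves, so later integrals remain on the strip.
-/
theorem exists_wt_bound {κ : Plane → ℝ} {U : Set Plane} (hκ : IsCutoff κ U) {ζ : ℝ → ℝ}
    (hζ : IsProfile ζ) {h w : Plane → ℝ} (hh : ContDiff ℝ 1 h) (hw : ContDiff ℝ 1 w) (l : ℕ) :
    ∃ C, 0 ≤ C ∧ ∀ θ, 0 < θ → θ ≤ 1 → ∀ x,
      |wt κ ζ h w l θ x| ≤ C * (κ x * ζ (w x / θ)) ∧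
      ‖fderiv ℝ (wt κ ζ h w l θ) x‖ ≤ C * θ⁻¹ * (κ x * ζ (w x / θ)) := by
  obtain ⟨C, hC0, hC⟩ := exists_profilePow_bound hζ l
  have hκ1 := ContDiff.one_of_infty hκ.smooth
  obtain ⟨c1, c10, h1⟩ := exists_bound_tsupport hκ.compact hh.continuous
  obtain ⟨c2, c20, h2⟩ := exists_bound_tsupport hκ.compact (hh.continuous_fderiv one_ne_zero)
  obtain ⟨c3, c30, h3⟩ := exists_bound_tsupport hκ.compact (hw.continuous_fderiv one_ne_zero)
  obtain ⟨c4, c40, h4⟩ := exists_bound_tsupport hκ.compact (hκ1.continuous_fderiv one_ne_zero)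
  refine ⟨c1 * C + (c1 * C * c3 + (2 * c1 * c4 + c2) * C), by positivity, fun θ hθ hθ1 x => ?_⟩
  have k0 := hκ.nonneg x
  have k1 := hκ.le_one x
  have z0 := hζ.nonneg (w x / θ)
  have hθi : 1 ≤ θ⁻¹ := (one_le_inv₀ hθ).mpr hθ1
  obtain ⟨g1, g2⟩ := hC (w x / θ)
  by_cases hx : κ x = 0
  · have hfd : HasFDerivAt (wt κ ζ h w l θ) (0 : Plane →L[ℝ] ℝ) x := by
      have a1 := ((hκ1.differentiable one_ne_zero x).hasFDerivAt.pow 2).mul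
        (hh.differentiable one_ne_zero x).hasFDerivAt
      have a2 := a1.mul (fderiv_comp_div (contDiff_profilePow hζ l) hw θ x)
      refine a2.congr_fderiv ?_
      simp [hx]
    rw [hfd.fderiv]
    simp [wt, hx]
  have hm := mem_tsupport_of_ne hx
  have b1 := h1 x hm
  have b2 := h2 x hm
  have b3 := h3 x hm
  have b4 := h4 x hm
  rw [Real.norm_eq_abs] at b1
  have hsq : κ x ^ 2 ≤ κ x := by nlinarith
  have hval : |wt κ ζ h w l θ x| ≤ c1 * C * (κ x * ζ (w x / θ)) := by
    rw [wt, abs_mul, abs_mul, abs_of_nonneg (sq_nonneg (κ x))]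
    calc κ x ^ 2 * |h x| * |profilePow ζ l (w x / θ)| ≤ κ x * c1 * (C * ζ (w x / θ)) := by gcongr
      _ = _ := by ring
  constructor
  · refine hval.trans (mul_le_mul_of_nonneg_right ?_ (by positivity))
    have : 0 ≤ c1 * C * c3 + (2 * c1 * c4 + c2) * C := by positivity
    linarith
  · have a1 := ((hκ1.differentiable one_ne_zero x).hasFDerivAt.pow 2).mul
      (hh.differentiable one_ne_zero x).hasFDerivAt
    have a2 : HasFDerivAt (wt κ ζ h w l θ) _ x :=
      a1.mul (fderiv_comp_div (contDiff_profilePow hζ l) hw θ x)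
    rw [a2.fderiv]
    simp only [Nat.add_one_sub_one, pow_one, Pi.mul_apply, two_nsmul, ← two_mul]
    refine (norm_add_le _ _).trans ?_
    rw [norm_smul, norm_smul, norm_smul]
    simp only [norm_mul, norm_pow, Real.norm_eq_abs, abs_of_nonneg k0, abs_inv, abs_of_pos hθ]
    have e1 : κ x ^ 2 * |h x| * (|deriv (profilePow ζ l) (w x / θ)| * θ⁻¹ * ‖fderiv ℝ w x‖)
        ≤ κ x * c1 * (C * ζ (w x / θ) * θ⁻¹ * c3) := by gcongr
    have e2 : |profilePow ζ l (w x / θ)| * ‖κ x ^ 2 • fderiv ℝ h x + h x • (2 * κ x) • fderiv ℝ κ x‖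
        ≤ C * ζ (w x / θ) * (κ x * c2 + c1 * (2 * κ x) * c4) := by
      gcongr
      refine (norm_add_le _ _).trans ?_
      rw [norm_smul, norm_smul, norm_smul, Real.norm_eq_abs, Real.norm_eq_abs, Real.norm_eq_abs,
        abs_of_nonneg (sq_nonneg (κ x)), abs_of_nonneg (by positivity : 0 ≤ 2 * κ x), ← mul_assoc]
      gcongr
    have e3 : C * ζ (w x / θ) * (κ x * c2 + c1 * (2 * κ x) * c4)
        ≤ C * ζ (w x / θ) * (κ x * c2 + c1 * (2 * κ x) * c4) * θ⁻¹ :=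
      le_mul_of_one_le_right (by positivity) hθi
    have e4 : 0 ≤ c1 * C * θ⁻¹ * (κ x * ζ (w x / θ)) := by positivity
    have e5 : κ x * c1 * (C * ζ (w x / θ) * θ⁻¹ * c3)
        + C * ζ (w x / θ) * (κ x * c2 + c1 * (2 * κ x) * c4) * θ⁻¹
        + c1 * C * θ⁻¹ * (κ x * ζ (w x / θ))
        = (c1 * C + (c1 * C * c3 + (2 * c1 * c4 + c2) * C)) * θ⁻¹ * (κ x * ζ (w x / θ)) := by ring
    linarith

/-! ### Oscillatory integrals over dyadic strips -/

/-- Near a point, `∂_v² f` and the Hessian determinant of `f` are powers of `w` up to units. -/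
structure LocalData (f w u p q : Plane → ℝ) (v v' : Plane) (k M : ℕ) (U : Set Plane) : Prop where
  smooth_f : ContDiff ℝ ∞ f
  smooth_w : ContDiff ℝ ∞ w
  smooth_u : ContDiff ℝ ∞ u
  smooth_p : ContDiff ℝ ∞ p
  smooth_q : ContDiff ℝ ∞ q
  dvv_eq : ∀ x ∈ U, dv v (dv v f) x = w x ^ k * u x
  unit : ∀ x ∈ U, u x * p x = 1
  hdet_mul : ∀ x ∈ U, hdet v v' f x * q x = w x ^ M
  abs_le : ∀ x ∈ U, |w x| ≤ 1

/-- An amplitude adapted to the strip `w ~ θ`. -/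
structure IsPiece (κ : Plane → ℝ) (ζ : ℝ → ℝ) (w : Plane → ℝ) (θ B : ℝ) (b : Plane → ℂ) :
    Prop where
  smooth : ContDiff ℝ 1 b
  supp : ∀ x ∈ tsupport b, κ x = 1 ∧ ζ (w x / θ) = 1
  bound : ∀ x, ‖b x‖ ≤ B
  dbound : ∀ x, ‖fderiv ℝ b x‖ ≤ B * θ⁻¹

variable {f w u p q : Plane → ℝ} {v v' : Plane} {k M : ℕ} {U : Set Plane} {κ : Plane → ℝ}
  {ζ : ℝ → ℝ} {θ B : ℝ} {b : Plane → ℂ}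

theorem IsPiece.nonneg (hb : IsPiece κ ζ w θ B b) : 0 ≤ B := (norm_nonneg _).trans (hb.bound 0)

theorem IsPiece.compact (hb : IsPiece κ ζ w θ B b) (hκ : IsCutoff κ U) : HasCompactSupport b := by
  refine hκ.compact.of_isClosed_subset (isClosed_tsupport _) fun x hx => ?_
  exact mem_tsupport_of_ne (by rw [(hb.supp x hx).1]; exact one_ne_zero)

/-- A piece lives where both cutoffs equal one, so the cutoffs may be replaced by any of their
powers. -/
theorem IsPiece.sq (hb : IsPiece κ ζ w θ B b) :
    IsPiece (fun x => κ x ^ 2) (fun z => ζ z ^ 2) w θ B b where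
  smooth := hb.smooth
  supp x hx := by simp [(hb.supp x hx).1, (hb.supp x hx).2]
  bound := hb.bound
  dbound := hb.dbound

theorem IsPiece.norm_le (hb : IsPiece κ ζ w θ B b) (hκ : IsCutoff κ U) (hζ : IsProfile ζ)
    (x : Plane) : ‖b x‖ ≤ B * (κ x * ζ (w x / θ)) := by
  by_cases hx : x ∈ tsupport b
  · rw [(hb.supp x hx).1, (hb.supp x hx).2, mul_one, mul_one]
    exact hb.bound x
  · rw [image_eq_zero_of_notMem_tsupport hx, norm_zero]
    exact mul_nonneg hb.nonneg (mul_nonneg (hκ.nonneg x) (hζ.nonneg _))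

theorem IsPiece.norm_fderiv_le (hb : IsPiece κ ζ w θ B b) (hθ : 0 < θ) (hκ : IsCutoff κ U)
    (hζ : IsProfile ζ) (x : Plane) : ‖fderiv ℝ b x‖ ≤ B * θ⁻¹ * (κ x * ζ (w x / θ)) := by
  by_cases hx : x ∈ tsupport b
  · rw [(hb.supp x hx).1, (hb.supp x hx).2, mul_one, mul_one]
    exact hb.dbound x
  · rw [fderiv_of_notMem_tsupport ℝ hx, norm_zero]
    have := hb.nonneg
    exact mul_nonneg (by positivity) (mul_nonneg (hκ.nonneg x) (hζ.nonneg _))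

/-- The weight realizes the quotient of the squared cutoffs by `g` without dividing by a function
that vanishes on `{w = 0}`: `1 / g` is `h w^(-l)`, and on the strip `w^(-l)` is `θ^(-l)` times a
smooth profile. -/
theorem wt_mul_eq (hκ : IsCutoff κ U) (hζ : IsProfile ζ) {g h : Plane → ℝ} {l : ℕ}
    (hgh : ∀ x ∈ U, g x * h x = w x ^ l) (hθ : 0 < θ) (x : Plane) :
    (θ⁻¹) ^ l * wt κ ζ h w l θ x * g x = κ x ^ 2 * ζ (w x / θ) ^ 2 := by
  rw [wt, profilePow]
  by_cases hx : κ x = 0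
  · simp [hx]
  by_cases hz : ζ (w x / θ) = 0
  · simp [hz]
  have hU := hκ.supp (mem_tsupport_of_ne hx)
  have hpos : 0 < w x / θ := by linarith [(hζ.supp _ hz).1]
  have hw0 : w x ≠ 0 := fun h => by simp [h] at hpos
  have e : (θ⁻¹) ^ l * ((w x / θ)⁻¹) ^ l * w x ^ l = 1 := by
    rw [← mul_pow, ← mul_pow]
    have : θ⁻¹ * (w x / θ)⁻¹ * w x = 1 := by field_simp
    rw [this, one_pow]
  calc _ = κ x ^ 2 * ζ (w x / θ) ^ 2 * ((θ⁻¹) ^ l * ((w x / θ)⁻¹) ^ l * (g x * h x)) := by ring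
    _ = _ := by rw [hgh x hU, e, mul_one]

theorem LocalData.dvv_mul (hD : LocalData f w u p q v v' k M U) (x : Plane) (hx : x ∈ U) :
    dv v (dv v f) x * p x = w x ^ k := by
  rw [hD.dvv_eq x hx, mul_assoc, hD.unit x hx, mul_one]

theorem LocalData.sq_hdet_mul (hD : LocalData f w u p q v v' k M U) (x : Plane) (hx : x ∈ U) :
    (dv v (dv v f) x ^ 2 * hdet v v' f x) * (p x ^ 2 * q x) = w x ^ (2 * k + M) := by
  rw [pow_add, ← hD.hdet_mul x hx, mul_comm 2 k, pow_mul, ← hD.dvv_mul x hx]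
  ring

theorem continuous_strip (hκ : IsCutoff κ U) (hζ : IsProfile ζ) (hw : Continuous w) (θ : ℝ) :
    Continuous fun x => κ x * ζ (w x / θ) :=
  hκ.smooth.continuous.mul (hζ.smooth.continuous.comp (hw.div_const θ))

theorem integrable_strip (hκ : IsCutoff κ U) (hζ : IsProfile ζ) (hw : Continuous w) (θ : ℝ) :
    Integrable fun x => κ x * ζ (w x / θ) :=
  (continuous_strip hκ hζ hw θ).integrable_of_hasCompactSupport
    (hasCompactSupport_of_imp hκ.compact fun x hx => by simp [hx])

theorem strip_nonneg (hκ : IsCutoff κ U) (hζ : IsProfile ζ) (w : Plane → ℝ) (θ : ℝ) (x : Plane) :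
    0 ≤ κ x * ζ (w x / θ) := mul_nonneg (hκ.nonneg x) (hζ.nonneg _)

theorem integral_strip_nonneg (hκ : IsCutoff κ U) (hζ : IsProfile ζ) (w : Plane → ℝ) (θ : ℝ) :
    0 ≤ ∫ x, κ x * ζ (w x / θ) := integral_nonneg fun x => strip_nonneg hκ hζ w θ x

theorem exists_integral_strip_le_const (hκ : IsCutoff κ U) (hζ : IsProfile ζ) (hw : Continuous w) :
    ∃ C, 0 ≤ C ∧ ∀ θ : ℝ, ∫ x, κ x * ζ (w x / θ) ≤ C := by
  refine ⟨∫ x, κ x, integral_nonneg hκ.nonneg, fun θ => ?_⟩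
  refine integral_mono (integrable_strip hκ hζ hw θ)
    (hκ.smooth.continuous.integrable_of_hasCompactSupport hκ.compact) fun x => ?_
  exact mul_le_of_le_one_right (hκ.nonneg x) (hζ.le_one _)

theorem IsProfile.le_lor {ζ : ℝ → ℝ} (hζ : IsProfile ζ) (z : ℝ) : ζ z ≤ 17 * lor z := by
  by_cases h : ζ z = 0
  · rw [h]; have := lor_pos z; positivity
  · obtain ⟨h1, h2⟩ := hζ.supp z h
    refine (hζ.le_one z).trans ?_
    -- The constant is `1 + 4²`, as `z ≤ 4` on the support.
    rw [lor, ← div_eq_mul_inv, le_div_iff₀ (by positivity)]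
    nlinarith

/-- Strips of width `θ` transversal to `v` have area `O(θ)`. -/
theorem exists_integral_strip_le (hκ : IsCutoff κ U) (hζ : IsProfile ζ) (hw : ContDiff ℝ ∞ w)
    {r : Plane → ℝ} (hr : ContDiff ℝ ∞ r) (hwr : ∀ x ∈ U, dv v w x * r x = 1) :
    ∃ C, 0 ≤ C ∧ ∀ θ : ℝ, 0 < θ → ∫ x, κ x * ζ (w x / θ) ≤ C * θ := by
  have hm : ContDiff ℝ 1 fun x => κ x * r x := ContDiff.one_of_infty (hκ.smooth.mul hr)
  have hmc : HasCompactSupport fun x => κ x * r x :=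
    hasCompactSupport_of_imp hκ.compact fun x hx => by simp [hx]
  refine ⟨17 * (2 * ∫ x, |along (fun _ => v) (fun x => κ x * r x) x| * 1),
    by positivity, fun θ hθ => ?_⟩
  have h := integral_lorentz_mul_along_le (isDivFree_const v) hm hmc (c := fun _ => 1)
    contDiff_const (fun x => by simp [along]) (fun _ => zero_le_one) (ContDiff.one_of_infty hw) hθ
  have e : ∀ x, κ x * r x * 1 * (1 + (w x / θ) ^ 2)⁻¹ * along (fun _ => v) w x
      = κ x * lor (w x / θ) := by
    intro x
    by_cases hx : κ x = 0
    · simp [hx]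
    have := hwr x (hκ.supp (mem_tsupport_of_ne hx))
    change κ x * r x * 1 * lor (w x / θ) * dv v w x = _
    linear_combination κ x * lor (w x / θ) * this
  simp only [e] at h
  have hl := continuous_lor_comp hw.continuous θ
  calc ∫ x, κ x * ζ (w x / θ) ≤ ∫ x, 17 * (κ x * lor (w x / θ)) := by
        refine integral_mono (integrable_strip hκ hζ hw.continuous θ)
          (((hκ.smooth.continuous.mul hl).integrable_of_hasCompactSupport
            (hasCompactSupport_of_imp hκ.compact fun x hx => by simp [hx])).const_mul 17)
          fun x => ?_
        have := mul_le_mul_of_nonneg_left (hζ.le_lor (w x / θ)) (hκ.nonneg x)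
        linarith
    _ = 17 * ∫ x, κ x * lor (w x / θ) := integral_const_mul _ _
    _ ≤ 17 * (2 * θ * ∫ x, |along (fun _ => v) (fun x => κ x * r x) x| * 1) := by
        linarith [(le_abs_self _).trans h]
    _ = _ := by ring

/-- The derivative in direction `v` of the weight that compensates `∂_v² f`. -/
theorem exists_integral_dv_wt_le (hκ : IsCutoff κ U) (hζ : IsProfile ζ) (hp : ContDiff ℝ ∞ p)
    (hw : ContDiff ℝ ∞ w) (k : ℕ) (v : Plane) :
    ∃ C, 0 ≤ C ∧ ∀ θ : ℝ, 0 < θ → θ ≤ 1 →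
      ∫ x, |dv v (fun y => (θ⁻¹) ^ k * wt κ ζ p w k θ y) x|
        ≤ C * (θ⁻¹) ^ (k + 1) * ∫ x, κ x * ζ (w x / θ) := by
  obtain ⟨C, hC0, hC⟩ := exists_wt_bound hκ hζ (ContDiff.one_of_infty hp)
    (ContDiff.one_of_infty hw) k
  refine ⟨C * ‖v‖, by positivity, fun θ hθ hθ1 => ?_⟩
  have hs := wt_spec hκ hζ (ContDiff.one_of_infty hp) (ContDiff.one_of_infty hw) k θ
  rw [← integral_const_mul]
  refine integral_mono_of_nonneg (.of_forall fun x => abs_nonneg _)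
    ((integrable_strip hκ hζ hw.continuous θ).const_mul _) (.of_forall fun x => ?_)
  change |dv v (fun y => (θ⁻¹) ^ k * wt κ ζ p w k θ y) x| ≤ _
  have hd := hs.1.differentiable one_ne_zero x
  rw [dv, fderiv_const_mul hd]
  simp only [smul_apply, smul_eq_mul, abs_mul, abs_pow, abs_inv, abs_of_pos hθ]
  have h1 : |fderiv ℝ (wt κ ζ p w k θ) x v| ≤ C * θ⁻¹ * (κ x * ζ (w x / θ)) * ‖v‖ :=
    ((fderiv ℝ (wt κ ζ p w k θ) x).le_opNorm v).trans
      (mul_le_mul_of_nonneg_right (hC θ hθ hθ1 x).2 (norm_nonneg _))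
  calc _ ≤ (θ⁻¹) ^ k * (C * θ⁻¹ * (κ x * ζ (w x / θ)) * ‖v‖) := by gcongr
    _ = _ := by ring

/-- The sublevel estimate for `∂_v φ`, with `f_vv ~ θ^k` divided out. The loss is `θ^(-k)` from the
division and `1 / θ` from differentiating the strip cutoff. -/
theorem LocalData.exists_area_le (hD : LocalData f w u p q v v' k M U) (hκ : IsCutoff κ U)
    (hζ : IsProfile ζ) :
    ∃ C, 0 ≤ C ∧ ∀ θ : ℝ, 0 < θ → θ ≤ 1 → ∀ (σ : Plane) (ρ : ℝ), 0 < ρ →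
      ∫ x, κ x ^ 2 * ζ (w x / θ) ^ 2 * lor (dv v (phase f σ) x / ρ) ≤
        C * ρ * (θ⁻¹) ^ (k + 1) * ∫ x, κ x * ζ (w x / θ) := by
  obtain ⟨C, hC0, hC⟩ := exists_integral_dv_wt_le hκ hζ hD.smooth_p hD.smooth_w k v
  refine ⟨2 * C, by positivity, fun θ hθ hθ1 σ ρ hρ => ?_⟩
  have hs := wt_spec hκ hζ (ContDiff.one_of_infty hD.smooth_p) (ContDiff.one_of_infty hD.smooth_w)
    k θ
  have h := integral_lor_mul_le (v := v) (σ := σ) hD.smooth_f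
    (m := fun y => (θ⁻¹) ^ k * wt κ ζ p w k θ y) (contDiff_const.mul hs.1)
    (hasCompactSupport_of_imp hs.2 fun x hx => by simp [hx]) hρ
  simp only [wt_mul_eq hκ hζ hD.dvv_mul hθ] at h
  refine ((le_abs_self _).trans h).trans ?_
  calc _ ≤ 2 * ρ * (C * (θ⁻¹) ^ (k + 1) * ∫ x, κ x * ζ (w x / θ)) :=
        mul_le_mul_of_nonneg_left (hC θ hθ hθ1) (by positivity)
    _ = _ := by ring

theorem IsPiece.norm_integral_lor_le (hb : IsPiece κ ζ w θ B b) (hκ : IsCutoff κ U)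
    (hζ : IsProfile ζ) (hf : ContDiff ℝ ∞ f) (hw : ContDiff ℝ ∞ w) (v σ : Plane) (ρ t : ℝ) :
    ‖∫ x, (lor (dv v (phase f σ) x / ρ) ^ 2) • (b x * osc t (phase f σ) x)‖ ≤
      B * ∫ x, κ x ^ 2 * ζ (w x / θ) ^ 2 * lor (dv v (phase f σ) x / ρ) := by
  have hY := (contDiff_dv (contDiff_phase hf σ) v).continuous
  have hl := continuous_lor_comp hY ρ
  rw [← integral_const_mul]
  refine norm_integral_le_of_norm_le ?_ (.of_forall fun x => ?_)
  · refine (Continuous.integrable_of_hasCompactSupport ?_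
      (hasCompactSupport_of_imp hκ.compact fun x hx => by simp [hx])).const_mul B
    exact (((hκ.smooth.continuous.pow 2).mul
      ((hζ.smooth.continuous.comp (hw.continuous.div_const θ)).pow 2)).mul hl)
  · have h1 := hb.sq.norm_le hκ.sq hζ.sq x
    have h2 := lor_pos (dv v (phase f σ) x / ρ)
    rw [norm_smul, norm_mul, norm_osc, mul_one, Real.norm_eq_abs, abs_of_nonneg (sq_nonneg _)]
    calc _ ≤ lor (dv v (phase f σ) x / ρ) * (B * (κ x ^ 2 * ζ (w x / θ) ^ 2)) :=
          mul_le_mul (lor_sq_le _) h1 (norm_nonneg _) h2.le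
      _ = _ := by ring

/-- The part of a piece away from the zeros of `∂_v φ`. -/
theorem LocalData.exists_piece_one_sub_le (hD : LocalData f w u p q v v' k M U)
    (hκ : IsCutoff κ U) (hζ : IsProfile ζ) :
    ∃ C, 0 ≤ C ∧ ∀ θ B : ℝ, 0 < θ → θ ≤ 1 → ∀ b, IsPiece κ ζ w θ B b →
      ∀ (σ : Plane) (ρ t : ℝ), 0 < ρ → t ≠ 0 →
      ‖∫ x, (1 - lor (dv v (phase f σ) x / ρ) ^ 2) • (b x * osc t (phase f σ) x)‖ ≤
        C * B * (|t| * ρ)⁻¹ * (θ⁻¹ * ∫ x, κ x * ζ (w x / θ)) := by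
  obtain ⟨C, hC0, hC⟩ := exists_integral_dv_wt_le hκ hζ hD.smooth_p hD.smooth_w k v
  obtain ⟨c, hc0, hc⟩ := exists_bound_tsupport hκ.compact hD.smooth_u.continuous
  refine ⟨‖v‖ + 8 * (4 ^ k * c) * C, by positivity, fun θ B hθ hθ1 b hb σ ρ t hρ ht => ?_⟩
  have hB := hb.nonneg
  have hs := wt_spec hκ hζ (ContDiff.one_of_infty hD.smooth_p) (ContDiff.one_of_infty hD.smooth_w)
    k θ
  have hm1 : ContDiff ℝ 1 fun y => (θ⁻¹) ^ k * wt κ ζ p w k θ y := contDiff_const.mul hs.1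
  have h := norm_integral_one_sub_lor_sq_le (v := v) (σ := σ) hD.smooth_f hb.smooth (hb.compact hκ)
    (m := fun y => B * ((θ⁻¹) ^ k * wt κ ζ p w k θ y)) (contDiff_const.mul hm1)
    (hasCompactSupport_of_imp hs.2 fun x hx => by simp [hx])
    (fun x => by
      rw [mul_assoc B, wt_mul_eq hκ hζ hD.dvv_mul hθ]
      exact hb.sq.norm_le hκ.sq hζ.sq x)
    -- On the strip `w ≤ 4 θ`, so `|f_vv|` is `O(θ^k)`. This compensates the `θ^(-k)` of the weight,
    -- and the final bound loses only `1 / θ`.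
    (B := (4 * θ) ^ k * c) (fun x hx => by
      have hxs := hb.supp x (subset_tsupport b hx)
      have hκx := mem_tsupport_of_ne (κ := κ) (x := x) (by rw [hxs.1]; exact one_ne_zero)
      obtain ⟨z1, z2⟩ := hζ.supp _ (by rw [hxs.2]; exact one_ne_zero)
      have hw4 : w x ≤ 4 * θ := by rwa [div_le_iff₀ hθ] at z2
      have hw0 : 0 ≤ w x := by
        rw [le_div_iff₀ hθ] at z1
        linarith
      rw [hD.dvv_eq x (hκ.supp hκx), abs_mul, abs_pow, abs_of_nonneg hw0]
      exact mul_le_mul (pow_le_pow_left₀ hw0 hw4 k) (hc x hκx) (abs_nonneg _) (by positivity))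
    (by positivity) hρ ht
  refine h.trans ?_
  set I := ∫ x, κ x * ζ (w x / θ) with hI
  have hI0 : 0 ≤ I := integral_strip_nonneg hκ hζ w θ
  have e1 : ∫ x, ‖dv v b x‖ ≤ ‖v‖ * B * (θ⁻¹ * I) := by
    have : ‖v‖ * B * (θ⁻¹ * I) = ∫ x, ‖v‖ * B * θ⁻¹ * (κ x * ζ (w x / θ)) := by
      rw [integral_const_mul, hI]; ring
    rw [this]
    refine integral_mono_of_nonneg (.of_forall fun x => norm_nonneg _)
      ((integrable_strip hκ hζ hD.smooth_w.continuous θ).const_mul _) (.of_forall fun x => ?_)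
    calc ‖dv v b x‖ ≤ ‖fderiv ℝ b x‖ * ‖v‖ := (fderiv ℝ b x).le_opNorm v
      _ ≤ B * θ⁻¹ * (κ x * ζ (w x / θ)) * ‖v‖ :=
          mul_le_mul_of_nonneg_right (hb.norm_fderiv_le hθ hκ hζ x) (norm_nonneg _)
      _ = _ := by ring
  have e2 : ∫ x, |dv v (fun y => B * ((θ⁻¹) ^ k * wt κ ζ p w k θ y)) x|
      ≤ B * (C * (θ⁻¹) ^ (k + 1) * I) := by
    have : ∀ x, |dv v (fun y => B * ((θ⁻¹) ^ k * wt κ ζ p w k θ y)) x|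
        = B * |dv v (fun y => (θ⁻¹) ^ k * wt κ ζ p w k θ y) x| := by
      intro x
      rw [dv, fderiv_const_mul (hm1.differentiable one_ne_zero x)]
      simp only [smul_apply, smul_eq_mul, abs_mul, abs_of_nonneg hB]
      rfl
    simp only [this]
    rw [integral_const_mul]
    exact mul_le_mul_of_nonneg_left (hC θ hθ hθ1) hB
  have e3 : 8 * ((4 * θ) ^ k * c) * (B * (C * (θ⁻¹) ^ (k + 1) * I))
      = 8 * (4 ^ k * c) * C * B * (θ⁻¹ * I) := by
    have : θ ^ k * (θ⁻¹) ^ (k + 1) = θ⁻¹ := by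
      rw [pow_succ, ← mul_assoc, ← mul_pow, mul_inv_cancel₀ hθ.ne', one_pow, one_mul]
    rw [mul_pow]
    linear_combination (8 * 4 ^ k * c * B * C * I) * this
  have e4 := mul_le_mul_of_nonneg_left e2 (show 0 ≤ 8 * ((4 * θ) ^ k * c) by positivity)
  rw [← mul_add]
  calc _ ≤ (|t| * ρ)⁻¹ * (‖v‖ * B * (θ⁻¹ * I) + 8 * (4 ^ k * c) * C * B * (θ⁻¹ * I)) :=
        mul_le_mul_of_nonneg_left (by linarith) (by positivity)
    _ = _ := by ring

theorem exists_bound_along_ham {F : Type*} [NormedAddCommGroup F] [NormedSpace ℝ F]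
    (hκ : IsCutoff κ U) (hf : ContDiff ℝ ∞ f) (v v' : Plane) :
    ∃ C, 0 ≤ C ∧ ∀ x ∈ tsupport κ, ∀ g : Plane → F,
      ‖along (ham v v' f) g x‖ ≤ C * ‖fderiv ℝ g x‖ := by
  obtain ⟨C, h0, h⟩ := exists_bound_tsupport hκ.compact (contDiff_ham hf v v').continuous
  refine ⟨C, h0, fun x hx g => norm_along_le.trans ?_⟩
  rw [mul_comm]
  exact mul_le_mul_of_nonneg_right (h x hx) (norm_nonneg _)

/-- The parameter `σ` enters `X(Xφ)` only through the first derivatives of the phase, so boundedness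
of `σ` suffices for a uniform bound. -/
theorem exists_bound_along_along (hκ : IsCutoff κ U) (hf : ContDiff ℝ ∞ f) (v v' : Plane) (R : ℝ) :
    ∃ C, 0 ≤ C ∧ ∀ x ∈ tsupport κ, ∀ σ : Plane, ‖σ‖ ≤ R →
      |along (ham v v' f) (along (ham v v' f) (phase f σ)) x| ≤ C := by
  have hX := contDiff_ham hf v v'
  have c1 := contDiff_dv (contDiff_dv hf v) v
  have c2 := contDiff_dv (contDiff_dv hf v) v'
  obtain ⟨A1, p1, h1⟩ := exists_bound_tsupport hκ.compact (c1.mul (contDiff_hdet hf v v')).continuous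
  obtain ⟨A2, p2, h2⟩ := exists_bound_tsupport hκ.compact (contDiff_along hX c1).continuous
  obtain ⟨A3, p3, h3⟩ := exists_bound_tsupport hκ.compact (contDiff_along hX c2).continuous
  obtain ⟨A4, p4, h4⟩ := exists_bound_tsupport hκ.compact (contDiff_dv hf v).continuous
  obtain ⟨A5, p5, h5⟩ := exists_bound_tsupport hκ.compact (contDiff_dv hf v').continuous
  refine ⟨A1 + A2 * (A5 + |R| * ‖v'‖) + A3 * (A4 + |R| * ‖v‖), by positivity,
    fun x hx σ hσ => ?_⟩
  rw [along_ham_along_ham_phase hf, dv_phase hf, dv_phase hf]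
  have hσR : ‖σ‖ ≤ |R| := hσ.trans (le_abs_self R)
  have i1 : |dv v' f x + inner ℝ σ v'| ≤ A5 + |R| * ‖v'‖ :=
    (abs_add_le _ _).trans (add_le_add (h5 x hx) ((abs_real_inner_le_norm σ v').trans
      (mul_le_mul_of_nonneg_right hσR (norm_nonneg _))))
  have i2 : |dv v f x + inner ℝ σ v| ≤ A4 + |R| * ‖v‖ :=
    (abs_add_le _ _).trans (add_le_add (h4 x hx) ((abs_real_inner_le_norm σ v).trans
      (mul_le_mul_of_nonneg_right hσR (norm_nonneg _))))
  refine (abs_sub _ _).trans (add_le_add ((abs_add_le _ _).trans (add_le_add (h1 x hx) ?_)) ?_)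
  · rw [abs_mul]
    exact mul_le_mul (h2 x hx) i1 (abs_nonneg _) p2
  · rw [abs_mul]
    exact mul_le_mul (h3 x hx) i2 (abs_nonneg _) p3

set_option maxHeartbeats 1000000 in
/-- The part of a piece near the zeros of `∂_v φ`. -/
theorem LocalData.exists_piece_lor_le (hD : LocalData f w u p q v v' k M U)
    (hκ : IsCutoff κ U) (hζ : IsProfile ζ) (R : ℝ) :
    ∃ C, 0 ≤ C ∧ ∀ θ B : ℝ, 0 < θ → θ ≤ 1 → ∀ b, IsPiece κ ζ w θ B b →
      ∀ σ : Plane, ‖σ‖ ≤ R → ∀ ρ η t : ℝ, 0 < ρ → 0 < η → η ≤ 1 → t ≠ 0 →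
      ‖∫ x, (lor (dv v (phase f σ) x / ρ) ^ 2) • (b x * osc t (phase f σ) x)‖ ≤
        C * B * (θ⁻¹) ^ (2 * k + M + 1) * ((|t| * η ^ 2)⁻¹ + η + ρ) *
          ∫ x, κ x ^ 2 * ζ (w x / θ) ^ 2 * lor (dv v (phase f σ) x / ρ) := by
  have hf := hD.smooth_f
  have hw := hD.smooth_w
  have hX := contDiff_ham hf v v'
  have hvv := contDiff_dv (contDiff_dv hf v) v
  have hh : ContDiff ℝ 1 fun x => p x ^ 2 * q x :=
    ContDiff.one_of_infty ((hD.smooth_p.pow 2).mul hD.smooth_q)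
  have hvv1 := ContDiff.one_of_infty hvv
  -- With cutoffs that are already squared, the weight is bounded by `κ² ζ²`, the same density as in
  -- the integral on the right of the claim. The exponent `2k + M` is the order in `w` of `f_vv² det
  -- D²f`.
  obtain ⟨C, hC0, hC⟩ := exists_wt_bound hκ.sq hζ.sq hh (ContDiff.one_of_infty hw) (2 * k + M)
  obtain ⟨a1, a10, h1⟩ := exists_bound_along_ham (F := ℝ) hκ hf v v'
  obtain ⟨a1', a10', h1'⟩ := exists_bound_along_ham (F := ℂ) hκ hf v v'
  obtain ⟨a2, a20, h2⟩ := exists_bound_along_along hκ hf v v' R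
  obtain ⟨a3, a30, h3⟩ := exists_bound_tsupport hκ.compact hvv.continuous
  obtain ⟨a4, a40, h4⟩ := exists_bound_tsupport hκ.compact (contDiff_along hX hvv).continuous
  obtain ⟨a5, a50, h5⟩ := exists_bound_tsupport hκ.compact (contDiff_remCoeff hf v v').continuous
  refine ⟨(a1' + 4 * a2) + (2 * (a3 * a1 * C + C * a4) + C * a4 + C * a5), by positivity,
    fun θ B hθ hθ1 b hb σ hσ ρ η t hρ hη hη1 ht => ?_⟩
  have hB := hb.nonneg
  have hθi : 1 ≤ θ⁻¹ := (one_le_inv₀ hθ).mpr hθ1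
  have hηi : 1 ≤ η⁻¹ := (one_le_inv₀ hη).mpr hη1
  set l := 2 * k + M with hl
  have hs := wt_spec hκ.sq hζ.sq hh (ContDiff.one_of_infty hw) l θ
  set g : Plane → ℝ := wt (fun x => κ x ^ 2) (fun z => ζ z ^ 2) (fun x => p x ^ 2 * q x) w l θ with hg
  have hm1 : ContDiff ℝ 1 fun y => B * ((θ⁻¹) ^ l * g y) := contDiff_const.mul (contDiff_const.mul hs.1)
  have hY := (contDiff_dv (contDiff_phase hf σ) v).continuous
  have hlo := continuous_lor_comp hY ρ
  have hmain := norm_integral_lor_sq_le (v := v) (v' := v') (σ := σ) hf hb.smooth (hb.compact hκ)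
    (m := fun y => B * ((θ⁻¹) ^ l * g y)) hm1
    (hasCompactSupport_of_imp hs.2 fun x hx => by simp [hx])
    (fun x => by
      rw [mul_assoc B, wt_mul_eq hκ.sq hζ.sq hD.sq_hdet_mul hθ]
      exact hb.sq.sq.norm_le hκ.sq.sq hζ.sq.sq x) hρ hη ht
  refine hmain.trans ?_
  set J := ∫ x, κ x ^ 2 * ζ (w x / θ) ^ 2 * lor (dv v (phase f σ) x / ρ) with hJ
  have hJi : Integrable fun x => κ x ^ 2 * ζ (w x / θ) ^ 2 * lor (dv v (phase f σ) x / ρ) := by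
    refine Continuous.integrable_of_hasCompactSupport ?_
      (hasCompactSupport_of_imp hκ.compact fun x hx => by simp [hx])
    exact (((hκ.smooth.continuous.pow 2).mul
      ((hζ.smooth.continuous.comp (hw.continuous.div_const θ)).pow 2)).mul hlo)
  have hJ0 : 0 ≤ J := integral_nonneg fun x => by
    have := lor_pos (dv v (phase f σ) x / ρ)
    positivity
  have hpw : θ⁻¹ ≤ (θ⁻¹) ^ (l + 1) := le_self_pow₀ hθi (by omega)
  have hpl : (θ⁻¹) ^ l ≤ (θ⁻¹) ^ (l + 1) := pow_le_pow_right₀ hθi (by omega)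
  -- the non-stationary term
  have e1 : ∫ x, (‖along (ham v v' f) b x‖
        + 4 * ‖b x‖ * (|along (ham v v' f) (along (ham v v' f) (phase f σ)) x| / η))
          * lor (dv v (phase f σ) x / ρ) ≤ (a1' + 4 * a2) * B * θ⁻¹ * η⁻¹ * J := by
    rw [hJ, ← integral_const_mul]
    refine integral_mono_of_nonneg (.of_forall fun x => ?_) (hJi.const_mul _) (.of_forall fun x => ?_)
    · have := lor_pos (dv v (phase f σ) x / ρ)
      positivity
    have hlp := lor_pos (dv v (phase f σ) x / ρ)
    by_cases hx : x ∈ tsupport κ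
    · have k1 : ‖along (ham v v' f) b x‖ ≤ a1' * (B * θ⁻¹ * (κ x ^ 2 * ζ (w x / θ) ^ 2)) :=
        (h1' x hx b).trans (mul_le_mul_of_nonneg_left (hb.sq.norm_fderiv_le hθ hκ.sq hζ.sq x) a10')
      have k2 : ‖b x‖ ≤ B * (κ x ^ 2 * ζ (w x / θ) ^ 2) := hb.sq.norm_le hκ.sq hζ.sq x
      have k3 := h2 x hx σ hσ
      set S := κ x ^ 2 * ζ (w x / θ) ^ 2 with hS
      have hS0 : 0 ≤ S := by positivity
      have k4 : a1' * (B * θ⁻¹ * S) ≤ a1' * B * θ⁻¹ * η⁻¹ * S := by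
        have : 0 ≤ a1' * B * θ⁻¹ * S := by positivity
        nlinarith
      have k5 : 4 * ‖b x‖ * (|along (ham v v' f) (along (ham v v' f) (phase f σ)) x| / η)
          ≤ 4 * a2 * B * θ⁻¹ * η⁻¹ * S := by
        calc _ ≤ 4 * (B * S) * (a2 / η) := by gcongr
          _ = 4 * a2 * B * 1 * η⁻¹ * S := by ring
          _ ≤ _ := by gcongr
      calc _ ≤ (a1' * B * θ⁻¹ * η⁻¹ * S + 4 * a2 * B * θ⁻¹ * η⁻¹ * S)
            * lor (dv v (phase f σ) x / ρ) :=
            mul_le_mul_of_nonneg_right (add_le_add (k1.trans k4) k5) hlp.le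
        _ = _ := by ring
    · have hx0 : κ x = 0 := image_eq_zero_of_notMem_tsupport hx
      have hbx := hb.norm_le hκ hζ x
      have hbx' := hb.norm_fderiv_le hθ hκ hζ x
      rw [hx0, zero_mul, mul_zero] at hbx hbx'
      have z1 : ‖b x‖ = 0 := le_antisymm hbx (norm_nonneg _)
      have z2 : ‖along (ham v v' f) b x‖ = 0 := by
        refine le_antisymm (norm_along_le.trans ?_) (norm_nonneg _)
        nlinarith [norm_nonneg (ham v v' f x), norm_nonneg (fderiv ℝ b x)]
      simp [z1, z2, hx0]
  -- the stationary term
  have e2 : ∫ x, (2 * η * |along (ham v v' f) (fun y => dv v (dv v f) y * (B * ((θ⁻¹) ^ l * g y))) x|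
        + η * |B * ((θ⁻¹) ^ l * g x) * along (ham v v' f) (dv v (dv v f)) x|
        + ρ * |B * ((θ⁻¹) ^ l * g x) * remCoeff v v' f x|)
          * lor (dv v (phase f σ) x / ρ) ≤
      (2 * (a3 * a1 * C + C * a4) + C * a4 + C * a5) * B * (θ⁻¹) ^ (l + 1) * (η + ρ) * J := by
    rw [hJ, ← integral_const_mul]
    refine integral_mono_of_nonneg (.of_forall fun x => ?_) (hJi.const_mul _) (.of_forall fun x => ?_)
    · have := lor_pos (dv v (phase f σ) x / ρ)
      positivity
    have hlp := lor_pos (dv v (phase f σ) x / ρ)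
    have hgx := (hC θ hθ hθ1 x).1
    have hgx' := (hC θ hθ hθ1 x).2
    rw [← hg] at hgx hgx'
    have hmul := along_mul (X := ham v v' f) (hvv1.differentiable one_ne_zero x)
      (hm1.differentiable one_ne_zero x)
    have hfd : along (ham v v' f) (fun y => B * ((θ⁻¹) ^ l * g y)) x
        = B * (θ⁻¹) ^ l * along (ham v v' f) g x := by
      have : (fun y => B * ((θ⁻¹) ^ l * g y)) = fun y => (B * (θ⁻¹) ^ l) * g y := by
        ext y; ring
      rw [this, along, fderiv_const_mul (hs.1.differentiable one_ne_zero x)]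
      simp [along]
    beta_reduce
    rw [hmul, hfd]
    set S := κ x ^ 2 * ζ (w x / θ) ^ 2 with hS
    have hS0 : 0 ≤ S := by positivity
    by_cases hx : x ∈ tsupport κ
    · have b3 := h3 x hx
      have b4 := h4 x hx
      have b5 := h5 x hx
      rw [Real.norm_eq_abs] at b3 b4 b5
      have k1 : |along (ham v v' f) g x| ≤ a1 * (C * θ⁻¹ * S) :=
        (h1 x hx g).trans (mul_le_mul_of_nonneg_left hgx' a10)
      have hBl : 0 ≤ B * (θ⁻¹) ^ l := by positivity
      have m1 : |B * ((θ⁻¹) ^ l * g x)| ≤ C * B * (θ⁻¹) ^ (l + 1) * S := by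
        rw [← mul_assoc, abs_mul, abs_of_nonneg hBl]
        calc _ ≤ B * (θ⁻¹) ^ (l + 1) * (C * S) := by gcongr
          _ = _ := by ring
      have m2 : |dv v (dv v f) x * (B * (θ⁻¹) ^ l * along (ham v v' f) g x)
          + along (ham v v' f) (dv v (dv v f)) x * (B * ((θ⁻¹) ^ l * g x))|
          ≤ (a3 * a1 * C + C * a4) * B * (θ⁻¹) ^ (l + 1) * S := by
        refine (abs_add_le _ _).trans ?_
        rw [abs_mul, abs_mul (B * (θ⁻¹) ^ l), abs_of_nonneg hBl, abs_mul (along _ _ _)]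
        calc _ ≤ a3 * (B * (θ⁻¹) ^ l * (a1 * (C * θ⁻¹ * S))) + a4 * (C * B * (θ⁻¹) ^ (l + 1) * S) := by
              gcongr
          _ = _ := by ring
      have m3 : |B * ((θ⁻¹) ^ l * g x) * along (ham v v' f) (dv v (dv v f)) x|
          ≤ C * a4 * B * (θ⁻¹) ^ (l + 1) * S := by
        rw [abs_mul]
        calc _ ≤ C * B * (θ⁻¹) ^ (l + 1) * S * a4 := by gcongr
          _ = _ := by ring
      have m4 : |B * ((θ⁻¹) ^ l * g x) * remCoeff v v' f x|
          ≤ C * a5 * B * (θ⁻¹) ^ (l + 1) * S := by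
        rw [abs_mul]
        calc _ ≤ C * B * (θ⁻¹) ^ (l + 1) * S * a5 := by gcongr
          _ = _ := by ring
      set T := B * (θ⁻¹) ^ (l + 1) * S with hT
      have hT0 : 0 ≤ T := by positivity
      calc _ ≤ (2 * η * ((a3 * a1 * C + C * a4) * B * (θ⁻¹) ^ (l + 1) * S)
            + η * (C * a4 * B * (θ⁻¹) ^ (l + 1) * S) + ρ * (C * a5 * B * (θ⁻¹) ^ (l + 1) * S))
            * lor (dv v (phase f σ) x / ρ) := by gcongr
        _ = ((2 * (a3 * a1 * C + C * a4) + C * a4) * η + C * a5 * ρ) * T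
            * lor (dv v (phase f σ) x / ρ) := by rw [hT]; ring
        _ ≤ ((2 * (a3 * a1 * C + C * a4) + C * a4) * (η + ρ) + C * a5 * (η + ρ)) * T
            * lor (dv v (phase f σ) x / ρ) := by
              gcongr
              · linarith
              · linarith
        _ = _ := by rw [hT]; ring
    · have hx0 : κ x = 0 := image_eq_zero_of_notMem_tsupport hx
      have hS' : S = 0 := by rw [hS, hx0]; ring
      rw [hS', mul_zero] at hgx hgx'
      have z1 : g x = 0 := abs_eq_zero.mp (le_antisymm hgx (abs_nonneg _))
      have z2 : along (ham v v' f) g x = 0 := by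
        have : fderiv ℝ g x = 0 := norm_eq_zero.mp (le_antisymm hgx' (norm_nonneg _))
        simp [along, this]
      simp [z1, z2, hS']
  have e3 := mul_le_mul_of_nonneg_left e1 (show 0 ≤ (|t| * η)⁻¹ by positivity)
  have htη : (|t| * η)⁻¹ * η⁻¹ = (|t| * η ^ 2)⁻¹ := by
    rw [← mul_inv]; ring_nf
  have e4 : (|t| * η)⁻¹ * ((a1' + 4 * a2) * B * θ⁻¹ * η⁻¹ * J)
      ≤ (a1' + 4 * a2) * B * (θ⁻¹) ^ (l + 1) * (|t| * η ^ 2)⁻¹ * J := by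
    calc _ = (a1' + 4 * a2) * B * θ⁻¹ * ((|t| * η)⁻¹ * η⁻¹) * J := by ring
      _ ≤ _ := by rw [htη]; gcongr
  refine (add_le_add (e3.trans e4) e2).trans ?_
  set c1 := a1' + 4 * a2
  set c2 := 2 * (a3 * a1 * C + C * a4) + C * a4 + C * a5
  have hc1 : 0 ≤ c1 := by positivity
  have hc2 : 0 ≤ c2 := by positivity
  set T := B * (θ⁻¹) ^ (l + 1) * J with hT
  have hT0 : 0 ≤ T := by positivity
  have hq : 0 ≤ (|t| * η ^ 2)⁻¹ := by positivity
  calc _ = c1 * (|t| * η ^ 2)⁻¹ * T + c2 * (η + ρ) * T := by rw [hT]; ring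
    _ ≤ c1 * ((|t| * η ^ 2)⁻¹ + η + ρ) * T + c2 * ((|t| * η ^ 2)⁻¹ + η + ρ) * T := by
        gcongr
        · linarith
        · linarith
    _ = _ := by rw [hT]; ring

/-! ### Dyadic decomposition -/

/-- A smooth step, vanishing on `(-∞, 1/2]` and equal to one on `[1, ∞)`. -/
noncomputable def step (z : ℝ) : ℝ := Real.smoothTransition (2 * z - 1)

theorem contDiff_step : ContDiff ℝ ∞ step :=
  Real.smoothTransition.contDiff.comp ((contDiff_const.mul contDiff_id).sub contDiff_const)

theorem step_of_le {z : ℝ} (h : z ≤ 1 / 2) : step z = 0 :=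
  Real.smoothTransition.zero_of_nonpos (by linarith)

theorem step_of_ge {z : ℝ} (h : 1 ≤ z) : step z = 1 :=
  Real.smoothTransition.one_of_one_le (by linarith)

theorem step_nonneg (z : ℝ) : 0 ≤ step z := Real.smoothTransition.nonneg _

theorem step_le_one (z : ℝ) : step z ≤ 1 := Real.smoothTransition.le_one _

/-- The dyadic profile `z ^ β (step z - step (z / 2))`, supported in `[1/2, 2]`. -/
noncomputable def dyadic (β z : ℝ) : ℝ := z ^ β * (step z - step (z / 2))

theorem dyadic_eq_zero_of_le {β z : ℝ} (h : z ≤ 1 / 2) : dyadic β z = 0 := by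
  rw [dyadic, step_of_le h]
  rcases le_total z 0 with h0 | h0
  · rw [step_of_le (by linarith)]; simp
  · rw [step_of_le (by linarith)]; simp

theorem dyadic_eq_zero_of_ge {β z : ℝ} (h : 2 ≤ z) : dyadic β z = 0 := by
  rw [dyadic, step_of_ge (by linarith), step_of_ge (by linarith)]
  simp

theorem dyadic_supp {β z : ℝ} (h : dyadic β z ≠ 0) : z ∈ Icc (1 / 2 : ℝ) 2 := by
  constructor
  · by_contra hz
    exact h (dyadic_eq_zero_of_le (not_le.mp hz).le)
  · by_contra hz
    exact h (dyadic_eq_zero_of_ge (not_le.mp hz).le)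

theorem contDiff_dyadic (β : ℝ) : ContDiff ℝ 1 (dyadic β) := by
  rw [contDiff_iff_contDiffAt]
  intro z
  rcases lt_or_ge z (1 / 2) with hz | hz
  · refine (contDiffAt_const (c := (0 : ℝ))).congr_of_eventuallyEq ?_
    filter_upwards [Iio_mem_nhds hz] with y hy
    exact dyadic_eq_zero_of_le (le_of_lt hy)
  · have hs : ContDiff ℝ 1 step := contDiff_step.of_le (by exact_mod_cast le_top)
    exact (Real.contDiffAt_rpow_const_of_ne (by linarith)).mul
      (hs.contDiffAt.sub (hs.comp (contDiff_id.div_const 2)).contDiffAt)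

theorem exists_dyadic_bound (β : ℝ) :
    ∃ C, 0 ≤ C ∧ ∀ z, |dyadic β z| ≤ C ∧ |deriv (dyadic β) z| ≤ C := by
  have hc : HasCompactSupport (dyadic β) :=
    HasCompactSupport.of_support_subset_isCompact isCompact_Icc fun z hz => dyadic_supp hz
  obtain ⟨C1, h1⟩ := hc.exists_bound_of_continuous (contDiff_dyadic β).continuous
  obtain ⟨C2, h2⟩ := hc.deriv.exists_bound_of_continuous
    ((contDiff_dyadic β).continuous_deriv le_rfl)
  have p1 := (norm_nonneg _).trans (h1 0)
  have p2 := (norm_nonneg _).trans (h2 0)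
  refine ⟨C1 + C2, by positivity, fun z => ⟨(h1 z).trans (by linarith), (h2 z).trans (by linarith)⟩⟩

/-- A smooth bump equal to one on `[1/2, 2]` and supported in `[1/4, 4]`. -/
noncomputable def strip : ℝ → ℝ :=
  (⟨3 / 4, 1, by norm_num, by norm_num⟩ : ContDiffBump (5 / 4 : ℝ))

theorem isProfile_strip : IsProfile strip where
  smooth := ContDiffBump.contDiff _
  nonneg _ := ContDiffBump.nonneg _
  le_one _ := ContDiffBump.le_one _
  supp z hz := by
    have h : z ∈ Function.support strip := hz
    rw [strip, ContDiffBump.support_eq, Real.ball_eq_Ioo] at h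
    constructor
    · linarith [h.1]
    · linarith [h.2]

theorem strip_eq_one {z : ℝ} (hz : z ∈ Icc (1 / 2 : ℝ) 2) : strip z = 1 := by
  refine ContDiffBump.one_of_mem_closedBall _ ?_
  rw [Real.closedBall_eq_Icc]
  constructor <;> linarith [hz.1, hz.2]

/-- The dyadic piece of `a |w| ^ β g` at scale `θ`, on the side `w > 0`. -/
noncomputable def piece (a : Plane → ℂ) (g w : Plane → ℝ) (β θ : ℝ) (x : Plane) : ℂ :=
  (g x * (θ ^ β * dyadic β (w x / θ))) • a x

theorem exists_isPiece {κ : Plane → ℝ} {U : Set Plane} (hκ : IsCutoff κ U) {g w : Plane → ℝ}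
    (hg : ContDiff ℝ 1 g) (hw : ContDiff ℝ ∞ w) (β : ℝ) :
    ∃ C, 0 ≤ C ∧ ∀ (a : Plane → ℂ) (A : ℝ), ContDiff ℝ 1 a → (∀ x ∈ tsupport a, κ x = 1) →
      (∀ x, ‖a x‖ ≤ A) → (∀ x, ‖fderiv ℝ a x‖ ≤ A) → ∀ θ, 0 < θ → θ ≤ 1 →
        IsPiece κ strip w θ (C * A * θ ^ β) (piece a g w β θ) := by
  obtain ⟨D, hD0, hD⟩ := exists_dyadic_bound β
  have hw1 := ContDiff.one_of_infty hw
  obtain ⟨c1, c10, h1⟩ := exists_bound_tsupport hκ.compact hg.continuous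
  obtain ⟨c2, c20, h2⟩ := exists_bound_tsupport hκ.compact (hg.continuous_fderiv one_ne_zero)
  obtain ⟨c3, c30, h3⟩ := exists_bound_tsupport hκ.compact (hw1.continuous_fderiv one_ne_zero)
  refine ⟨c1 * D + c2 * D + c1 * D * c3, by positivity, fun a A ha hκa hA hA' θ hθ hθ1 => ?_⟩
  have hA0 : 0 ≤ A := (norm_nonneg _).trans (hA 0)
  have hθi : 1 ≤ θ⁻¹ := (one_le_inv₀ hθ).mpr hθ1
  have hθβ : 0 < θ ^ β := Real.rpow_pos_of_pos hθ β
  have hsub : tsupport (piece a g w β θ) ⊆ tsupport a :=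
    closure_mono fun x hx => by
      simp only [Function.mem_support, piece] at hx ⊢
      exact fun h => hx (by simp [h])
  have hdy : ContDiff ℝ 1 fun x => dyadic β (w x / θ) :=
    (contDiff_dyadic β).comp (hw1.div_const θ)
  refine ⟨(hg.mul (contDiff_const.mul hdy)).smul ha, fun x hx => ⟨hκa x (hsub hx), ?_⟩,
    fun x => ?_, fun x => ?_⟩
  · have hcl : IsClosed {x | w x / θ ∈ Icc (1 / 2 : ℝ) 2} :=
      isClosed_Icc.preimage (hw.continuous.div_const θ)
    have : tsupport (piece a g w β θ) ⊆ {x | w x / θ ∈ Icc (1 / 2 : ℝ) 2} :=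
      closure_minimal (fun y hy => dyadic_supp (β := β) fun h => hy (by simp [piece, h])) hcl
    exact strip_eq_one (this hx)
  · by_cases hx : x ∈ tsupport a
    · have hm := mem_tsupport_of_ne (κ := κ) (x := x) (by rw [hκa x hx]; exact one_ne_zero)
      rw [piece, norm_smul, norm_mul, norm_mul, Real.norm_of_nonneg hθβ.le]
      calc _ ≤ c1 * (θ ^ β * D) * A := by
            gcongr
            · exact h1 x hm
            · exact (hD _).1
            · exact hA x
        _ = c1 * D * A * θ ^ β := by ring
        _ ≤ _ := by
            gcongr
            have : 0 ≤ c2 * D + c1 * D * c3 := by positivity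
            linarith
    · rw [piece, image_eq_zero_of_notMem_tsupport hx, smul_zero, norm_zero]
      positivity
  · by_cases hx : x ∈ tsupport a
    · have hm := mem_tsupport_of_ne (κ := κ) (x := x) (by rw [hκa x hx]; exact one_ne_zero)
      have e1 := (fderiv_comp_div (contDiff_dyadic β) hw1 θ x).const_mul (θ ^ β)
      have e2 := (hg.differentiable one_ne_zero x).hasFDerivAt.mul e1
      have e3 : HasFDerivAt (piece a g w β θ) _ x :=
        e2.smul (ha.differentiable one_ne_zero x).hasFDerivAt
      rw [e3.fderiv]
      have b1 := h1 x hm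
      have b2 := h2 x hm
      have b3 := h3 x hm
      have b4 := (hD (w x / θ)).1
      have b5 := (hD (w x / θ)).2
      have b6 := hA x
      have b7 := hA' x
      rw [← Real.norm_eq_abs] at b4 b5
      refine (norm_add_le _ _).trans ?_
      have k1 : ‖(g x * (θ ^ β * dyadic β (w x / θ))) • fderiv ℝ a x‖ ≤ c1 * D * A * θ ^ β * θ⁻¹ := by
        rw [norm_smul, norm_mul, norm_mul, Real.norm_of_nonneg hθβ.le]
        calc _ ≤ c1 * (θ ^ β * D) * A := by gcongr
          _ = c1 * D * A * θ ^ β * 1 := by ring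
          _ ≤ _ := by gcongr
      have k2 : ‖(g x • θ ^ β • (deriv (dyadic β) (w x / θ) * θ⁻¹) • fderiv ℝ w x
          + (θ ^ β * dyadic β (w x / θ)) • fderiv ℝ g x)‖
          ≤ (c2 * D + c1 * D * c3) * θ ^ β * θ⁻¹ := by
        refine (norm_add_le _ _).trans ?_
        rw [norm_smul, norm_smul, norm_smul, norm_smul, norm_mul, norm_mul,
          Real.norm_of_nonneg hθβ.le, Real.norm_of_nonneg (by positivity : 0 ≤ θ⁻¹)]
        calc _ ≤ c1 * (θ ^ β * (D * θ⁻¹ * c3)) + θ ^ β * D * c2 := by gcongr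
          _ ≤ c1 * (θ ^ β * (D * θ⁻¹ * c3)) + θ ^ β * D * c2 * θ⁻¹ := by
              refine add_le_add le_rfl ?_
              exact le_mul_of_one_le_right (by positivity) hθi
          _ = _ := by ring
      have k3 : ‖ContinuousLinearMap.smulRight (g x • θ ^ β •
          (deriv (dyadic β) (w x / θ) * θ⁻¹) • fderiv ℝ w x
          + (θ ^ β * dyadic β (w x / θ)) • fderiv ℝ g x) (a x)‖
          ≤ (c2 * D + c1 * D * c3) * θ ^ β * θ⁻¹ * A := by
        rw [ContinuousLinearMap.norm_smulRight_apply]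
        exact mul_le_mul k2 b6 (norm_nonneg _) (by positivity)
      refine (add_le_add k1 k3).trans (le_of_eq ?_)
      ring
    · have : x ∉ tsupport (piece a g w β θ) := fun h => hx (hsub h)
      rw [fderiv_of_notMem_tsupport ℝ this, norm_zero]
      positivity

/-- The dyadic profiles telescope to a single step function. The term with `l = 0` vanishes because
`w ≤ 1`. -/
theorem sum_piece (a : Plane → ℂ) (g w : Plane → ℝ) (β : ℝ) {x : Plane} (hx : w x ≤ 1) (N : ℕ) :
    ∑ l ∈ Finset.range N, piece a g w β ((1 / 2 : ℝ) ^ l) x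
      = (g x * (|w x| ^ β * step (w x * 2 ^ N / 2))) • a x := by
  have key : ∀ l : ℕ, ((1 / 2 : ℝ) ^ l) ^ β * dyadic β (w x / (1 / 2 : ℝ) ^ l)
      = |w x| ^ β * (step (w x * 2 ^ (l + 1) / 2) - step (w x * 2 ^ l / 2)) := by
    intro l
    have e0 : w x / (1 / 2 : ℝ) ^ l = w x * 2 ^ l := by
      rw [one_div, inv_pow, div_inv_eq_mul]
    rw [dyadic, e0, show w x * 2 ^ (l + 1) / 2 = w x * 2 ^ l by ring]
    rcases le_or_gt (w x) 0 with h | h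
    · have h2 : w x * 2 ^ l ≤ 0 := mul_nonpos_of_nonpos_of_nonneg h (by positivity)
      rw [step_of_le (by linarith), step_of_le (by linarith)]
      simp
    · rw [← mul_assoc, abs_of_pos h, ← Real.mul_rpow (by positivity) (by positivity)]
      congr 2
      rw [one_div, inv_pow]
      field_simp
  simp only [piece, key]
  rw [← Finset.sum_smul, ← Finset.mul_sum, ← Finset.mul_sum, Finset.sum_range_sub
    (fun l => step (w x * 2 ^ l / 2))]
  rw [step_of_le (z := w x * 2 ^ 0 / 2) (by simp; linarith), sub_zero]

/-- The factor that remains after the removal of `N` dyadic pieces on both sides. -/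
noncomputable def remFactor (w : Plane → ℝ) (N : ℕ) (x : Plane) : ℝ :=
  1 - step (w x * 2 ^ N / 2) - step (-w x * 2 ^ N / 2)

theorem abs_remFactor_le (w : Plane → ℝ) (N : ℕ) (x : Plane) : |remFactor w N x| ≤ 1 := by
  rw [remFactor, abs_le]
  have p : (0 : ℝ) < 2 ^ N := by positivity
  rcases le_total (w x) 0 with h | h
  · rw [step_of_le (z := w x * 2 ^ N / 2) (by nlinarith)]
    constructor <;> linarith [step_nonneg (-w x * 2 ^ N / 2), step_le_one (-w x * 2 ^ N / 2)]
  · rw [step_of_le (z := -w x * 2 ^ N / 2) (by nlinarith)]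
    constructor <;> linarith [step_nonneg (w x * 2 ^ N / 2), step_le_one (w x * 2 ^ N / 2)]

theorem remFactor_supp {w : Plane → ℝ} {N : ℕ} {x : Plane} (h : remFactor w N x ≠ 0) :
    |w x| ≤ 2 * (1 / 2) ^ N := by
  by_contra hc
  push Not at hc
  apply h
  have p : (0 : ℝ) < 2 ^ N := by positivity
  have hq : (2 : ℝ) * (1 / 2) ^ N * 2 ^ N = 2 := by
    rw [mul_assoc, ← mul_pow]; norm_num
  have h1 : 2 < |w x| * 2 ^ N := by nlinarith
  rw [remFactor]
  rcases le_total (w x) 0 with h0 | h0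
  · rw [abs_of_nonpos h0] at h1
    rw [step_of_le (z := w x * 2 ^ N / 2) (by nlinarith), step_of_ge (by linarith)]
    ring
  · rw [abs_of_nonneg h0] at h1
    rw [step_of_le (z := -w x * 2 ^ N / 2) (by nlinarith), step_of_ge (by linarith)]
    ring

theorem continuous_remFactor {w : Plane → ℝ} (hw : Continuous w) (N : ℕ) :
    Continuous (remFactor w N) := by
  have := contDiff_step.continuous
  unfold remFactor
  fun_prop

/-- Finitely many pieces on each side of `{w = 0}` are split off, and the part with `|w| ≲ 2^(-N)`
is kept as an explicit remainder, so no infinite sum of integrals is needed. -/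
theorem integral_eq_sum_piece {a : Plane → ℂ} (ha : Continuous a) (hac : HasCompactSupport a)
    {g w : Plane → ℝ} (hg : Continuous g) (hw : Continuous w) {β : ℝ} (hβ : 0 ≤ β)
    (hwa : ∀ x, a x ≠ 0 → |w x| ≤ 1) (hpc : ∀ l : ℕ, Continuous (piece a g w β ((1 / 2 : ℝ) ^ l)))
    (hpc' : ∀ l : ℕ, Continuous (piece a g (fun x => -w x) β ((1 / 2 : ℝ) ^ l)))
    {F : Plane → ℂ} (hF : Continuous F) (N : ℕ) :
    ∫ x, ((g x * |w x| ^ β) • a x) * F x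
      = (∑ l ∈ Finset.range N, ∫ x, piece a g w β ((1 / 2 : ℝ) ^ l) x * F x)
        + (∑ l ∈ Finset.range N, ∫ x, piece a g (fun x => -w x) β ((1 / 2 : ℝ) ^ l) x * F x)
        + ∫ x, ((g x * (|w x| ^ β * remFactor w N x)) • a x) * F x := by
  have hI : ∀ {b : Plane → ℂ}, Continuous b → (∀ x, a x = 0 → b x = 0) →
      Integrable fun x => b x * F x := fun hb h0 =>
    (hb.mul hF).integrable_of_hasCompactSupport
      (hasCompactSupport_of_imp hac fun x hx => by simp [h0 x hx])
  have h1 : ∀ l ∈ Finset.range N, Integrable fun x => piece a g w β ((1 / 2 : ℝ) ^ l) x * F x :=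
    fun l _ => hI (hpc l) fun x hx => by simp [piece, hx]
  have h2 : ∀ l ∈ Finset.range N,
      Integrable fun x => piece a g (fun x => -w x) β ((1 / 2 : ℝ) ^ l) x * F x :=
    fun l _ => hI (hpc' l) fun x hx => by simp [piece, hx]
  have hwβ : Continuous fun x => |w x| ^ β := hw.abs.rpow_const fun _ => Or.inr hβ
  have h3 : Integrable fun x => ((g x * (|w x| ^ β * remFactor w N x)) • a x) * F x :=
    hI (b := fun x => (g x * (|w x| ^ β * remFactor w N x)) • a x)
      ((hg.mul (hwβ.mul (continuous_remFactor hw N))).smul ha) fun x hx => by simp [hx]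
  have h4 := integrable_finsetSum _ h1
  have h5 := integrable_finsetSum _ h2
  have h6 := h4.add h5
  simp only [Pi.add_def] at h6
  rw [← integral_finsetSum _ h1, ← integral_finsetSum _ h2, ← integral_add h4 h5,
    ← integral_add h6 h3]
  congr 1
  ext x
  rw [← Finset.sum_mul, ← Finset.sum_mul, ← add_mul, ← add_mul]
  congr 1
  by_cases hx : a x = 0
  · simp [piece, hx]
  · have hw1 := abs_le.mp (hwa x hx)
    rw [sum_piece a g w β hw1.2, sum_piece a g (fun x => -w x) β (by linarith), ← add_smul,
      ← add_smul]
    congr 1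
    simp only [abs_neg, remFactor]
    ring

theorem le_rpow_mul_rpow {x a b s : ℝ} (hx : 0 ≤ x) (ha : x ≤ a) (hb : x ≤ b) (hs : 0 ≤ s)
    (hs1 : s ≤ 1) : x ≤ a ^ (1 - s) * b ^ s := by
  rcases hx.eq_or_lt with h | h
  · rw [← h]
    exact mul_nonneg (Real.rpow_nonneg (hx.trans ha) _) (Real.rpow_nonneg (hx.trans hb) _)
  calc x = x ^ (1 - s) * x ^ s := by rw [← Real.rpow_add h]; simp
    _ ≤ _ := mul_le_mul (Real.rpow_le_rpow hx ha (by linarith)) (Real.rpow_le_rpow hx hb hs)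
        (Real.rpow_nonneg hx _) (Real.rpow_nonneg (hx.trans ha) _)

/-- Each term is at most the geometric mean of its two bounds with weights `1 - s` and `s`. A small
`s` keeps a positive power of `θ`, hence a convergent geometric series, while retaining `T^s`. -/
theorem exists_dyadic_sum_le {c : ℝ} (hc : 0 < c) (L : ℕ) :
    ∃ s S : ℝ, 0 < s ∧ s ≤ 1 ∧ 0 ≤ S ∧ ∀ (H T : ℝ) (y : ℕ → ℝ), 0 ≤ H → 0 ≤ T → (∀ l, 0 ≤ y l) →
      (∀ l, y l ≤ H * ((1 / 2 : ℝ) ^ l) ^ c) → (∀ l, y l ≤ H * T * ((1 / 2 : ℝ) ^ l)⁻¹ ^ L) →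
      ∀ N, ∑ l ∈ Finset.range N, y l ≤ S * H * T ^ s := by
  -- With this value the exponent of `θ` is `c (1 - s) - L s = c / 2`.
  set s : ℝ := c / (2 * (c + L)) with hs
  have hcL : 0 < c + L := by positivity
  have hs0 : 0 < s := by positivity
  have hs1 : s ≤ 1 := by
    rw [hs, div_le_one (by positivity)]
    have : (0 : ℝ) ≤ L := by positivity
    linarith
  set r : ℝ := (1 / 2 : ℝ) ^ (c / 2) with hr
  have hr0 : 0 ≤ r := by positivity
  have hr1 : r < 1 := Real.rpow_lt_one (by norm_num) (by norm_num) (by positivity)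
  have hsum := summable_geometric_of_lt_one hr0 hr1
  refine ⟨s, ∑' l, r ^ l, hs0, hs1, tsum_nonneg fun l => by positivity,
    fun H T y hH hT hy h1 h2 N => ?_⟩
  have key : ∀ l, y l ≤ H * T ^ s * r ^ l := by
    intro l
    set θ : ℝ := (1 / 2 : ℝ) ^ l with hθ
    have hθ0 : 0 < θ := by positivity
    refine (le_rpow_mul_rpow (hy l) (h1 l) (h2 l) hs0.le hs1).trans (le_of_eq ?_)
    have e1 : (H * θ ^ c) ^ (1 - s) = H ^ (1 - s) * θ ^ (c * (1 - s)) := by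
      rw [Real.mul_rpow hH (by positivity), ← Real.rpow_mul hθ0.le]
    have e2 : (H * T * (θ⁻¹) ^ L) ^ s = H ^ s * T ^ s * θ ^ (-(L * s)) := by
      rw [Real.mul_rpow (by positivity) (by positivity), Real.mul_rpow hH hT, ← Real.rpow_natCast,
        ← Real.rpow_mul (by positivity), Real.inv_rpow hθ0.le, ← Real.rpow_neg hθ0.le]
    have e3 : H ^ (1 - s) * H ^ s = H := by
      rw [← Real.rpow_add_of_nonneg hH (by linarith) hs0.le]; simp
    have e4 : θ ^ (c * (1 - s)) * θ ^ (-(L * s)) = r ^ l := by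
      rw [← Real.rpow_add hθ0, hr, ← Real.rpow_mul_natCast (by norm_num), hθ,
        ← Real.rpow_natCast, ← Real.rpow_mul (by norm_num)]
      congr 1
      rw [hs]
      field_simp
      ring
    rw [e1, e2, ← e4]
    calc _ = (H ^ (1 - s) * H ^ s) * T ^ s * (θ ^ (c * (1 - s)) * θ ^ (-(L * s))) := by ring
      _ = _ := by rw [e3]
  calc _ ≤ ∑ l ∈ Finset.range N, H * T ^ s * r ^ l := Finset.sum_le_sum fun l _ => key l
    _ = H * T ^ s * ∑ l ∈ Finset.range N, r ^ l := by rw [Finset.mul_sum]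
    _ ≤ H * T ^ s * ∑' l, r ^ l :=
        mul_le_mul_of_nonneg_left (hsum.sum_le_tsum _ fun l _ => by positivity) (by positivity)
    _ = _ := by ring

/-- The pieces live on the side `w > 0`; the other side is treated by exchanging `w` and `-w`. -/
theorem LocalData.neg {f w u p q : Plane → ℝ} {v v' : Plane} {k M : ℕ} {U : Set Plane}
    (hD : LocalData f w u p q v v' k M U) :
    LocalData f (fun x => -w x) (fun x => (-1) ^ k * u x) (fun x => (-1) ^ k * p x)
      (fun x => (-1) ^ M * q x) v v' k M U where
  smooth_f := hD.smooth_f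
  smooth_w := hD.smooth_w.neg
  smooth_u := contDiff_const.mul hD.smooth_u
  smooth_p := contDiff_const.mul hD.smooth_p
  smooth_q := contDiff_const.mul hD.smooth_q
  dvv_eq x hx := by
    rw [hD.dvv_eq x hx, neg_pow, mul_mul_mul_comm, ← mul_pow]
    simp
  unit x hx := by
    rw [mul_mul_mul_comm, ← mul_pow, hD.unit x hx]
    simp
  hdet_mul x hx := by
    rw [mul_left_comm, hD.hdet_mul x hx, ← mul_pow, neg_one_mul]
  abs_le x hx := by
    rw [abs_neg]
    exact hD.abs_le x hx

/-! ### Decay near a point -/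

section Decay

variable {f w u p q : Plane → ℝ} {v v' : Plane} {k M : ℕ} {U : Set Plane} {κ : Plane → ℝ}

theorem integral_split_lor (hf : ContDiff ℝ ∞ f) {b : Plane → ℂ} (hb : Continuous b)
    (hbc : HasCompactSupport b) (v σ : Plane) (ρ t : ℝ) :
    ∫ x, b x * osc t (phase f σ) x
      = (∫ x, (1 - lor (dv v (phase f σ) x / ρ) ^ 2) • (b x * osc t (phase f σ) x))
        + ∫ x, (lor (dv v (phase f σ) x / ρ) ^ 2) • (b x * osc t (phase f σ) x) := by
  have hl := continuous_lor_comp (contDiff_dv (contDiff_phase hf σ) v).continuous ρ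
  have he : Continuous (osc t (phase f σ)) := (contDiff_osc (n := ⊤) (contDiff_phase hf σ)).continuous
  have hI : ∀ {g : Plane → ℝ}, Continuous g →
      Integrable fun x => g x • (b x * osc t (phase f σ) x) :=
    fun hg => Continuous.integrable_of_hasCompactSupport (hg.smul (hb.mul he))
      (hasCompactSupport_of_imp hbc fun x hx => by simp [hx])
  rw [← integral_add (hI (g := fun x => 1 - lor (dv v (phase f σ) x / ρ) ^ 2) (by fun_prop))
    (hI (g := fun x => lor (dv v (phase f σ) x / ρ) ^ 2) (by fun_prop))]
  congr 1
  ext x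
  rw [← add_smul]
  simp

/-- The bound for a dyadic piece by the second derivative test. -/
theorem LocalData.exists_piece_near_le (hD : LocalData f w u p q v v' k M U) (hκ : IsCutoff κ U)
    {r : Plane → ℝ} (hr : ContDiff ℝ ∞ r) (hwr : ∀ x ∈ U, dv v w x * r x = 1) :
    ∃ C, 0 ≤ C ∧ ∀ θ B : ℝ, 0 < θ → θ ≤ 1 → ∀ b, IsPiece κ strip w θ B b →
      ∀ (σ : Plane) (t : ℝ), t ≠ 0 →
      ‖∫ x, b x * osc t (phase f σ) x‖ ≤ C * B * |t| ^ (-(1 / 2) : ℝ) * θ ^ (-(k / 2) : ℝ) := by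
  obtain ⟨C0, h00, h0⟩ := exists_integral_strip_le hκ isProfile_strip hD.smooth_w hr hwr
  obtain ⟨C1, h10, h1⟩ := hD.exists_area_le hκ isProfile_strip
  obtain ⟨C2, h20, h2⟩ := hD.exists_piece_one_sub_le hκ isProfile_strip
  refine ⟨C2 * C0 + C1 * C0, by positivity, fun θ B hθ hθ1 b hb σ t ht => ?_⟩
  have hB := hb.nonneg
  have ht0 : 0 < |t| := abs_pos.mpr ht
  -- This `ρ` balances `1 / (|t| ρ)` against `ρ θ^(-k)`, the oscillation bound and the area of the
  -- strip region.
  set ρ : ℝ := |t| ^ (-(1 / 2) : ℝ) * θ ^ (k / 2 : ℝ) with hρd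
  have hρ : 0 < ρ := by positivity
  set I := ∫ x, κ x * strip (w x / θ) with hI
  have hI0 : 0 ≤ I := integral_strip_nonneg hκ isProfile_strip w θ
  have hIθ : I ≤ C0 * θ := h0 θ hθ
  have hIθ' : θ⁻¹ * I ≤ C0 := by
    rw [inv_mul_le_iff₀ hθ, mul_comm]
    exact hIθ
  have a1 := h2 θ B hθ hθ1 b hb σ ρ t hρ ht
  have a2 := hb.norm_integral_lor_le hκ isProfile_strip hD.smooth_f hD.smooth_w v σ ρ t
  have a3 := h1 θ hθ hθ1 σ ρ hρ
  have e1 : (|t| * ρ)⁻¹ = |t| ^ (-(1 / 2) : ℝ) * θ ^ (-(k / 2) : ℝ) := by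
    have : |t| * ρ = |t| ^ (1 / 2 : ℝ) * θ ^ (k / 2 : ℝ) := by
      rw [hρd, ← mul_assoc]
      congr 1
      nth_rewrite 1 [← Real.rpow_one |t|]
      rw [← Real.rpow_add ht0]
      norm_num
    rw [this, mul_inv, Real.rpow_neg ht0.le, Real.rpow_neg hθ.le]
  have e2 : ρ * (θ⁻¹) ^ k = |t| ^ (-(1 / 2) : ℝ) * θ ^ (-(k / 2) : ℝ) := by
    rw [hρd, mul_assoc]
    congr 1
    rw [inv_pow, ← Real.rpow_natCast, ← Real.rpow_neg hθ.le, ← Real.rpow_add hθ]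
    congr 1
    ring
  set E := |t| ^ (-(1 / 2) : ℝ) * θ ^ (-(k / 2) : ℝ) with hE
  have hE0 : 0 ≤ E := by positivity
  rw [integral_split_lor hD.smooth_f hb.smooth.continuous (hb.compact hκ) v σ ρ t]
  refine (norm_add_le _ _).trans ?_
  have b1 : C2 * B * (|t| * ρ)⁻¹ * (θ⁻¹ * I) ≤ C2 * C0 * B * E := by
    rw [e1]
    calc _ ≤ C2 * B * E * C0 := by gcongr
      _ = _ := by ring
  have b2 : C1 * ρ * (θ⁻¹) ^ (k + 1) * I ≤ C1 * C0 * E := by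
    calc C1 * ρ * (θ⁻¹) ^ (k + 1) * I = C1 * (ρ * (θ⁻¹) ^ k) * (θ⁻¹ * I) := by ring
      _ ≤ C1 * E * C0 := by rw [e2]; gcongr
      _ = _ := by ring
  have b3 := mul_le_mul_of_nonneg_left (a3.trans b2) hB
  calc _ ≤ C2 * C0 * B * E + B * (C1 * C0 * E) := add_le_add (a1.trans b1) (a2.trans b3)
    _ = _ := by rw [hE]; ring

/-- The value `η = t^(-1/3)` equalizes the two competing terms `1 / (t η²)` and `η`. -/
theorem inv_mul_sq_rpow {t : ℝ} (ht : 0 < t) : (t * (t ^ (-(1 / 3) : ℝ)) ^ 2)⁻¹ = t ^ (-(1 / 3) : ℝ) := by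
  rw [← Real.rpow_mul_natCast ht.le]
  nth_rewrite 1 [← Real.rpow_one t]
  rw [← Real.rpow_add ht, ← Real.rpow_neg ht.le]
  norm_num

/-- The bound for a dyadic piece by nondegeneracy of the Hessian. -/
theorem LocalData.exists_piece_far_le (hD : LocalData f w u p q v v' k M U) (hκ : IsCutoff κ U)
    {r : Plane → ℝ} (hr : ContDiff ℝ ∞ r) (hwr : ∀ x ∈ U, dv v w x * r x = 1) (R : ℝ) :
    ∃ C, 0 ≤ C ∧ ∀ θ B : ℝ, 0 < θ → θ ≤ 1 → ∀ b, IsPiece κ strip w θ B b →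
      ∀ σ : Plane, ‖σ‖ ≤ R → ∀ t : ℝ, 1 ≤ |t| →
      ‖∫ x, b x * osc t (phase f σ) x‖ ≤
        C * B * |t| ^ (-(7 / 12) : ℝ) * (θ⁻¹) ^ (3 * k + M + 1) := by
  obtain ⟨C0, h00, h0⟩ := exists_integral_strip_le hκ isProfile_strip hD.smooth_w hr hwr
  obtain ⟨C1, h10, h1⟩ := hD.exists_area_le hκ isProfile_strip
  obtain ⟨C2, h20, h2⟩ := hD.exists_piece_one_sub_le hκ isProfile_strip
  obtain ⟨C3, h30, h3⟩ := hD.exists_piece_lor_le hκ isProfile_strip R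
  refine ⟨C2 * C0 + C3 * 3 * (C1 * C0), by positivity, fun θ B hθ hθ1 b hb σ hσ t ht1 => ?_⟩
  have hB := hb.nonneg
  have ht0 : 0 < |t| := by linarith
  have ht : t ≠ 0 := abs_pos.mp ht0
  have hθi : 1 ≤ θ⁻¹ := (one_le_inv₀ hθ).mpr hθ1
  -- Any `ρ` strictly between `|t|^(-1/2)` and `|t|^(-1/6)` would beat the exponent `1/2`: here `1 /
  -- (|t| ρ) = |t|^(-7/12)` and `ρ η = |t|^(-3/4)`.
  set ρ : ℝ := |t| ^ (-(5 / 12) : ℝ) with hρd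
  set η : ℝ := |t| ^ (-(1 / 3) : ℝ) with hηd
  have hρ : 0 < ρ := by positivity
  have hη : 0 < η := by positivity
  have hη1 : η ≤ 1 := Real.rpow_le_one_of_one_le_of_nonpos ht1 (by norm_num)
  have hρη : ρ ≤ η := Real.rpow_le_rpow_of_exponent_le ht1 (by norm_num)
  set I := ∫ x, κ x * strip (w x / θ) with hI
  have hI0 : 0 ≤ I := integral_strip_nonneg hκ isProfile_strip w θ
  have hIθ' : θ⁻¹ * I ≤ C0 := by
    rw [inv_mul_le_iff₀ hθ, mul_comm]
    exact h0 θ hθ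
  have a1 := h2 θ B hθ hθ1 b hb σ ρ t hρ ht
  have a2 := h3 θ B hθ hθ1 b hb σ hσ ρ η t hρ hη hη1 ht
  have a3 := h1 θ hθ hθ1 σ ρ hρ
  set E := |t| ^ (-(7 / 12) : ℝ) with hE
  have hE0 : 0 < E := by positivity
  have e1 : (|t| * ρ)⁻¹ = E := by
    rw [hρd, hE]
    nth_rewrite 1 [← Real.rpow_one |t|]
    rw [← Real.rpow_add ht0, ← Real.rpow_neg ht0.le]
    norm_num
  have e2 : ρ * η ≤ E := by
    rw [hρd, hηd, hE, ← Real.rpow_add ht0]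
    exact Real.rpow_le_rpow_of_exponent_le ht1 (by norm_num)
  have e3 : (|t| * η ^ 2)⁻¹ = η := inv_mul_sq_rpow ht0
  rw [integral_split_lor hD.smooth_f hb.smooth.continuous (hb.compact hκ) v σ ρ t]
  refine (norm_add_le _ _).trans ?_
  have b1 : C2 * B * (|t| * ρ)⁻¹ * (θ⁻¹ * I) ≤ C2 * C0 * B * E * (θ⁻¹) ^ (3 * k + M + 1) := by
    rw [e1]
    calc _ ≤ C2 * B * E * C0 := by gcongr
      _ = C2 * C0 * B * E * 1 := by ring
      _ ≤ _ := by
          gcongr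
          exact one_le_pow₀ hθi
  set J := ∫ x, κ x ^ 2 * strip (w x / θ) ^ 2 * lor (dv v (phase f σ) x / ρ) with hJ
  have b2 : J ≤ C1 * C0 * ρ * (θ⁻¹) ^ k := by
    refine a3.trans ?_
    calc C1 * ρ * (θ⁻¹) ^ (k + 1) * I = C1 * ρ * (θ⁻¹) ^ k * (θ⁻¹ * I) := by ring
      _ ≤ C1 * ρ * (θ⁻¹) ^ k * C0 := by gcongr
      _ = _ := by ring
  have b3 : (|t| * η ^ 2)⁻¹ + η + ρ ≤ 3 * η := by rw [e3]; linarith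
  have hJ0 : 0 ≤ J := integral_nonneg fun x => by
    have := lor_pos (dv v (phase f σ) x / ρ)
    positivity
  have b4 : C3 * B * (θ⁻¹) ^ (2 * k + M + 1) * ((|t| * η ^ 2)⁻¹ + η + ρ) * J
      ≤ C3 * 3 * (C1 * C0) * B * E * (θ⁻¹) ^ (3 * k + M + 1) := by
    calc _ ≤ C3 * B * (θ⁻¹) ^ (2 * k + M + 1) * (3 * η) * (C1 * C0 * ρ * (θ⁻¹) ^ k) := by
          gcongr
      _ = C3 * 3 * (C1 * C0) * B * (ρ * η) * ((θ⁻¹) ^ (2 * k + M + 1) * (θ⁻¹) ^ k) := by ring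
      _ ≤ C3 * 3 * (C1 * C0) * B * E * ((θ⁻¹) ^ (2 * k + M + 1) * (θ⁻¹) ^ k) := by gcongr
      _ = _ := by rw [← pow_add]; ring_nf
  calc _ ≤ _ := add_le_add (a1.trans b1) (a2.trans b4)
    _ = _ := by ring

/-- One-sided sum of dyadic pieces for a damped amplitude. -/
theorem LocalData.exists_sum_piece_le (hD : LocalData f w u p q v v' k M U) (hκ : IsCutoff κ U)
    {r : Plane → ℝ} (hr : ContDiff ℝ ∞ r) (hwr : ∀ x ∈ U, dv v w x * r x = 1) {β : ℝ}
    (hβ : (k : ℝ) / 2 < β) :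
    ∃ s : ℝ, 0 < s ∧ ∀ (R : ℝ) (g : Plane → ℝ), ContDiff ℝ 1 g → ∃ C, 0 ≤ C ∧ ∀ σ : Plane, ‖σ‖ ≤ R →
      ∀ (a : Plane → ℂ) (A : ℝ), ContDiff ℝ 1 a → (∀ x ∈ tsupport a, κ x = 1) →
      (∀ x, ‖a x‖ ≤ A) → (∀ x, ‖fderiv ℝ a x‖ ≤ A) → ∀ t : ℝ, 1 ≤ |t| → ∀ N,
        ∑ l ∈ Finset.range N, ‖∫ x, piece a g w β ((1 / 2 : ℝ) ^ l) x * osc t (phase f σ) x‖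
          ≤ C * A * |t| ^ (-(1 / 2 + s)) := by
  obtain ⟨s, S, hs0, -, hS0, hS⟩ := exists_dyadic_sum_le (c := β - k / 2) (by linarith) (3 * k + M + 1)
  refine ⟨1 / 12 * s, by positivity, fun R g hg => ?_⟩
  obtain ⟨C0, h00, h0⟩ := exists_isPiece hκ hg hD.smooth_w β
  obtain ⟨C1, h10, h1⟩ := hD.exists_piece_near_le hκ hr hwr
  obtain ⟨C2, h20, h2⟩ := hD.exists_piece_far_le hκ hr hwr R
  refine ⟨S * ((C1 + C2) * C0), by positivity, fun σ hσ a A ha hκa hA hA' t ht1 N => ?_⟩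
  have hA0 : 0 ≤ A := (norm_nonneg _).trans (hA 0)
  have ht0 : 0 < |t| := by linarith
  have hk0 : 0 ≤ (k : ℝ) / 2 := by positivity
  have hT : |t| ^ (-(1 / 2) : ℝ) * |t| ^ (-(1 / 12) : ℝ) = |t| ^ (-(7 / 12) : ℝ) := by
    rw [← Real.rpow_add ht0]; norm_num
  -- The second derivative test supplies `θ^(β - k/2)`, with positive exponent. The Hessian bound
  -- improves `|t|^(-1/2)` by `T = |t|^(-1/12)`, at the price of a negative power of `θ`.
  have key := hS ((C1 + C2) * C0 * A * |t| ^ (-(1 / 2) : ℝ)) (|t| ^ (-(1 / 12) : ℝ))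
    (fun l => ‖∫ x, piece a g w β ((1 / 2 : ℝ) ^ l) x * osc t (phase f σ) x‖)
    (by positivity) (by positivity) (fun l => norm_nonneg _) (fun l => ?_) (fun l => ?_) N
  · refine key.trans (le_of_eq ?_)
    rw [← Real.rpow_mul ht0.le, show -(1 / 2 + 1 / 12 * s) = -(1 / 2) + -(1 / 12) * s by ring,
      Real.rpow_add ht0]
    ring
  · have hθ0 : (0 : ℝ) < (1 / 2) ^ l := by positivity
    have hθ1 : ((1 : ℝ) / 2) ^ l ≤ 1 := pow_le_one₀ (by norm_num) (by norm_num)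
    have hp := h0 a A ha hκa hA hA' _ hθ0 hθ1
    refine (h1 _ _ hθ0 hθ1 _ hp σ t (abs_pos.mp ht0)).trans ?_
    set θ : ℝ := (1 / 2) ^ l
    have : θ ^ β * θ ^ (-(k / 2) : ℝ) = θ ^ (β - k / 2) := by
      rw [← Real.rpow_add hθ0]; rfl
    calc _ = C1 * C0 * A * |t| ^ (-(1 / 2) : ℝ) * (θ ^ β * θ ^ (-(k / 2) : ℝ)) := by ring
      _ ≤ (C1 + C2) * C0 * A * |t| ^ (-(1 / 2) : ℝ) * (θ ^ β * θ ^ (-(k / 2) : ℝ)) := by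
          gcongr
          linarith
      _ = _ := by rw [this]
  · have hθ0 : (0 : ℝ) < (1 / 2) ^ l := by positivity
    have hθ1 : ((1 : ℝ) / 2) ^ l ≤ 1 := pow_le_one₀ (by norm_num) (by norm_num)
    have hp := h0 a A ha hκa hA hA' _ hθ0 hθ1
    refine (h2 _ _ hθ0 hθ1 _ hp σ hσ t ht1).trans ?_
    set θ : ℝ := (1 / 2) ^ l
    have hθβ : θ ^ β ≤ 1 := Real.rpow_le_one hθ0.le hθ1 (by linarith)
    rw [mul_assoc _ (|t| ^ (-(1 / 2) : ℝ)), hT]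
    calc C2 * (C0 * A * θ ^ β) * |t| ^ (-(7 / 12) : ℝ) * θ⁻¹ ^ (3 * k + M + 1)
        ≤ C2 * (C0 * A * 1) * |t| ^ (-(7 / 12) : ℝ) * θ⁻¹ ^ (3 * k + M + 1) := by gcongr
      _ = C2 * C0 * A * |t| ^ (-(7 / 12) : ℝ) * θ⁻¹ ^ (3 * k + M + 1) := by ring
      _ ≤ _ := by
          gcongr
          linarith

theorem rpow_neg_min_le {t a b : ℝ} (ht : 1 ≤ t) : t ^ (-(1 / 2 + a)) ≤ t ^ (-(1 / 2 + min a b)) :=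
  Real.rpow_le_rpow_of_exponent_le ht (by linarith [min_le_left a b])

/-- Decay for the damped amplitude `a g |w| ^ β`. -/
theorem LocalData.exists_damped_decay (hD : LocalData f w u p q v v' k M U) (hκ : IsCutoff κ U)
    {r : Plane → ℝ} (hr : ContDiff ℝ ∞ r) (hwr : ∀ x ∈ U, dv v w x * r x = 1) {β : ℝ}
    (hβ : (k : ℝ) / 2 < β) :
    ∃ s : ℝ, 0 < s ∧ ∀ (R : ℝ) (g : Plane → ℝ), ContDiff ℝ 1 g → ∃ C, 0 ≤ C ∧ ∀ σ : Plane, ‖σ‖ ≤ R →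
      ∀ (a : Plane → ℂ) (A : ℝ), ContDiff ℝ 1 a → (∀ x ∈ tsupport a, κ x = 1) →
      (∀ x, ‖a x‖ ≤ A) → (∀ x, ‖fderiv ℝ a x‖ ≤ A) → ∀ t : ℝ, 1 ≤ |t| →
        ‖∫ x, ((g x * |w x| ^ β) • a x) * osc t (phase f σ) x‖ ≤ C * A * |t| ^ (-(1 / 2 + s)) := by
  obtain ⟨s1, hs1, H1⟩ := hD.exists_sum_piece_le hκ hr hwr hβ
  obtain ⟨s2, hs2, H2⟩ := hD.neg.exists_sum_piece_le hκ hr.neg (fun x hx => by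
    have : dv v (fun x => -w x) x = - dv v w x := by simp [dv, fderiv_fun_neg]
    rw [this, neg_mul_neg, hwr x hx]) hβ
  refine ⟨min s1 s2, lt_min hs1 hs2, fun R g hg => ?_⟩
  obtain ⟨C1, h10, h1⟩ := H1 R g hg
  obtain ⟨C2, h20, h2⟩ := H2 R g hg
  refine ⟨C1 + C2, by positivity, fun σ hσ a A ha hκa hA hA' t ht1 => ?_⟩
  have hk0 : 0 ≤ (k : ℝ) / 2 := by positivity
  have hβ0 : 0 < β := by linarith
  have hA0 : 0 ≤ A := (norm_nonneg _).trans (hA 0)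
  have hac : HasCompactSupport a := hκ.compact.of_isClosed_subset (isClosed_tsupport _) fun x hx =>
    mem_tsupport_of_ne (by rw [hκa x hx]; exact one_ne_zero)
  have hsm : ∀ {w : Plane → ℝ}, ContDiff ℝ ∞ w → ∀ l : ℕ,
      Continuous (piece a g w β ((1 / 2 : ℝ) ^ l)) := by
    intro w hw l
    have := (contDiff_dyadic β).continuous.comp (hw.continuous.div_const ((1 / 2 : ℝ) ^ l))
    exact (hg.continuous.mul (continuous_const.mul this)).smul ha.continuous
  have hF : Continuous (osc t (phase f σ)) :=
    (contDiff_osc (n := ⊤) (contDiff_phase hD.smooth_f σ)).continuous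
  obtain ⟨c, c0, hc⟩ := exists_bound_tsupport hκ.compact hg.continuous
  -- the remainder is small
  have hrem : ∀ N : ℕ, ‖∫ x, ((g x * (|w x| ^ β * remFactor w N x)) • a x) * osc t (phase f σ) x‖
      ≤ c * A * (2 * (1 / 2) ^ N) ^ β * ∫ x, κ x := by
    intro N
    rw [← integral_const_mul]
    refine norm_integral_le_of_norm_le
      ((hκ.smooth.continuous.integrable_of_hasCompactSupport hκ.compact).const_mul _)
      (.of_forall fun x => ?_)
    rw [norm_mul, norm_osc, mul_one, norm_smul]
    by_cases hx : x ∈ tsupport a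
    · have hm := mem_tsupport_of_ne (κ := κ) (x := x) (by rw [hκa x hx]; exact one_ne_zero)
      rw [hκa x hx, mul_one, norm_mul, norm_mul, Real.norm_of_nonneg (by positivity : 0 ≤ |w x| ^ β)]
      have h3 : |w x| ^ β * ‖remFactor w N x‖ ≤ (2 * (1 / 2) ^ N) ^ β := by
        by_cases h0 : remFactor w N x = 0
        · rw [h0, norm_zero, mul_zero]; positivity
        · calc |w x| ^ β * ‖remFactor w N x‖ ≤ (2 * (1 / 2) ^ N) ^ β * 1 := by
                gcongr
                · exact remFactor_supp h0
                · exact abs_remFactor_le w N x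
            _ = _ := mul_one _
      calc _ ≤ c * (2 * (1 / 2) ^ N) ^ β * A := by
            gcongr
            · exact hc x hm
            · exact hA x
        _ = _ := by ring
    · rw [image_eq_zero_of_notMem_tsupport hx, norm_zero, mul_zero]
      have := hκ.nonneg x
      positivity
  have hlim : Tendsto (fun N : ℕ => (C1 + C2) * A * |t| ^ (-(1 / 2 + min s1 s2))
      + c * A * (2 * (1 / 2 : ℝ) ^ N) ^ β * ∫ x, κ x) atTop
      (𝓝 ((C1 + C2) * A * |t| ^ (-(1 / 2 + min s1 s2)))) := by
    have h1 : Tendsto (fun N : ℕ => (2 * (1 / 2 : ℝ) ^ N) ^ β) atTop (𝓝 0) := by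
      have h2 : Tendsto (fun N : ℕ => 2 * (1 / 2 : ℝ) ^ N) atTop (𝓝 0) := by
        simpa using (tendsto_pow_atTop_nhds_zero_of_lt_one (r := (1 / 2 : ℝ)) (by norm_num)
          (by norm_num)).const_mul 2
      have h3 := h2.rpow_const (p := β) (Or.inr hβ0.le)
      rwa [Real.zero_rpow hβ0.ne'] at h3
    have h2 := ((h1.const_mul (c * A)).mul_const (∫ x, κ x)).const_add
      ((C1 + C2) * A * |t| ^ (-(1 / 2 + min s1 s2)))
    simpa using h2
  -- The bound for the pieces is uniform in `N`, and `β > 0` makes the remainder vanish in the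
  -- limit.
  refine ge_of_tendsto hlim (.of_forall fun N => ?_)
  rw [integral_eq_sum_piece ha.continuous hac hg.continuous hD.smooth_w.continuous hβ0.le
    (fun x hx => hD.abs_le x (hκ.supp (mem_tsupport_of_ne (by
      rw [hκa x (subset_tsupport a hx)]; exact one_ne_zero))))
    (hsm hD.smooth_w) (hsm hD.smooth_w.neg) hF N]
  refine (norm_add_le _ _).trans (add_le_add ((norm_add_le _ _).trans ?_) (hrem N))
  have b1 := ((norm_sum_le _ _).trans (h1 σ hσ a A ha hκa hA hA' t ht1 N)).trans
    (mul_le_mul_of_nonneg_left (rpow_neg_min_le (b := s2) ht1) (by positivity))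
  have b2 := ((norm_sum_le _ _).trans (h2 σ hσ a A ha hκa hA hA' t ht1 N)).trans
    (mul_le_mul_of_nonneg_left (rpow_neg_min_le (b := s1) ht1) (by positivity))
  rw [min_comm s2 s1] at b2
  linarith

end Decay

/-! ### Decay without damping where `∂_v² f` does not vanish. -/

section UndampedDecay

variable {f w u p q : Plane → ℝ} {v v' : Plane} {M : ℕ} {U : Set Plane} {κ : Plane → ℝ}

/-- For `k = 0` the function `f_vv` is a unit, so the area of `{|∂_v φ| ≲ ρ}` is `O(ρ)` without
restriction to a strip. -/
theorem LocalData.exists_area_zero_le (hD : LocalData f w u p q v v' 0 M U) (hκ : IsCutoff κ U) :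
    ∃ C, 0 ≤ C ∧ ∀ (σ : Plane) (ρ : ℝ), 0 < ρ →
      ∫ x, κ x ^ 2 * lor (dv v (phase f σ) x / ρ) ≤ C * ρ := by
  have hm : ContDiff ℝ 1 fun x => κ x ^ 2 * p x :=
    ContDiff.one_of_infty ((hκ.smooth.pow 2).mul hD.smooth_p)
  refine ⟨2 * ∫ x, |dv v (fun x => κ x ^ 2 * p x) x|, by positivity, fun σ ρ hρ => ?_⟩
  have h := integral_lor_mul_le (v := v) (σ := σ) hD.smooth_f hm
    (hasCompactSupport_of_imp hκ.compact fun x hx => by simp [hx]) hρ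
  have e : ∀ x, κ x ^ 2 * p x * dv v (dv v f) x = κ x ^ 2 := by
    intro x
    by_cases hx : κ x = 0
    · simp [hx]
    have := hD.dvv_mul x (hκ.supp (mem_tsupport_of_ne hx))
    rw [pow_zero] at this
    linear_combination κ x ^ 2 * this
  simp only [e] at h
  linarith [(le_abs_self _).trans h]

theorem LocalData.exists_one_sub_le (hD : LocalData f w u p q v v' 0 M U) (hκ : IsCutoff κ U) :
    ∃ C, 0 ≤ C ∧ ∀ (b : Plane → ℂ) (B : ℝ), ContDiff ℝ 1 b → (∀ x ∈ tsupport b, κ x = 1) →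
      (∀ x, ‖b x‖ ≤ B) → (∀ x, ‖fderiv ℝ b x‖ ≤ B) → ∀ (σ : Plane) (ρ t : ℝ), 0 < ρ → t ≠ 0 →
      ‖∫ x, (1 - lor (dv v (phase f σ) x / ρ) ^ 2) • (b x * osc t (phase f σ) x)‖ ≤
        C * B * (|t| * ρ)⁻¹ := by
  have hm : ContDiff ℝ 1 fun x => κ x ^ 2 * p x :=
    ContDiff.one_of_infty ((hκ.smooth.pow 2).mul hD.smooth_p)
  obtain ⟨c, c0, hc⟩ := exists_bound_tsupport hκ.compact
    (contDiff_dv (contDiff_dv hD.smooth_f v) v).continuous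
  refine ⟨‖v‖ * (∫ x, κ x) + 8 * c * ∫ x, |dv v (fun x => κ x ^ 2 * p x) x|, ?_, ?_⟩
  · have : 0 ≤ ∫ x, κ x := integral_nonneg fun x => hκ.nonneg x
    have h2 : 0 ≤ ∫ x, |dv v (fun x => κ x ^ 2 * p x) x| := by positivity
    exact add_nonneg (mul_nonneg (norm_nonneg _) this) (by positivity)
  intro b B hb hκb hB hB' σ ρ t hρ ht
  have hB0 : 0 ≤ B := (norm_nonneg _).trans (hB 0)
  have hbκ : ∀ x ∈ tsupport b, x ∈ tsupport κ := fun x hx =>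
    mem_tsupport_of_ne (by rw [hκb x hx]; exact one_ne_zero)
  have hbc : HasCompactSupport b := hκ.compact.of_isClosed_subset (isClosed_tsupport _) hbκ
  have h := norm_integral_one_sub_lor_sq_le (v := v) (σ := σ) hD.smooth_f hb hbc
    (m := fun x => B * (κ x ^ 2 * p x)) (contDiff_const.mul hm)
    (hasCompactSupport_of_imp hκ.compact fun x hx => by simp [hx])
    (fun x => by
      by_cases hx : x ∈ tsupport b
      · have h1 := hD.dvv_mul x (hκ.supp (hbκ x hx))
        rw [pow_zero] at h1
        rw [hκb x hx]
        have e : B * (1 ^ 2 * p x) * dv v (dv v f) x = B := by linear_combination B * h1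
        rw [e]
        exact hB x
      · rw [image_eq_zero_of_notMem_tsupport hx, norm_zero]
        by_cases hx' : κ x = 0
        · simp [hx']
        have h1 := hD.dvv_mul x (hκ.supp (mem_tsupport_of_ne hx'))
        rw [pow_zero] at h1
        have e : B * (κ x ^ 2 * p x) * dv v (dv v f) x = B * κ x ^ 2 := by
          linear_combination B * κ x ^ 2 * h1
        rw [e]
        positivity)
    (B := c) (fun x hx => hc x (hbκ x (subset_tsupport b hx))) c0 hρ ht
  refine h.trans ?_
  have e1 : ∫ x, ‖dv v b x‖ ≤ ‖v‖ * B * ∫ x, κ x := by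
    rw [← integral_const_mul]
    refine integral_mono_of_nonneg (.of_forall fun x => norm_nonneg _)
      ((hκ.smooth.continuous.integrable_of_hasCompactSupport hκ.compact).const_mul _)
      (.of_forall fun x => ?_)
    by_cases hx : x ∈ tsupport b
    · change ‖dv v b x‖ ≤ ‖v‖ * B * κ x
      rw [hκb x hx, mul_one, mul_comm]
      exact ((fderiv ℝ b x).le_opNorm v).trans
        (mul_le_mul_of_nonneg_right (hB' x) (norm_nonneg _))
    · change ‖dv v b x‖ ≤ ‖v‖ * B * κ x
      have := hκ.nonneg x
      rw [dv, fderiv_of_notMem_tsupport ℝ hx, zero_apply, norm_zero]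
      positivity
  have e2 : ∫ x, |dv v (fun x => B * (κ x ^ 2 * p x)) x|
      = B * ∫ x, |dv v (fun x => κ x ^ 2 * p x) x| := by
    rw [← integral_const_mul]
    congr 1
    ext x
    rw [dv, fderiv_const_mul (hm.differentiable one_ne_zero x)]
    simp only [smul_apply, smul_eq_mul, abs_mul, abs_of_nonneg hB0]
    rfl
  rw [e2]
  have e3 := mul_le_mul_of_nonneg_left e1 (show 0 ≤ (|t| * ρ)⁻¹ by positivity)
  refine (add_le_add e3 le_rfl).trans (le_of_eq ?_)
  ring

/-- Two transversal constraints: `∂_v φ` is constant along the Hamiltonian field while `w` moves at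
nonzero speed. The sublevel estimate for `w` along this field gives `θ`, and the surviving factor
`lor` gives `ρ`. This replaces the positive power of `θ` that damping would provide. -/
theorem LocalData.exists_strip_area_le (hD : LocalData f w u p q v v' 0 M U) (hκ : IsCutoff κ U)
    {r : Plane → ℝ} (hr : ContDiff ℝ ∞ r) (hwr : ∀ x ∈ U, along (ham v v' f) w x * r x = 1) :
    ∃ C, 0 ≤ C ∧ ∀ (σ : Plane) (ρ θ : ℝ), 0 < ρ → 0 < θ →
      ∫ x, κ x ^ 4 * (lor (w x / θ) * lor (dv v (phase f σ) x / ρ) ^ 2) ≤ C * θ * ρ := by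
  have hf := hD.smooth_f
  have hX := contDiff_ham hf v v'
  have hκ2 : ContDiff ℝ ∞ fun x => κ x ^ 2 := hκ.smooth.pow 2
  have hκr : ContDiff ℝ ∞ fun x => κ x ^ 2 * r x := hκ2.mul hr
  have hm : ContDiff ℝ ∞ fun x => κ x ^ 2 * (κ x ^ 2 * r x) := hκ2.mul hκr
  obtain ⟨C, C0, hC⟩ := hD.exists_area_zero_le hκ
  obtain ⟨c1, c10, h1⟩ := exists_bound_tsupport hκ.compact (contDiff_along hX hκr).continuous
  obtain ⟨c2, c20, h2⟩ := exists_bound_tsupport hκ.compact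
    ((contDiff_along hX hκ2).mul hr).continuous
  refine ⟨2 * (c1 + c2) * C, by positivity, fun σ ρ θ hρ hθ => ?_⟩
  have h := integral_lor_sq_mul_lor_le (v := v) (v' := v') (σ := σ) hf (ContDiff.one_of_infty hm)
    (hasCompactSupport_of_imp hκ.compact fun x hx => by simp [hx]) hD.smooth_w (ρ := ρ) hθ
  have e : ∀ x, κ x ^ 2 * (κ x ^ 2 * r x) * lor (dv v (phase f σ) x / ρ) ^ 2 * lor (w x / θ)
      * along (ham v v' f) w x
      = κ x ^ 4 * (lor (w x / θ) * lor (dv v (phase f σ) x / ρ) ^ 2) := by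
    intro x
    by_cases hx : κ x = 0
    · simp [hx]
    have := hwr x (hκ.supp (mem_tsupport_of_ne hx))
    linear_combination κ x ^ 4 * (lor (w x / θ) * lor (dv v (phase f σ) x / ρ) ^ 2) * this
  simp only [e] at h
  refine ((le_abs_self _).trans h).trans ?_
  have hlo := continuous_lor_comp (contDiff_dv (contDiff_phase hf σ) v).continuous ρ
  have h3 : ∫ x, |along (ham v v' f) (fun x => κ x ^ 2 * (κ x ^ 2 * r x)) x|
      * lor (dv v (phase f σ) x / ρ) ^ 2
      ≤ (c1 + c2) * ∫ x, κ x ^ 2 * lor (dv v (phase f σ) x / ρ) := by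
    rw [← integral_const_mul]
    refine integral_mono_of_nonneg (.of_forall fun x => by positivity) ?_ (.of_forall fun x => ?_)
    · refine (Continuous.integrable_of_hasCompactSupport ?_
        (hasCompactSupport_of_imp hκ.compact fun x hx => by simp [hx])).const_mul _
      exact (hκ.smooth.continuous.pow 2).mul hlo
    · have hlp := lor_pos (dv v (phase f σ) x / ρ)
      have hmul := along_mul (X := ham v v' f) (hκ2.differentiable (by simp) x)
        (hκr.differentiable (by simp) x)
      have hb : |along (ham v v' f) (fun x => κ x ^ 2 * (κ x ^ 2 * r x)) x| ≤ (c1 + c2) * κ x ^ 2 := by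
        rw [hmul]
        by_cases hx : κ x = 0
        · simp [hx]
        have hmem := mem_tsupport_of_ne hx
        have g1 := h1 x hmem
        have g2 := h2 x hmem
        rw [Real.norm_eq_abs] at g1 g2
        calc _ ≤ κ x ^ 2 * |along (ham v v' f) (fun x => κ x ^ 2 * r x) x|
              + κ x ^ 2 * |along (ham v v' f) (fun x => κ x ^ 2) x * r x| := by
              refine (abs_add_le _ _).trans (le_of_eq ?_)
              rw [abs_mul, abs_of_nonneg (sq_nonneg (κ x)), abs_mul, abs_mul, abs_mul,
                abs_of_nonneg (sq_nonneg (κ x))]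
              ring
          _ ≤ κ x ^ 2 * c1 + κ x ^ 2 * c2 := by gcongr
          _ = _ := by ring
      calc _ ≤ (c1 + c2) * κ x ^ 2 * lor (dv v (phase f σ) x / ρ) :=
            mul_le_mul hb (lor_sq_le _) (sq_nonneg _) (by positivity)
        _ = _ := by ring
  calc _ ≤ 2 * θ * ((c1 + c2) * (C * ρ)) := by
        refine mul_le_mul_of_nonneg_left (h3.trans ?_) (by positivity)
        exact mul_le_mul_of_nonneg_left (hC σ ρ hρ) (by positivity)
    _ = _ := by ring

/-- One-sided sum of dyadic pieces, near the zeros of `∂_v φ`. -/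
theorem LocalData.exists_sum_piece_lor_le (hD : LocalData f w u p q v v' 0 M U)
    (hκ : IsCutoff κ U) {r : Plane → ℝ} (hr : ContDiff ℝ ∞ r)
    (hwr : ∀ x ∈ U, along (ham v v' f) w x * r x = 1) :
    ∃ s : ℝ, 0 < s ∧ s ≤ 1 ∧ ∀ (R : ℝ) (g : Plane → ℝ), ContDiff ℝ 1 g → ∃ C, 0 ≤ C ∧
      ∀ σ : Plane, ‖σ‖ ≤ R →
      ∀ (a : Plane → ℂ) (A : ℝ), ContDiff ℝ 1 a → (∀ x ∈ tsupport a, κ x = 1) →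
      (∀ x, ‖a x‖ ≤ A) → (∀ x, ‖fderiv ℝ a x‖ ≤ A) → ∀ t ρ : ℝ, 1 ≤ |t| → 0 < ρ →
        ρ ≤ |t| ^ (-(1 / 3) : ℝ) → ∀ N,
        ∑ l ∈ Finset.range N, ‖∫ x, piece a g w 0 ((1 / 2 : ℝ) ^ l) x *
          ((lor (dv v (phase f σ) x / ρ) ^ 2) • osc t (phase f σ) x)‖
          ≤ C * A * ρ * |t| ^ (-(s / 3)) := by
  -- The area bound provides `θ^1`. The Hessian bound loses `θ^(-(M+1))`, and a further `1 / θ`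
  -- comes from the area estimate on the strip.
  obtain ⟨s, S, hs0, hs1, hS0, hS⟩ := exists_dyadic_sum_le (c := 1) one_pos (M + 2)
  refine ⟨s, hs0, hs1, fun R g hg => ?_⟩
  obtain ⟨C0, h00, h0⟩ := exists_isPiece hκ hg hD.smooth_w 0
  obtain ⟨C1, h10, h1⟩ := hD.exists_strip_area_le hκ hr hwr
  obtain ⟨C2, h20, h2⟩ := hD.exists_piece_lor_le hκ isProfile_strip R
  obtain ⟨C3, h30, h3⟩ := hD.exists_area_le hκ isProfile_strip
  obtain ⟨C4, h40, h4⟩ := exists_integral_strip_le_const (κ := κ) hκ isProfile_strip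
    hD.smooth_w.continuous
  refine ⟨S * ((17 * C1 + C2 * 3 * (C3 * C4)) * C0), by positivity,
    fun σ hσ a A ha hκa hA hA' t ρ ht1 hρ hρη N => ?_⟩
  have hA0 : 0 ≤ A := (norm_nonneg _).trans (hA 0)
  have ht0 : 0 < |t| := by linarith
  have ht : t ≠ 0 := abs_pos.mp ht0
  have hcomm : ∀ (b : Plane → ℂ), ∫ x, b x * ((lor (dv v (phase f σ) x / ρ) ^ 2) • osc t (phase f σ) x)
      = ∫ x, (lor (dv v (phase f σ) x / ρ) ^ 2) • (b x * osc t (phase f σ) x) := by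
    intro b
    congr 1
    ext x
    rw [mul_smul_comm]
  have hlo := continuous_lor_comp (contDiff_dv (contDiff_phase hD.smooth_f σ) v).continuous ρ
  have key := hS ((17 * C1 + C2 * 3 * (C3 * C4)) * C0 * A * ρ) (|t| ^ (-(1 / 3) : ℝ))
    (fun l => ‖∫ x, piece a g w 0 ((1 / 2 : ℝ) ^ l) x *
          ((lor (dv v (phase f σ) x / ρ) ^ 2) • osc t (phase f σ) x)‖)
    (by positivity) (by positivity) (fun l => norm_nonneg _) (fun l => ?_) (fun l => ?_) N
  · refine key.trans (le_of_eq ?_)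
    rw [← Real.rpow_mul ht0.le, show -(1 / 3) * s = -(s / 3) by ring]
    ring
  · have hθ0 : (0 : ℝ) < (1 / 2) ^ l := by positivity
    have hθ1 : ((1 : ℝ) / 2) ^ l ≤ 1 := pow_le_one₀ (by norm_num) (by norm_num)
    have hp := h0 a A ha hκa hA hA' _ hθ0 hθ1
    rw [hcomm]
    set θ : ℝ := (1 / 2) ^ l
    rw [Real.rpow_zero, mul_one] at hp
    have hlw := continuous_lor_comp hD.smooth_w.continuous θ
    have b1 : ‖∫ x, (lor (dv v (phase f σ) x / ρ) ^ 2) • (piece a g w 0 θ x * osc t (phase f σ) x)‖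
        ≤ C0 * A * 17 * ∫ x, κ x ^ 4 * (lor (w x / θ) * lor (dv v (phase f σ) x / ρ) ^ 2) := by
      rw [← integral_const_mul]
      refine norm_integral_le_of_norm_le ?_ (.of_forall fun x => ?_)
      · refine (Continuous.integrable_of_hasCompactSupport ?_
          (hasCompactSupport_of_imp hκ.compact fun x hx => by simp [hx])).const_mul _
        exact (hκ.smooth.continuous.pow 4).mul (hlw.mul (hlo.pow 2))
      · rw [norm_smul, norm_mul, norm_osc, mul_one, Real.norm_eq_abs, abs_of_nonneg (sq_nonneg _)]
        have k1 := hp.sq.sq.norm_le hκ.sq.sq isProfile_strip.sq.sq x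
        have k2 := isProfile_strip.sq.sq.le_lor (w x / θ)
        have k3 : ((κ x ^ 2) ^ 2) = κ x ^ 4 := by ring
        simp only [k3] at k1
        calc _ ≤ lor (dv v (phase f σ) x / ρ) ^ 2 * (C0 * A * (κ x ^ 4 * (17 * lor (w x / θ)))) := by
              gcongr
              refine k1.trans ?_
              gcongr
          _ = _ := by ring
    refine b1.trans ?_
    rw [Real.rpow_one]
    calc _ ≤ C0 * A * 17 * (C1 * θ * ρ) := by
          gcongr
          exact h1 σ ρ θ hρ hθ0
      _ = (17 * C1) * C0 * A * ρ * θ := by ring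
      _ ≤ _ := by
          gcongr
          have : 0 ≤ C2 * 3 * (C3 * C4) := by positivity
          linarith
  · have hθ0 : (0 : ℝ) < (1 / 2) ^ l := by positivity
    have hθ1 : ((1 : ℝ) / 2) ^ l ≤ 1 := pow_le_one₀ (by norm_num) (by norm_num)
    have hp := h0 a A ha hκa hA hA' _ hθ0 hθ1
    rw [hcomm]
    set θ : ℝ := (1 / 2) ^ l
    rw [Real.rpow_zero, mul_one] at hp
    set η : ℝ := |t| ^ (-(1 / 3) : ℝ) with hηd
    have hη : 0 < η := by positivity
    have hη1 : η ≤ 1 := Real.rpow_le_one_of_one_le_of_nonpos ht1 (by norm_num)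
    have e3 : (|t| * η ^ 2)⁻¹ = η := inv_mul_sq_rpow ht0
    have a1 := h2 θ _ hθ0 hθ1 _ hp σ hσ ρ η t hρ hη hη1 ht
    have a2 := h3 θ hθ0 hθ1 σ ρ hρ
    refine a1.trans ?_
    have b3 : (|t| * η ^ 2)⁻¹ + η + ρ ≤ 3 * η := by rw [e3]; linarith
    set J := ∫ x, κ x ^ 2 * strip (w x / θ) ^ 2 * lor (dv v (phase f σ) x / ρ) with hJ
    have hJ0 : 0 ≤ J := integral_nonneg fun x => by
      have := lor_pos (dv v (phase f σ) x / ρ)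
      positivity
    have b4 : J ≤ C3 * ρ * (θ⁻¹) ^ (0 + 1) * C4 :=
      a2.trans (mul_le_mul_of_nonneg_left (h4 θ) (by positivity))
    calc _ ≤ C2 * (C0 * A) * (θ⁻¹) ^ (2 * 0 + M + 1) * (3 * η) * (C3 * ρ * (θ⁻¹) ^ (0 + 1) * C4) := by
          gcongr
      _ = (C2 * 3 * (C3 * C4)) * C0 * A * ρ * η * (θ⁻¹) ^ (M + 2) := by ring
      _ ≤ _ := by
          gcongr
          have : 0 ≤ 17 * C1 := by positivity
          linarith

/-- Decay for the amplitude `a g` where `∂_v² f` does not vanish. -/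
theorem LocalData.exists_decay (hD : LocalData f w u p q v v' 0 M U) (hκ : IsCutoff κ U)
    {r : Plane → ℝ} (hr : ContDiff ℝ ∞ r) (hwr : ∀ x ∈ U, along (ham v v' f) w x * r x = 1) :
    ∃ s : ℝ, 0 < s ∧ ∀ (R : ℝ) (g : Plane → ℝ), ContDiff ℝ 1 g → ∃ C, 0 ≤ C ∧ ∀ σ : Plane, ‖σ‖ ≤ R →
      ∀ (a : Plane → ℂ) (A : ℝ), ContDiff ℝ 1 a → (∀ x ∈ tsupport a, κ x = 1) →
      (∀ x, ‖a x‖ ≤ A) → (∀ x, ‖fderiv ℝ a x‖ ≤ A) → ∀ t : ℝ, 1 ≤ |t| →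
        ‖∫ x, (g x • a x) * osc t (phase f σ) x‖ ≤ C * A * |t| ^ (-(1 / 2 + s)) := by
  have hf := hD.smooth_f
  obtain ⟨s1, hs1, hs11, H1⟩ := hD.exists_sum_piece_lor_le hκ hr hwr
  obtain ⟨s2, hs2, hs21, H2⟩ := hD.neg.exists_sum_piece_lor_le hκ hr.neg (fun x hx => by
    have : along (ham v v' f) (fun x => -w x) x = - along (ham v v' f) w x := by
      simp [along, fderiv_fun_neg]
    rw [this, neg_mul_neg, hwr x hx])
  set s := min s1 s2 with hs
  have hs0 : 0 < s := lt_min hs1 hs2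
  have hsle : s ≤ 1 := (min_le_left _ _).trans hs11
  refine ⟨s / 6, by positivity, fun R g hg => ?_⟩
  obtain ⟨C1, h10, h1⟩ := H1 R g hg
  obtain ⟨C2, h20, h2⟩ := H2 R g hg
  obtain ⟨C3, h30, h3⟩ := hD.exists_one_sub_le hκ
  obtain ⟨C4, h40, h4⟩ := hD.exists_strip_area_le hκ hr hwr
  obtain ⟨c1, c10, hc1⟩ := exists_bound_tsupport hκ.compact hg.continuous
  obtain ⟨c2, c20, hc2⟩ := exists_bound_tsupport hκ.compact (hg.continuous_fderiv one_ne_zero)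
  refine ⟨C3 * (c1 + c2) + (C1 + C2), by positivity, fun σ hσ a A ha hκa hA hA' t ht1 => ?_⟩
  have hA0 : 0 ≤ A := (norm_nonneg _).trans (hA 0)
  have ht0 : 0 < |t| := by linarith
  have ht : t ≠ 0 := abs_pos.mp ht0
  have haκ : ∀ x ∈ tsupport a, x ∈ tsupport κ := fun x hx =>
    mem_tsupport_of_ne (by rw [hκa x hx]; exact one_ne_zero)
  have hac : HasCompactSupport a := hκ.compact.of_isClosed_subset (isClosed_tsupport _) haκ
  -- This balances `1 / (|t| ρ)` with `ρ |t|^(-s/3)`: both equal `|t|^(-1/2 - s/6)`.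
  set ρ : ℝ := |t| ^ (-(1 / 2) + s / 6) with hρd
  have hρ : 0 < ρ := by positivity
  have hρη : ρ ≤ |t| ^ (-(1 / 3) : ℝ) :=
    Real.rpow_le_rpow_of_exponent_le ht1 (by linarith)
  set E := |t| ^ (-(1 / 2 + s / 6)) with hE
  have e1 : (|t| * ρ)⁻¹ = E := by
    rw [hρd, hE]
    nth_rewrite 1 [← Real.rpow_one |t|]
    rw [← Real.rpow_add ht0, ← Real.rpow_neg ht0.le]
    congr 1
    ring
  have e2 : ∀ {s' : ℝ}, s ≤ s' → ρ * |t| ^ (-(s' / 3)) ≤ E := by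
    intro s' h
    rw [hρd, hE, ← Real.rpow_add ht0]
    exact Real.rpow_le_rpow_of_exponent_le ht1 (by linarith)
  -- away from the zeros of `∂_v φ`
  have hb : ContDiff ℝ 1 fun x => g x • a x := hg.smul ha
  have hsub : tsupport (fun x => g x • a x) ⊆ tsupport a :=
    closure_mono fun x hx => by
      simp only [Function.mem_support] at hx ⊢
      exact fun h => hx (by simp [h])
  have hbc : HasCompactSupport fun x => g x • a x :=
    hasCompactSupport_of_imp hac fun x hx => by simp [hx]
  have hbB : ∀ x, ‖g x • a x‖ ≤ (c1 + c2) * A := by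
    intro x
    by_cases hx : x ∈ tsupport a
    · rw [norm_smul]
      exact mul_le_mul ((hc1 x (haκ x hx)).trans (by linarith)) (hA x) (norm_nonneg _) (by positivity)
    · rw [image_eq_zero_of_notMem_tsupport hx, smul_zero, norm_zero]
      positivity
  have hbB' : ∀ x, ‖fderiv ℝ (fun x => g x • a x) x‖ ≤ (c1 + c2) * A := by
    intro x
    by_cases hx : x ∈ tsupport a
    · rw [fderiv_fun_smul (hg.differentiable one_ne_zero x) (ha.differentiable one_ne_zero x)]
      refine (norm_add_le _ _).trans ?_
      rw [norm_smul, ContinuousLinearMap.norm_smulRight_apply, add_mul]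
      exact add_le_add (mul_le_mul (hc1 x (haκ x hx)) (hA' x) (norm_nonneg _) c10)
        (mul_le_mul (hc2 x (haκ x hx)) (hA x) (norm_nonneg _) c20)
    · rw [fderiv_of_notMem_tsupport ℝ fun h => hx (hsub h), norm_zero]
      positivity
  have a1 := h3 _ _ hb (fun x hx => hκa x (hsub hx)) hbB hbB' σ ρ t hρ ht
  rw [e1] at a1
  rw [integral_split_lor hf hb.continuous hbc v σ ρ t]
  refine (norm_add_le _ _).trans ?_
  rw [show (C3 * (c1 + c2) + (C1 + C2)) * A * E = C3 * ((c1 + c2) * A) * E + (C1 + C2) * A * E by ring]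
  refine add_le_add a1 ?_
  -- near the zeros of `∂_v φ`
  set F : Plane → ℂ := fun x => (lor (dv v (phase f σ) x / ρ) ^ 2) • osc t (phase f σ) x with hFd
  have hlo := continuous_lor_comp (contDiff_dv (contDiff_phase hf σ) v).continuous ρ
  have hF : Continuous F :=
    (hlo.pow 2).smul (contDiff_osc (n := ⊤) (contDiff_phase hf σ)).continuous
  have hsm : ∀ {w : Plane → ℝ}, ContDiff ℝ ∞ w → ∀ l : ℕ,
      Continuous (piece a g w 0 ((1 / 2 : ℝ) ^ l)) := by
    intro w hw l
    have := (contDiff_dyadic 0).continuous.comp (hw.continuous.div_const ((1 / 2 : ℝ) ^ l))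
    exact (hg.continuous.mul (continuous_const.mul this)).smul ha.continuous
  have hrw : ∫ x, (lor (dv v (phase f σ) x / ρ) ^ 2) • ((g x • a x) * osc t (phase f σ) x)
      = ∫ x, ((g x * |w x| ^ (0 : ℝ)) • a x) * F x := by
    congr 1
    ext x
    rw [hFd, Real.rpow_zero, mul_one, mul_smul_comm]
  rw [hrw]
  have hrem : ∀ N : ℕ, ‖∫ x, ((g x * (|w x| ^ (0 : ℝ) * remFactor w N x)) • a x) * F x‖
      ≤ c1 * A * 5 * (C4 * (1 / 2 : ℝ) ^ N * ρ) := by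
    intro N
    have hθ0 : (0 : ℝ) < (1 / 2) ^ N := by positivity
    refine le_trans ?_ (mul_le_mul_of_nonneg_left (h4 σ ρ _ hρ hθ0) (by positivity))
    rw [← integral_const_mul]
    have hlw := continuous_lor_comp hD.smooth_w.continuous ((1 / 2 : ℝ) ^ N)
    refine norm_integral_le_of_norm_le ?_ (.of_forall fun x => ?_)
    · refine (Continuous.integrable_of_hasCompactSupport ?_
        (hasCompactSupport_of_imp hκ.compact fun x hx => by simp [hx])).const_mul _
      exact (hκ.smooth.continuous.pow 4).mul (hlw.mul (hlo.pow 2))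
    · have hlp := lor_pos (w x / (1 / 2 : ℝ) ^ N)
      by_cases hx : x ∈ tsupport a
      · rw [hκa x hx, Real.rpow_zero, one_mul, norm_mul, norm_smul, norm_mul, hFd, norm_smul, norm_osc,
          mul_one, Real.norm_of_nonneg (sq_nonneg _)]
        -- On the support of the remainder `|w| ≤ 2 θ` with `θ = 2^(-N)`, whence `5 = 1 + 2²`.
        have h5 : ‖remFactor w N x‖ ≤ 5 * lor (w x / (1 / 2 : ℝ) ^ N) := by
          by_cases h0 : remFactor w N x = 0
          · rw [h0, norm_zero]; positivity
          · refine (abs_remFactor_le w N x).trans ?_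
            have h6 : |w x / (1 / 2 : ℝ) ^ N| ≤ 2 := by
              rw [abs_div, abs_of_pos hθ0, div_le_iff₀ hθ0]
              exact remFactor_supp h0
            have h7 : (w x / (1 / 2 : ℝ) ^ N) ^ 2 ≤ 4 := by
              rw [← sq_abs]
              nlinarith [abs_nonneg (w x / (1 / 2 : ℝ) ^ N)]
            rw [lor, ← div_eq_mul_inv, le_div_iff₀ (by positivity)]
            linarith
        calc _ ≤ c1 * (5 * lor (w x / (1 / 2 : ℝ) ^ N)) * A * lor (dv v (phase f σ) x / ρ) ^ 2 := by
              gcongr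
              · exact hc1 x (haκ x hx)
              · exact hA x
          _ = _ := by ring
      · rw [image_eq_zero_of_notMem_tsupport hx, smul_zero, zero_mul, norm_zero]
        positivity
  have hlim : Tendsto (fun N : ℕ => (C1 + C2) * A * E + c1 * A * 5 * (C4 * (1 / 2 : ℝ) ^ N * ρ)) atTop
      (𝓝 ((C1 + C2) * A * E)) := by
    have h1 : Tendsto (fun N : ℕ => (1 / 2 : ℝ) ^ N) atTop (𝓝 0) :=
      tendsto_pow_atTop_nhds_zero_of_lt_one (by norm_num) (by norm_num)
    simpa using (((h1.const_mul C4).mul_const ρ).const_mul (c1 * A * 5)).const_add ((C1 + C2) * A * E)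
  -- With no damping, the remainder tends to zero because the area of `{|w| ≲ 2^(-N), |∂_v φ| ≲ ρ}`
  -- does.
  refine ge_of_tendsto hlim (.of_forall fun N => ?_)
  rw [integral_eq_sum_piece ha.continuous hac hg.continuous hD.smooth_w.continuous le_rfl
    (fun x hx => hD.abs_le x (hκ.supp (haκ x (subset_tsupport a hx))))
    (hsm hD.smooth_w) (hsm hD.smooth_w.neg) hF N]
  refine (norm_add_le _ _).trans (add_le_add ((norm_add_le _ _).trans ?_) (hrem N))
  have b1 := (norm_sum_le _ _).trans (h1 σ hσ a A ha hκa hA hA' t ρ ht1 hρ hρη N)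
  have b2 := (norm_sum_le _ _).trans (h2 σ hσ a A ha hκa hA hA' t ρ ht1 hρ hρη N)
  have g1 : C1 * A * ρ * |t| ^ (-(s1 / 3)) ≤ C1 * A * E := by
    rw [mul_assoc]
    exact mul_le_mul_of_nonneg_left (e2 (min_le_left _ _)) (by positivity)
  have g2 : C2 * A * ρ * |t| ^ (-(s2 / 3)) ≤ C2 * A * E := by
    rw [mul_assoc]
    exact mul_le_mul_of_nonneg_left (e2 (min_le_right _ _)) (by positivity)
  refine (add_le_add (b1.trans g1) (b2.trans g2)).trans (le_of_eq ?_)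
  ring

end UndampedDecay

/-! ### The Sobolev embedding -/

theorem enorm_le_lintegral_dv {F : Type*} [NormedAddCommGroup F] [NormedSpace ℝ F]
    {h : Plane → F} (hh : ContDiff ℝ 1 h) (hc : HasCompactSupport h) (v : Plane) (hv : v ≠ 0)
    (x : Plane) : ‖h x‖ₑ ≤ ∫⁻ s : ℝ, ‖fderiv ℝ h (x + s • v) v‖ₑ := by
  have hd : ∀ s : ℝ, HasDerivAt (fun s : ℝ => h (x + s • v)) (fderiv ℝ h (x + s • v) v) s := by
    intro s
    have h1 : HasDerivAt (fun s : ℝ => x + s • v) v s := by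
      simpa using ((hasDerivAt_id s).smul_const v).const_add x
    exact ((hh.differentiable one_ne_zero (x + s • v)).hasFDerivAt).comp_hasDerivAt s h1
  have hcs : HasCompactSupport fun s : ℝ => h (x + s • v) := by
    refine hc.comp_isClosedEmbedding (g := fun s : ℝ => x + s • v) ?_
    exact (Homeomorph.addLeft x).isClosedEmbedding.comp (isClosedEmbedding_smul_left hv)
  have hC : ContDiff ℝ 1 fun s : ℝ => h (x + s • v) :=
    hh.comp (contDiff_const.add (contDiff_id.smul contDiff_const))
  have := hcs.enorm_le_lintegral_Ici_deriv hC 0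
  simp only [zero_smul, add_zero] at this
  refine this.trans ((setLIntegral_le_lintegral _ _).trans ?_)
  refine lintegral_mono fun s => ?_
  rw [(hd s).deriv]

theorem lintegral_plane {g : Plane → ℝ≥0∞} (hg : Measurable g) :
    ∫⁻ x, g x = ∫⁻ s : ℝ, ∫⁻ u : ℝ, g !₂[s, u] := by
  have hg' : Measurable fun y : Fin 2 → ℝ => g (WithLp.toLp 2 y) :=
    hg.comp (PiLp.volume_preserving_toLp (Fin 2)).measurable
  rw [← (PiLp.volume_preserving_toLp (Fin 2)).lintegral_comp hg,
    ← (volume_preserving_finTwoArrow ℝ).symm.lintegral_comp hg', Measure.volume_eq_prod]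
  exact lintegral_prod _ (hg'.comp (MeasurableEquiv.measurable _)).aemeasurable

theorem norm_fderiv_fderiv_le {F : Type*} [NormedAddCommGroup F] [NormedSpace ℝ F]
    {h : Plane → F} (hh : ContDiff ℝ 2 h) (i j : Fin 2) (x : Plane) :
    ‖fderiv ℝ (fun y => fderiv ℝ h y (EuclideanSpace.single i 1)) x (EuclideanSpace.single j 1)‖ ≤
      ‖iteratedFDeriv ℝ 2 h x‖ := by
  have hd : DifferentiableAt ℝ (fderiv ℝ h) x :=
    (hh.fderiv_right (m := 1) (by norm_num)).differentiable one_ne_zero x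
  have e : fderiv ℝ (fun y => fderiv ℝ h y (EuclideanSpace.single i 1)) x
      (EuclideanSpace.single j 1) =
      iteratedFDeriv ℝ 2 h x ![EuclideanSpace.single j 1, EuclideanSpace.single i 1] := by
    rw [iteratedFDeriv_two_apply, fderiv_clm_apply hd (differentiableAt_const _)]
    simp
  rw [e]
  refine (ContinuousMultilinearMap.le_opNorm _ _).trans ?_
  simp

/-- The fundamental theorem of calculus, once in each coordinate direction, bounds `h(x)` by the
integral of `|∂₁∂₀ h|`. Applied to `a` and to `Da`, it explains why three derivatives of the
amplitude suffice. -/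
theorem norm_le_integral_iteratedFDeriv_two {F : Type*} [NormedAddCommGroup F] [NormedSpace ℝ F]
    {h : Plane → F} (hh : ContDiff ℝ 2 h) (hc : HasCompactSupport h) (x : Plane) :
    ‖h x‖ ≤ ∫ y, ‖iteratedFDeriv ℝ 2 h y‖ := by
  have hcont : Continuous fun y => iteratedFDeriv ℝ 2 h y := hh.continuous_iteratedFDeriv le_rfl
  have hint : Integrable fun y => iteratedFDeriv ℝ 2 h y :=
    hcont.integrable_of_hasCompactSupport (hc.iteratedFDeriv 2)
  have key : ‖h x‖ₑ ≤ ∫⁻ y, ‖iteratedFDeriv ℝ 2 h y‖ₑ := by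
    rw [lintegral_plane (hcont.enorm.measurable)]
    have e0 : (EuclideanSpace.single 0 1 : Plane) ≠ 0 := by simp
    have e1 : (EuclideanSpace.single 1 1 : Plane) ≠ 0 := by simp
    have hk : ContDiff ℝ 1 fun y => fderiv ℝ h y (EuclideanSpace.single 0 1) :=
      (hh.fderiv_right (m := 1) (by norm_num)).clm_apply contDiff_const
    have hkc : HasCompactSupport fun y => fderiv ℝ h y (EuclideanSpace.single 0 1) :=
      hc.fderiv_apply ℝ _
    have h0 := enorm_le_lintegral_dv (hh.of_le (by norm_num)) hc _ e0 x
    refine h0.trans ?_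
    have sub : ∫⁻ s : ℝ, ‖fderiv ℝ h (x + s • EuclideanSpace.single 0 1)
        (EuclideanSpace.single 0 1)‖ₑ = ∫⁻ s : ℝ, ‖fderiv ℝ h !₂[s, x 1]
        (EuclideanSpace.single 0 1)‖ₑ := by
      rw [← lintegral_add_left_eq_self (fun s : ℝ => ‖fderiv ℝ h !₂[s, x 1]
        (EuclideanSpace.single 0 1)‖ₑ) (x 0)]
      congr 1 with s
      congr 3
      ext i; fin_cases i <;> simp
    rw [sub]
    refine lintegral_mono fun s => ?_
    refine (enorm_le_lintegral_dv hk hkc _ e1 _).trans ?_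
    have sub : ∫⁻ u : ℝ, ‖fderiv ℝ (fun y => fderiv ℝ h y (EuclideanSpace.single 0 1))
        (!₂[s, x 1] + u • EuclideanSpace.single 1 1) (EuclideanSpace.single 1 1)‖ₑ =
        ∫⁻ u : ℝ, ‖fderiv ℝ (fun y => fderiv ℝ h y (EuclideanSpace.single 0 1))
          !₂[s, u] (EuclideanSpace.single 1 1)‖ₑ := by
      rw [← lintegral_add_left_eq_self (fun u : ℝ => ‖fderiv ℝ
        (fun y => fderiv ℝ h y (EuclideanSpace.single 0 1))
          !₂[s, u] (EuclideanSpace.single 1 1)‖ₑ) (x 1)]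
      congr 1 with u
      congr 3
      ext i; fin_cases i <;> simp
    rw [sub]
    refine lintegral_mono fun u => ?_
    rw [enorm_le_iff_norm_le]
    exact norm_fderiv_fderiv_le hh 0 1 _
  rw [← ofReal_norm, ← ofReal_integral_norm_eq_lintegral_enorm hint] at key
  exact (ENNReal.ofReal_le_ofReal_iff (integral_nonneg fun _ => norm_nonneg _)).1 key

theorem integral_iteratedFDeriv_le_sobolevNorm (a : Plane → ℂ) {k : ℕ} (hk : k < 4) :
    ∫ x, ‖iteratedFDeriv ℝ k a x‖ ≤ sobolevNorm a :=
  Finset.single_le_sum (f := fun k => ∫ x, ‖iteratedFDeriv ℝ k a x‖)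
    (fun _ _ => integral_nonneg fun _ => norm_nonneg _) (Finset.mem_range.2 hk)

theorem sobolevNorm_nonneg (a : Plane → ℂ) : 0 ≤ sobolevNorm a :=
  Finset.sum_nonneg fun _ _ => integral_nonneg fun _ => norm_nonneg _

theorem integral_norm_le_sobolevNorm (a : Plane → ℂ) : ∫ x, ‖a x‖ ≤ sobolevNorm a := by
  simpa using integral_iteratedFDeriv_le_sobolevNorm a (k := 0) (by norm_num)

theorem norm_le_sobolevNorm {a : Plane → ℂ} (ha : ContDiff ℝ ∞ a) (hc : HasCompactSupport a)
    (x : Plane) : ‖a x‖ ≤ sobolevNorm a :=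
  (norm_le_integral_iteratedFDeriv_two (ha.of_le two_le_infty) hc x).trans
    (integral_iteratedFDeriv_le_sobolevNorm a (by norm_num))

theorem norm_fderiv_le_sobolevNorm {a : Plane → ℂ} (ha : ContDiff ℝ ∞ a)
    (hc : HasCompactSupport a) (x : Plane) : ‖fderiv ℝ a x‖ ≤ sobolevNorm a := by
  have h2 : ContDiff ℝ 2 (fderiv ℝ a) := ha.fderiv_right (m := 2) (by norm_cast)
  refine (norm_le_integral_iteratedFDeriv_two h2 (hc.fderiv ℝ) x).trans ?_
  simp only [norm_iteratedFDeriv_fderiv]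
  exact integral_iteratedFDeriv_le_sobolevNorm a (by norm_num)

/-! ### Decay estimates for germs -/

/-- For `|t| ≤ 1` the trivial `L¹` bound is enough. The factor `2^y` compares `1 + |t|` with `2`
there and with `2 |t|` for large `|t|`. -/
theorem exists_sobolev_decay {ι : Type*} {P : ι → Prop} {φ : ι → Plane → ℝ} {m : Plane → ℝ}
    {K : Set Plane} {C s : ℝ} (hK : IsCompact K) (hm : ContinuousOn m K) (hC0 : 0 ≤ C) (hs : 0 < s)
    (hC : ∀ i, P i → ∀ (a : Plane → ℂ) (A : ℝ), ContDiff ℝ 1 a → tsupport a ⊆ K →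
      (∀ x, ‖a x‖ ≤ A) → (∀ x, ‖fderiv ℝ a x‖ ≤ A) → ∀ t : ℝ, 1 ≤ |t| →
        ‖∫ x, (m x • a x) * osc t (φ i) x‖ ≤ C * A * |t| ^ (-(1 / 2 + s))) :
    ∃ C', ∀ i, P i → ∀ a : Plane → ℂ, ContDiff ℝ ∞ a → tsupport a ⊆ K → ∀ t : ℝ,
      ‖∫ x, (m x • a x) * osc t (φ i) x‖ ≤ C' * sobolevNorm a * (1 + |t|) ^ (-(1 / 2 + s)) := by
  obtain ⟨B, hB⟩ := hK.exists_bound_of_continuousOn hm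
  set y := 1 / 2 + s with hy
  have hy0 : 0 < y := by positivity
  refine ⟨(C + |B|) * 2 ^ y, fun i hi a ha haK t => ?_⟩
  have hac : HasCompactSupport a := hK.of_isClosed_subset (isClosed_tsupport _) haK
  have hS := sobolevNorm_nonneg a
  have h1t : 0 < 1 + |t| := by positivity
  rcases le_total 1 |t| with ht | ht
  · refine (hC i hi a _ (ContDiff.one_of_infty ha) haK (norm_le_sobolevNorm ha hac)
      (norm_fderiv_le_sobolevNorm ha hac) t ht).trans ?_
    have e : |t| ^ (-y) ≤ 2 ^ y * (1 + |t|) ^ (-y) := by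
      have h : (2 * |t|) ^ (-y) ≤ (1 + |t|) ^ (-y) :=
        Real.rpow_le_rpow_of_nonpos h1t (by linarith) (by linarith)
      rw [Real.mul_rpow (by norm_num) (by positivity), Real.rpow_neg (by norm_num),
        inv_mul_le_iff₀ (by positivity)] at h
      exact h
    calc C * sobolevNorm a * |t| ^ (-y) ≤ (C + |B|) * sobolevNorm a * (2 ^ y * (1 + |t|) ^ (-y)) := by
          gcongr
          linarith [abs_nonneg B]
      _ = _ := by ring
  · have e : 1 ≤ 2 ^ y * (1 + |t|) ^ (-y) := by
      have h : (2 : ℝ) ^ (-y) ≤ (1 + |t|) ^ (-y) :=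
        Real.rpow_le_rpow_of_nonpos h1t (by linarith) (by linarith)
      rw [Real.rpow_neg (by norm_num), inv_le_iff_one_le_mul₀' (by positivity)] at h
      exact h
    have hb : ‖∫ x, (m x • a x) * osc t (φ i) x‖ ≤ ∫ x, |B| * ‖a x‖ := by
      refine norm_integral_le_of_norm_le
        ((ha.continuous.norm.integrable_of_hasCompactSupport hac.norm).const_mul _)
        (Eventually.of_forall fun x => ?_)
      rw [norm_mul, norm_osc, mul_one, norm_smul]
      by_cases hx : x ∈ tsupport a
      · gcongr
        exact (hB x (haK hx)).trans (le_abs_self _)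
      · simp [image_eq_zero_of_notMem_tsupport hx]
    rw [integral_const_mul] at hb
    calc _ ≤ |B| * ∫ x, ‖a x‖ := hb
      _ ≤ (C + |B|) * sobolevNorm a := by
          gcongr
          · linarith
          · exact integral_norm_le_sobolevNorm a
      _ ≤ (C + |B|) * sobolevNorm a * (2 ^ y * (1 + |t|) ^ (-y)) :=
          le_mul_of_one_le_right (by positivity) e
      _ = _ := by ring

/-- `f` is smooth on a neighbourhood of `x₀`. -/
def SmoothNear (f : Plane → ℝ) (x₀ : Plane) : Prop := ∀ᶠ x in 𝓝 x₀, ContDiffAt ℝ ∞ f x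

theorem exists_cutoff {V : Set Plane} {x₀ : Plane} (hV : V ∈ 𝓝 x₀) :
    ∃ κ : Plane → ℝ, IsCutoff κ V ∧ ∃ K ∈ 𝓝 x₀, IsCompact K ∧ K ⊆ V ∧ ∀ x ∈ K, κ x = 1 := by
  obtain ⟨ε, ε0, hε⟩ := Metric.mem_nhds_iff.1 hV
  let b : ContDiffBump x₀ := ⟨ε / 4, ε / 2, by positivity, by linarith⟩
  have hsub : Metric.closedBall x₀ (ε / 2) ⊆ V :=
    (Metric.closedBall_subset_ball (by linarith)).trans hε
  refine ⟨b, ⟨b.contDiff, b.hasCompactSupport, ?_, fun x => b.nonneg, fun x => b.le_one⟩,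
    Metric.closedBall x₀ (ε / 4), Metric.closedBall_mem_nhds _ (by positivity),
    isCompact_closedBall _ _, (Metric.closedBall_subset_closedBall (by linarith)).trans hsub,
    fun x hx => b.one_of_mem_closedBall hx⟩
  rw [b.tsupport_eq]
  exact hsub

theorem IsCutoff.contDiff_mul {κ g : Plane → ℝ} {V : Set Plane} {n : ℕ∞} (hκ : IsCutoff κ V)
    (hg : ∀ x ∈ V, ContDiffAt ℝ n g x) : ContDiff ℝ n fun x => κ x * g x := by
  rw [contDiff_iff_contDiffAt]
  intro x
  by_cases hx : x ∈ tsupport κ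
  · exact (hκ.smooth.contDiffAt.of_le (by exact_mod_cast le_top)).mul (hg x (hκ.supp hx))
  · have : (fun x => κ x * g x) =ᶠ[𝓝 x] fun _ => 0 := by
      filter_upwards [(isClosed_tsupport κ).isOpen_compl.mem_nhds hx] with y hy
      rw [image_eq_zero_of_notMem_tsupport hy, zero_mul]
    exact contDiffAt_const.congr_of_eventuallyEq this

theorem SmoothNear.exists_contDiff {f : Plane → ℝ} {x₀ : Plane} (hf : SmoothNear f x₀) :
    ∃ F : Plane → ℝ, ContDiff ℝ ∞ F ∧ F =ᶠ[𝓝 x₀] f := by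
  obtain ⟨κ, hκ, K, hK, -, -, h1⟩ := exists_cutoff hf
  refine ⟨fun x => κ x * f x, hκ.contDiff_mul fun x hx => hx, ?_⟩
  filter_upwards [hK] with x hx
  rw [h1 x hx, one_mul]

theorem SmoothNear.inv {f : Plane → ℝ} {x₀ : Plane} (hf : SmoothNear f x₀) (h0 : f x₀ ≠ 0) :
    SmoothNear (fun x => (f x)⁻¹) x₀ := by
  have hc : ContinuousAt f x₀ := (Eventually.self_of_nhds hf).continuousAt
  filter_upwards [hf, hc.eventually_ne h0] with x hx hx0
  exact hx.inv hx0

theorem SmoothNear.congr {f g : Plane → ℝ} {x₀ : Plane} (hf : SmoothNear f x₀)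
    (h : g =ᶠ[𝓝 x₀] f) : SmoothNear g x₀ := by
  filter_upwards [hf, h.eventuallyEq_nhds] with x hx hx'
  exact hx.congr_of_eventuallyEq hx'

theorem SmoothNear.dv {f : Plane → ℝ} {x₀ : Plane} (hf : SmoothNear f x₀) (v : Plane) :
    SmoothNear (dv v f) x₀ := by
  filter_upwards [hf] with x hx
  exact (hx.fderiv_right (m := ∞) (by norm_cast)).clm_apply contDiffAt_const

theorem SmoothNear.continuousAt {f : Plane → ℝ} {x₀ : Plane} (hf : SmoothNear f x₀) :
    ContinuousAt f x₀ :=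
  (Eventually.self_of_nhds hf).continuousAt

theorem SmoothNear.mul {f g : Plane → ℝ} {x₀ : Plane} (hf : SmoothNear f x₀)
    (hg : SmoothNear g x₀) : SmoothNear (fun x => f x * g x) x₀ := by
  filter_upwards [hf, hg] with x h1 h2 using h1.mul h2

theorem SmoothNear.add {f g : Plane → ℝ} {x₀ : Plane} (hf : SmoothNear f x₀)
    (hg : SmoothNear g x₀) : SmoothNear (fun x => f x + g x) x₀ := by
  filter_upwards [hf, hg] with x h1 h2 using h1.add h2

theorem SmoothNear.sub {f g : Plane → ℝ} {x₀ : Plane} (hf : SmoothNear f x₀)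
    (hg : SmoothNear g x₀) : SmoothNear (fun x => f x - g x) x₀ := by
  filter_upwards [hf, hg] with x h1 h2 using h1.sub h2

theorem SmoothNear.pow {f : Plane → ℝ} {x₀ : Plane} (hf : SmoothNear f x₀) (n : ℕ) :
    SmoothNear (fun x => f x ^ n) x₀ := by
  filter_upwards [hf] with x h1 using h1.pow n

theorem _root_.ContDiff.smoothNear {f : Plane → ℝ} (hf : ContDiff ℝ ∞ f) (x₀ : Plane) :
    SmoothNear f x₀ := Eventually.of_forall fun _ => hf.contDiffAt

theorem smoothNear_const (c : ℝ) (x₀ : Plane) : SmoothNear (fun _ => c) x₀ :=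
  contDiff_const.smoothNear x₀

theorem dv_eventuallyEq {f g : Plane → ℝ} {x₀ : Plane} (h : f =ᶠ[𝓝 x₀] g) (v : Plane) :
    dv v f =ᶠ[𝓝 x₀] dv v g := by
  filter_upwards [h.fderiv (𝕜 := ℝ)] with x hx
  rw [MixedHom.dv, MixedHom.dv, hx]

theorem hdet_eventuallyEq {f g : Plane → ℝ} {x₀ : Plane} (h : f =ᶠ[𝓝 x₀] g) (v v' : Plane) :
    hdet v v' f =ᶠ[𝓝 x₀] hdet v v' g := by
  filter_upwards [dv_eventuallyEq (dv_eventuallyEq h v) v,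
    dv_eventuallyEq (dv_eventuallyEq h v') v', dv_eventuallyEq (dv_eventuallyEq h v) v']
    with x h1 h2 h3
  simp only [hdet, h1, h2, h3]

theorem SmoothNear.hdet {f : Plane → ℝ} {x₀ : Plane} (hf : SmoothNear f x₀) (v v' : Plane) :
    SmoothNear (hdet v v' f) x₀ :=
  (((hf.dv v).dv v).mul ((hf.dv v').dv v')).sub ((((hf.dv v).dv v')).pow 2)

/-- The hypotheses concern germs at `x₀`, whereas the integrations by parts take place on the whole
plane. Every function, including the reciprocals of the units, is therefore replaced by a globally
smooth one with the same germ. -/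
theorem exists_localData {f w u T : Plane → ℝ} {x₀ v v' : Plane} {k M : ℕ}
    (hf : SmoothNear f x₀) (hw : SmoothNear w x₀) (hu : SmoothNear u x₀) (hT : SmoothNear T x₀)
    (hu0 : u x₀ ≠ 0) (hT0 : T x₀ ≠ 0) (hw0 : w x₀ = 0)
    (hdvv : ∀ᶠ x in 𝓝 x₀, dv v (dv v f) x = w x ^ k * u x)
    (hdet' : ∀ᶠ x in 𝓝 x₀, hdet v v' f x = w x ^ M * T x) :
    ∃ F W u' p q, F =ᶠ[𝓝 x₀] f ∧ W =ᶠ[𝓝 x₀] w ∧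
      ∃ U ∈ 𝓝 x₀, LocalData F W u' p q v v' k M U := by
  obtain ⟨F, hF, hFf⟩ := hf.exists_contDiff
  obtain ⟨W, hW, hWw⟩ := hw.exists_contDiff
  obtain ⟨u', hu', huu⟩ := hu.exists_contDiff
  obtain ⟨p, hp, hpp⟩ := (hu.inv hu0).exists_contDiff
  obtain ⟨q, hq, hqq⟩ := (hT.inv hT0).exists_contDiff
  have habs : ∀ᶠ x in 𝓝 x₀, |w x| ≤ 1 := by
    have : ContinuousAt (fun x => |w x|) x₀ := hw.continuousAt.abs
    exact (this.eventually_lt continuousAt_const (by simp [hw0])).mono fun x hx => hx.le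
  refine ⟨F, W, u', p, q, hFf, hWw, {x | dv v (dv v F) x = W x ^ k * u' x ∧ u' x * p x = 1 ∧
    MixedHom.hdet v v' F x * q x = W x ^ M ∧ |W x| ≤ 1}, ?_, hF, hW, hu', hp, hq,
    fun x hx => hx.1, fun x hx => hx.2.1, fun x hx => hx.2.2.1, fun x hx => hx.2.2.2⟩
  filter_upwards [dv_eventuallyEq (dv_eventuallyEq hFf v) v, hdet_eventuallyEq hFf v v', hWw, huu,
    hpp, hqq, habs, hdvv, hdet', hu.continuousAt.eventually_ne hu0,
    hT.continuousAt.eventually_ne hT0] with x h1 h2 h3 h4 h5 h6 h7 h8 h9 h10 h11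
  simp only [h1, h2, h3, h4, h5, h6, h8, h9]
  exact ⟨trivial, mul_inv_cancel₀ h10, by field_simp, h7⟩

theorem integral_congr_on_tsupport {a : Plane → ℂ} {K : Set Plane} {m m' φ φ' : Plane → ℝ}
    (ha : tsupport a ⊆ K) (hb : ∀ x ∈ K, m x = m' x) (hφ : ∀ x ∈ K, φ x = φ' x) (t : ℝ) :
    ∫ x, (m x • a x) * osc t φ x = ∫ x, (m' x • a x) * osc t φ' x := by
  refine integral_congr_ae (Eventually.of_forall fun x => ?_)
  by_cases hx : x ∈ tsupport a
  · simp only [osc, hb x (ha hx), hφ x (ha hx)]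
  · simp [image_eq_zero_of_notMem_tsupport hx]

theorem LocalData.mono {f w u p q : Plane → ℝ} {v v' : Plane} {k M : ℕ} {U U' : Set Plane}
    (hD : LocalData f w u p q v v' k M U) (h : U' ⊆ U) : LocalData f w u p q v v' k M U' where
  smooth_f := hD.smooth_f
  smooth_w := hD.smooth_w
  smooth_u := hD.smooth_u
  smooth_p := hD.smooth_p
  smooth_q := hD.smooth_q
  dvv_eq := fun x hx => hD.dvv_eq x (h hx)
  unit := fun x hx => hD.unit x (h hx)
  hdet_mul := fun x hx => hD.hdet_mul x (h hx)
  abs_le := fun x hx => hD.abs_le x (h hx)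

/-- Decay of order more than `1 / 2`, uniformly in the linear perturbation, of the oscillatory
integrals with phase `f` and amplitudes supported near `x₀`, with weight `b` times a function
that is continuously differentiable on `V`. -/
def DecayNear (f b : Plane → ℝ) (x₀ : Plane) (V : Set Plane) : Prop :=
  ∃ s : ℝ, 0 < s ∧ ∃ K ∈ 𝓝 x₀, IsCompact K ∧ K ⊆ V ∧
    ∀ (R : ℝ) (g : Plane → ℝ), (∀ x ∈ V, ContDiffAt ℝ 1 g x) → ∃ C, ∀ σ : Plane, ‖σ‖ ≤ R →
      ∀ a : Plane → ℂ, ContDiff ℝ ∞ a → tsupport a ⊆ K → ∀ t : ℝ,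
        ‖∫ x, ((g x * b x) • a x) * osc t (phase f σ) x‖ ≤
          C * sobolevNorm a * (1 + |t|) ^ (-(1 / 2 + s))

/-- The form used at critical points of `f`: `f_vv` may vanish to order `k` on `{w = 0}`, and the
weight `|w|^β` with `β > k/2` compensates for this. -/
theorem decayNear_abs_rpow {f w u T : Plane → ℝ} {x₀ v v' : Plane} {k M : ℕ} {β : ℝ}
    (hf : SmoothNear f x₀) (hw : SmoothNear w x₀) (hu : SmoothNear u x₀) (hT : SmoothNear T x₀)
    (hu0 : u x₀ ≠ 0) (hT0 : T x₀ ≠ 0) (hw0 : w x₀ = 0)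
    (hdvv : ∀ᶠ x in 𝓝 x₀, dv v (dv v f) x = w x ^ k * u x)
    (hdet' : ∀ᶠ x in 𝓝 x₀, hdet v v' f x = w x ^ M * T x)
    (hvw : dv v w x₀ ≠ 0) (hβ : (k : ℝ) / 2 < β)
    {V : Set Plane} (hV : V ∈ 𝓝 x₀) :
    DecayNear f (fun x => |w x| ^ β) x₀ V := by
  obtain ⟨F, W, u', p, q, hFf, hWw, U, hU, hD⟩ :=
    exists_localData hf hw hu hT hu0 hT0 hw0 hdvv hdet'
  obtain ⟨r, hr, hrr⟩ := ((hw.dv v).inv hvw).exists_contDiff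
  have hr1 : ∀ᶠ x in 𝓝 x₀, dv v W x * r x = 1 := by
    filter_upwards [hrr, dv_eventuallyEq hWw v, (hw.dv v).continuousAt.eventually_ne hvw]
      with x h1 h2 h3
    rw [h1, h2, mul_inv_cancel₀ h3]
  obtain ⟨κ, hκ, K, hK, hKc, hKV, hκK⟩ := exists_cutoff
    (inter_mem hU (inter_mem hV (inter_mem hr1 (inter_mem hFf hWw))))
  have hκV : IsCutoff κ V := ⟨hκ.smooth, hκ.compact, fun x hx => (hκ.supp hx).2.1, hκ.nonneg,
    hκ.le_one⟩
  obtain ⟨s, hs, H⟩ := (hD.mono inter_subset_left).exists_damped_decay hκ hr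
    (fun x hx => hx.2.2.1) hβ
  refine ⟨s, hs, K, hK, hKc, fun x hx => (hKV hx).2.1, fun R g hg => ?_⟩
  have hg' : ContDiff ℝ 1 fun x => κ x * g x := hκV.contDiff_mul (n := 1) hg
  obtain ⟨C, hC0, hC⟩ := H R _ hg'
  have hβ0 : 0 ≤ β := le_trans (by positivity) hβ.le
  have hm : Continuous fun x => κ x * g x * |W x| ^ β :=
    hg'.continuous.mul (hD.smooth_w.continuous.abs.rpow_const fun x => Or.inr hβ0)
  obtain ⟨C', hC'⟩ := exists_sobolev_decay (P := fun σ : Plane => ‖σ‖ ≤ R) (φ := phase F) hKc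
    hm.continuousOn hC0 hs
    (fun σ hσ a A ha haK h1 h2 t ht => hC σ hσ a A ha (fun x hx => hκK x (haK hx)) h1 h2 t ht)
  refine ⟨C', fun σ hσ a ha haK t => ?_⟩
  rw [integral_congr_on_tsupport (m' := fun x => κ x * g x * |W x| ^ β) (φ' := phase F σ) haK]
  · exact hC' σ hσ a ha haK t
  · intro x hx
    rw [hκK x hx, one_mul, show W x = w x from (hKV hx).2.2.2.2]
  · intro x hx
    rw [phase, phase, show F x = f x from (hKV hx).2.2.2.1]

/-- The form used at noncritical points. The last condition on `w` says that the Hamiltonian field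
of `∂_v f` is transversal to `{w = 0}` at `x₀`. -/
theorem decayNear_one {f w T : Plane → ℝ} {x₀ v v' : Plane} {M : ℕ}
    (hf : SmoothNear f x₀) (hw : SmoothNear w x₀) (hT : SmoothNear T x₀)
    (hu0 : dv v (dv v f) x₀ ≠ 0) (hT0 : T x₀ ≠ 0) (hw0 : w x₀ = 0)
    (hdet' : ∀ᶠ x in 𝓝 x₀, hdet v v' f x = w x ^ M * T x)
    (hvw : dv v (dv v f) x₀ * dv v' w x₀ - dv v' (dv v f) x₀ * dv v w x₀ ≠ 0)
    {V : Set Plane} (hV : V ∈ 𝓝 x₀) :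
    DecayNear f (fun _ => 1) x₀ V := by
  obtain ⟨F, W, u', p, q, hFf, hWw, U, hU, hD⟩ := exists_localData (k := 0)
    hf hw ((hf.dv v).dv v) hT hu0 hT0 hw0 (by simp) hdet'
  have hFW : along (ham v v' F) W x₀ ≠ 0 := by
    rw [along_ham, (dv_eventuallyEq (dv_eventuallyEq hFf v) v).self_of_nhds,
      (dv_eventuallyEq (dv_eventuallyEq hFf v) v').self_of_nhds,
      (dv_eventuallyEq hWw v).self_of_nhds, (dv_eventuallyEq hWw v').self_of_nhds]
    exact hvw
  obtain ⟨r, hr, hrr⟩ := (((contDiff_along (contDiff_ham hD.smooth_f v v')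
    hD.smooth_w).smoothNear x₀).inv hFW).exists_contDiff
  have hr1 : ∀ᶠ x in 𝓝 x₀, along (ham v v' F) W x * r x = 1 := by
    filter_upwards [hrr, (contDiff_along (contDiff_ham hD.smooth_f v v')
      hD.smooth_w).continuous.continuousAt.eventually_ne hFW] with x h1 h2
    rw [h1, mul_inv_cancel₀ h2]
  obtain ⟨κ, hκ, K, hK, hKc, hKV, hκK⟩ := exists_cutoff
    (inter_mem hU (inter_mem hV (inter_mem hr1 hFf)))
  have hκV : IsCutoff κ V := ⟨hκ.smooth, hκ.compact, fun x hx => (hκ.supp hx).2.1, hκ.nonneg,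
    hκ.le_one⟩
  obtain ⟨s, hs, H⟩ := (hD.mono inter_subset_left).exists_decay hκ hr (fun x hx => hx.2.2.1)
  refine ⟨s, hs, K, hK, hKc, fun x hx => (hKV hx).2.1, fun R g hg => ?_⟩
  have hg' : ContDiff ℝ 1 fun x => κ x * g x := hκV.contDiff_mul (n := 1) hg
  obtain ⟨C, hC0, hC⟩ := H R _ hg'
  obtain ⟨C', hC'⟩ := exists_sobolev_decay (P := fun σ : Plane => ‖σ‖ ≤ R) (φ := phase F) hKc
    hg'.continuous.continuousOn hC0 hs
    (fun σ hσ a A ha haK h1 h2 t ht => hC σ hσ a A ha (fun x hx => hκK x (haK hx)) h1 h2 t ht)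
  refine ⟨C', fun σ hσ a ha haK t => ?_⟩
  rw [integral_congr_on_tsupport (m' := fun x => κ x * g x) (φ' := phase F σ) haK]
  · exact hC' σ hσ a ha haK t
  · intro x hx
    rw [hκK x hx, one_mul, mul_one]
  · intro x hx
    rw [phase, phase, show F x = f x from (hKV hx).2.2.2]

/-! ### Factorization and order of vanishing -/

/-- Differentiation in `s` brings down one more factor `y`; allowing an arbitrary power of `y`
closes the induction for smoothness. -/
theorem hasDerivAt_integral_pow_mul {h : ℝ → ℝ} (hh : ContDiff ℝ ∞ h) (m : ℕ) (s : ℝ) :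
    HasDerivAt (fun s => ∫ y in (0 : ℝ)..1, y ^ m * h (s * y))
      (∫ y in (0 : ℝ)..1, y ^ (m + 1) * deriv h (s * y)) s := by
  have hd : Continuous (deriv h) := hh.continuous_deriv (by simp)
  obtain ⟨B, hB⟩ := (isCompact_Icc (a := -(|s| + 1)) (b := |s| + 1)).exists_bound_of_continuousOn
    hd.continuousOn
  refine (intervalIntegral.hasDerivAt_integral_of_dominated_loc_of_deriv_le
    (F := fun s y => y ^ m * h (s * y)) (F' := fun s y => y ^ (m + 1) * deriv h (s * y))
    (bound := fun _ => B)
    (Metric.ball_mem_nhds s one_pos) (Eventually.of_forall fun x => ?_) ?_ ?_ ?_ ?_ ?_).2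
  · exact (by have := hh.continuous; fun_prop : Continuous fun y => y ^ m * h (x * y)).aestronglyMeasurable
  · exact (by have := hh.continuous; fun_prop : Continuous fun y => y ^ m * h (s * y)).intervalIntegrable _ _
  · exact (by fun_prop : Continuous fun y => y ^ (m + 1) * deriv h (s * y)).aestronglyMeasurable
  · refine Eventually.of_forall fun y hy x hx => ?_
    rw [uIoc_of_le zero_le_one] at hy
    rw [Metric.mem_ball, Real.dist_eq] at hx
    have hx1 : |x| ≤ |s| + 1 := by
      have := abs_sub_abs_le_abs_sub x s
      linarith
    have hxy : |x * y| ≤ |s| + 1 := by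
      rw [abs_mul, abs_of_pos hy.1]
      calc |x| * y ≤ |x| * 1 := by gcongr; exact hy.2
        _ ≤ _ := by linarith
    have h1 : |y ^ (m + 1)| ≤ 1 := by
      rw [abs_of_pos (pow_pos hy.1 _)]
      exact pow_le_one₀ hy.1.le hy.2
    have h2 := hB (x * y) (abs_le.1 hxy)
    rw [norm_mul, Real.norm_eq_abs (y ^ (m + 1))]
    calc |y ^ (m + 1)| * ‖deriv h (x * y)‖ ≤ 1 * B := by gcongr
      _ = B := one_mul B
  · exact intervalIntegrable_const
  · refine Eventually.of_forall fun y hy x hx => ?_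
    have h1 : HasDerivAt (fun x : ℝ => x * y) y x := by simpa using (hasDerivAt_id x).mul_const y
    have h2 := (((hh.differentiable (by simp)) (x * y)).hasDerivAt.comp x h1).const_mul (y ^ m)
    refine h2.congr_deriv ?_
    ring

theorem contDiff_integral_pow_mul {h : ℝ → ℝ} (hh : ContDiff ℝ ∞ h) (m : ℕ) :
    ContDiff ℝ ∞ fun s => ∫ y in (0 : ℝ)..1, y ^ m * h (s * y) := by
  rw [contDiff_infty]
  intro n
  induction n generalizing m h with
  | zero =>
    exact contDiff_zero.2 (continuous_iff_continuousAt.2 fun s =>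
      (hasDerivAt_integral_pow_mul hh m s).continuousAt)
  | succ n ih =>
    rw [Nat.cast_add, Nat.cast_one, contDiff_succ_iff_deriv]
    refine ⟨fun s => (hasDerivAt_integral_pow_mul hh m s).differentiableAt, by simp, ?_⟩
    have : deriv (fun s => ∫ y in (0 : ℝ)..1, y ^ m * h (s * y)) =
        fun s => ∫ y in (0 : ℝ)..1, y ^ (m + 1) * deriv h (s * y) :=
      funext fun s => (hasDerivAt_integral_pow_mul hh m s).deriv
    rw [this]
    exact ih (contDiff_infty_iff_deriv.1 hh).2 (m + 1)

/-- Hadamard's lemma on the line. -/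
theorem exists_eq_mul_of_zero {h : ℝ → ℝ} (hh : ContDiff ℝ ∞ h) (h0 : h 0 = 0) :
    ∃ e : ℝ → ℝ, ContDiff ℝ ∞ e ∧ ∀ s, h s = s * e s := by
  refine ⟨fun s => ∫ y in (0 : ℝ)..1, y ^ 0 * deriv h (s * y),
    contDiff_integral_pow_mul (contDiff_infty_iff_deriv.1 hh).2 0, fun s => ?_⟩
  have hd : Continuous (deriv h) := hh.continuous_deriv (by simp)
  have := intervalIntegral.integral_eq_sub_of_hasDerivAt (a := 0) (b := 1)
    (f := fun y => h (s * y)) (f' := fun y => deriv h (s * y) * s)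
    (fun y _ => by
      have h1 : HasDerivAt (fun y : ℝ => s * y) s y := by
        simpa using (hasDerivAt_id y).const_mul s
      exact ((hh.differentiable (by simp)) (s * y)).hasDerivAt.comp y h1)
    ((by fun_prop : Continuous fun y => deriv h (s * y) * s).intervalIntegrable _ _)
  rw [intervalIntegral.integral_mul_const] at this
  simp only [mul_one, mul_zero, h0, sub_zero] at this
  simp only [pow_zero, one_mul]
  rw [← this, mul_comm]

/-- Factors of `s` are extracted by Hadamard's lemma until the quotient is nonzero at the origin; if
this never happens, every power of `s` divides `h`. -/
theorem exists_pow_factorization {h : ℝ → ℝ} (hh : ContDiff ℝ ∞ h) :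
    (∃ (N : ℕ) (e : ℝ → ℝ), ContDiff ℝ ∞ e ∧ e 0 ≠ 0 ∧ ∀ s, h s = s ^ N * e s) ∨
      ∀ N : ℕ, ∃ e : ℝ → ℝ, ContDiff ℝ ∞ e ∧ ∀ s, h s = s ^ N * e s := by
  by_contra hcon
  push Not at hcon
  obtain ⟨h1, N, hN⟩ := hcon
  have : ∀ n : ℕ, ∃ e : ℝ → ℝ, ContDiff ℝ ∞ e ∧ ∀ s, h s = s ^ n * e s := by
    intro n
    induction n with
    | zero => exact ⟨h, hh, by simp⟩
    | succ n ih =>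
      obtain ⟨e, he, hs⟩ := ih
      have he0 : e 0 = 0 := by
        by_contra he0
        obtain ⟨s, hs'⟩ := h1 n e he he0
        exact hs' (hs s)
      obtain ⟨e', he', hs'⟩ := exists_eq_mul_of_zero he he0
      exact ⟨e', he', fun s => by rw [hs, hs', pow_succ, mul_assoc]⟩
  obtain ⟨e, he, hs⟩ := this N
  obtain ⟨s, hs'⟩ := hN e he
  exact hs' (hs s)

/-! ### Orders of vanishing along `{w = 0}`. -/

theorem iteratedFDeriv_congr_nhds {f g : Plane → ℝ} {x₀ : Plane} (h : f =ᶠ[𝓝 x₀] g) (n : ℕ) :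
    iteratedFDeriv ℝ n f x₀ = iteratedFDeriv ℝ n g x₀ :=
  (h.iteratedFDeriv ℝ n).self_of_nhds

theorem SmoothNear.iteratedFDeriv_mul_eq_zero {w g : Plane → ℝ} {x₀ : Plane}
    (hw : SmoothNear w x₀) (hg : SmoothNear g x₀) (hw0 : w x₀ = 0) {N : ℕ}
    (h : ∀ j < N, iteratedFDeriv ℝ j g x₀ = 0) {j : ℕ} (hj : j < N + 1) :
    iteratedFDeriv ℝ j (fun x => w x * g x) x₀ = 0 := by
  obtain ⟨W, hW, hWw⟩ := hw.exists_contDiff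
  obtain ⟨G, hG, hGg⟩ := hg.exists_contDiff
  have e : (fun x => w x * g x) =ᶠ[𝓝 x₀] fun x => W x * G x := by
    filter_upwards [hWw, hGg] with x h1 h2
    rw [h1, h2]
  rw [iteratedFDeriv_congr_nhds e, ← norm_le_zero_iff]
  refine (norm_iteratedFDeriv_mul_le (N := ∞) hW hG x₀ (by exact_mod_cast le_top)).trans ?_
  refine Finset.sum_nonpos fun i hij => ?_
  rw [Finset.mem_range] at hij
  rcases Nat.eq_zero_or_pos i with rfl | hi
  · rw [norm_iteratedFDeriv_zero, hWw.self_of_nhds, hw0]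
    simp
  · rw [iteratedFDeriv_congr_nhds hGg, h (j - i) (by omega)]
    simp

theorem SmoothNear.iteratedFDeriv_pow_mul_eq_zero {w g : Plane → ℝ} {x₀ : Plane}
    (hw : SmoothNear w x₀) (hg : SmoothNear g x₀) (hw0 : w x₀ = 0) {N j : ℕ} (hj : j < N) :
    iteratedFDeriv ℝ j (fun x => w x ^ N * g x) x₀ = 0 := by
  induction N generalizing j with
  | zero => omega
  | succ N ih =>
    have e : (fun x => w x ^ (N + 1) * g x) = fun x => w x * (w x ^ N * g x) := by
      funext x; ring
    rw [e]
    exact hw.iteratedFDeriv_mul_eq_zero ((hw.pow N).mul hg) hw0 (fun j hj => ih hj) hj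

theorem SmoothNear.differentiableAt {f : Plane → ℝ} {x₀ : Plane} (hf : SmoothNear f x₀) :
    DifferentiableAt ℝ f x₀ :=
  (Eventually.self_of_nhds hf).differentiableAt (by simp)

theorem SmoothNear.eventually {f : Plane → ℝ} {x₀ : Plane} (hf : SmoothNear f x₀) :
    ∀ᶠ x in 𝓝 x₀, SmoothNear f x :=
  Eventually.eventually_nhds hf

theorem dv_pow_succ_mul {w g : Plane → ℝ} {x : Plane} (hw : DifferentiableAt ℝ w x)
    (hg : DifferentiableAt ℝ g x) (v : Plane) (N : ℕ) :
    dv v (fun x => w x ^ (N + 1) * g x) x =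
      w x ^ N * ((N + 1) * dv v w x * g x + w x * dv v g x) := by
  rw [MixedHom.dv, fderiv_fun_mul (hw.fun_pow _) hg, fderiv_fun_pow _ hw]
  simp [MixedHom.dv]
  ring

theorem dv_eventuallyEq_pow_mul {f w g : Plane → ℝ} {x₀ : Plane} (hw : SmoothNear w x₀)
    (hg : SmoothNear g x₀) {N : ℕ} (h : ∀ᶠ x in 𝓝 x₀, f x = w x ^ (N + 1) * g x) (v : Plane) :
    ∀ᶠ x in 𝓝 x₀, dv v f x = w x ^ N * ((N + 1) * dv v w x * g x + w x * dv v g x) := by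
  filter_upwards [dv_eventuallyEq h v, hw.eventually, hg.eventually] with x h1 h2 h3
  rw [h1, dv_pow_succ_mul h2.differentiableAt h3.differentiableAt]

theorem SmoothNear.dv_factor {w g : Plane → ℝ} {x₀ : Plane} (hw : SmoothNear w x₀)
    (hg : SmoothNear g x₀) (N : ℕ) (v : Plane) :
    SmoothNear (fun x => (N + 1) * MixedHom.dv v w x * g x + w x * MixedHom.dv v g x) x₀ :=
  (((smoothNear_const _ _).mul (hw.dv v)).mul hg).add (hw.mul (hg.dv v))

/-- Induction on `N`: one derivative transversal to `{w = 0}` lowers the power of `w` by one, and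
its cofactor is still nonzero at `x₀`. -/
theorem iteratedFDeriv_ne_zero_of_eq_pow_mul {f w g : Plane → ℝ} {x₀ v : Plane} {N : ℕ}
    (hf : SmoothNear f x₀) (hw : SmoothNear w x₀) (hg : SmoothNear g x₀) (hw0 : w x₀ = 0)
    (hv : dv v w x₀ ≠ 0) (hg0 : g x₀ ≠ 0) (h : ∀ᶠ x in 𝓝 x₀, f x = w x ^ N * g x) :
    iteratedFDeriv ℝ N f x₀ ≠ 0 := by
  induction N generalizing f g with
  | zero =>
    intro h0
    apply hg0
    have := norm_iteratedFDeriv_zero (𝕜 := ℝ) (f := f) (x := x₀)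
    rw [h0, norm_zero] at this
    have h1 := h.self_of_nhds
    rw [pow_zero, one_mul] at h1
    rw [← h1]
    exact norm_eq_zero.1 this.symm
  | succ N ih =>
    intro h0
    refine ih (f := dv v f) (hf.dv v) (hw.dv_factor hg N v) ?_
      (dv_eventuallyEq_pow_mul hw hg h v) ?_
    · rw [hw0, zero_mul, add_zero]
      exact mul_ne_zero (mul_ne_zero (by positivity) hv) hg0
    · rw [← norm_le_zero_iff]
      have hc : ContDiffAt ℝ ∞ (fderiv ℝ f) x₀ :=
        (Eventually.self_of_nhds hf).fderiv_right (m := ∞) (by norm_cast)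
      refine (norm_iteratedFDeriv_clm_apply_const (N := ∞) hc (by exact_mod_cast le_top)).trans ?_
      rw [norm_iteratedFDeriv_fderiv, h0, norm_zero, mul_zero]

theorem orderAt_eq_of_eq_pow_mul {f w g : Plane → ℝ} {x₀ v : Plane} {N : ℕ}
    (hf : SmoothNear f x₀) (hw : SmoothNear w x₀) (hg : SmoothNear g x₀) (hw0 : w x₀ = 0)
    (hv : dv v w x₀ ≠ 0) (hg0 : g x₀ ≠ 0) (h : ∀ᶠ x in 𝓝 x₀, f x = w x ^ N * g x) :
    orderAt f x₀ = N := by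
  refine le_antisymm (iInf₂_le N (iteratedFDeriv_ne_zero_of_eq_pow_mul hf hw hg hw0 hv hg0 h))
    (le_iInf₂ fun j hj => ?_)
  by_contra hcon
  have hjN : j < N := by exact_mod_cast not_le.1 hcon
  rw [iteratedFDeriv_congr_nhds (g := fun x => w x ^ N * g x) h] at hj
  exact hj (hw.iteratedFDeriv_pow_mul_eq_zero hg hw0 hjN)

theorem orderAt_eq_top_of_forall_eq_pow_mul {f w : Plane → ℝ} {x₀ : Plane} (hw : SmoothNear w x₀)
    (hw0 : w x₀ = 0)
    (h : ∀ N : ℕ, ∃ g, SmoothNear g x₀ ∧ ∀ᶠ x in 𝓝 x₀, f x = w x ^ N * g x) :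
    orderAt f x₀ = ⊤ := by
  rw [orderAt, iInf₂_eq_top]
  intro j hj
  obtain ⟨g, hg, hfg⟩ := h (j + 1)
  rw [iteratedFDeriv_congr_nhds (g := fun x => w x ^ (j + 1) * g x) hfg] at hj
  exact absurd (hw.iteratedFDeriv_pow_mul_eq_zero hg hw0 (Nat.lt_succ_self j)) hj

/-- A crude count that suffices to transfer flatness from `f` to its Hessian determinant: `f_vv` and
`f_vv'` are both divisible by `w^N`. -/
theorem exists_hdet_eq_pow_mul {f w g : Plane → ℝ} {x₀ : Plane} {N : ℕ} (hf : SmoothNear f x₀)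
    (hw : SmoothNear w x₀)
    (hg : SmoothNear g x₀) (h : ∀ᶠ x in 𝓝 x₀, f x = w x ^ (N + 2) * g x) (v v' : Plane) :
    ∃ T, SmoothNear T x₀ ∧ ∀ᶠ x in 𝓝 x₀, hdet v v' f x = w x ^ N * T x := by
  have h1 := dv_eventuallyEq_pow_mul hw hg h v
  have hg1 := hw.dv_factor hg (N + 1) v
  have h2 := dv_eventuallyEq_pow_mul hw hg1 h1 v
  have h3 := dv_eventuallyEq_pow_mul hw hg1 h1 v'
  have hg2 := hw.dv_factor hg1 N v
  have hg3 := hw.dv_factor hg1 N v'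
  refine ⟨_, (hg2.mul ((hf.dv v').dv v')).sub ((hg3.pow 2).mul (hw.pow N)), ?_⟩
  filter_upwards [h2, h3] with x e2 e3
  rw [hdet, e2, e3]
  ring

/-! ### Homogeneous functions -/

theorem smoothNear_of_contDiffOn {f : Plane → ℝ} (hf : ContDiffOn ℝ ∞ f {0}ᶜ) {x : Plane}
    (hx : x ≠ 0) : SmoothNear f x := by
  filter_upwards [isOpen_compl_singleton.mem_nhds hx] with y hy
  exact hf.contDiffAt (isOpen_compl_singleton.mem_nhds hy)

theorem contDiffOn_of_smoothNear {f : Plane → ℝ} (hf : ∀ x ≠ 0, SmoothNear f x) :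
    ContDiffOn ℝ ∞ f {0}ᶜ := fun x hx =>
  (Eventually.self_of_nhds (hf x hx)).contDiffWithinAt

theorem contDiffOn_pderiv {f : Plane → ℝ} (hf : ContDiffOn ℝ ∞ f {0}ᶜ) (j : Fin 2) :
    ContDiffOn ℝ ∞ (pderiv j f) {0}ᶜ :=
  contDiffOn_of_smoothNear fun _ hx => (smoothNear_of_contDiffOn hf hx).dv _

theorem dilation_add_single (κ : Fin 2 → ℝ) (r s : ℝ) (x : Plane) (j : Fin 2) :
    dilation κ r (x + s • EuclideanSpace.single j 1) =
      dilation κ r x + (s * r ^ κ j) • EuclideanSpace.single j 1 := by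
  ext i
  simp only [dilation_apply, PiLp.add_apply, PiLp.smul_apply, smul_eq_mul]
  by_cases h : i = j
  · subst h; simp; ring
  · simp [h]

theorem hasDerivAt_line {g : Plane → ℝ} {x : Plane} (hg : DifferentiableAt ℝ g x) (v : Plane) :
    HasDerivAt (fun s : ℝ => g (x + s • v)) (dv v g x) 0 := by
  have h1 : HasDerivAt (fun s : ℝ => x + s • v) v 0 := by
    simpa using ((hasDerivAt_id (0 : ℝ)).smul_const v).const_add x
  have h2 : HasFDerivAt g (fderiv ℝ g x) (x + (0 : ℝ) • v) := by simpa using hg.hasFDerivAt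
  exact h2.comp_hasDerivAt 0 h1

theorem IsKappaHomogeneous.pderiv {κ : Fin 2 → ℝ} {d : ℝ} {f : Plane → ℝ}
    (hf : ContDiffOn ℝ ∞ f {0}ᶜ) (h : IsKappaHomogeneous κ d f) (j : Fin 2) :
    IsKappaHomogeneous κ (d - κ j) (pderiv j f) := by
  intro x hx r hr
  have hy := dilation_ne_zero κ hx hr
  have h1 := (hasDerivAt_line (smoothNear_of_contDiffOn hf hx).differentiableAt
    (EuclideanSpace.single j 1)).const_mul (r ^ d)
  have h2 : HasDerivAt (fun s : ℝ => f (dilation κ r (x + s • EuclideanSpace.single j 1)))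
      (MixedHom.pderiv j f (dilation κ r x) * r ^ κ j) 0 := by
    simp only [dilation_add_single]
    have h3 : HasDerivAt (fun s : ℝ => s * r ^ κ j) (r ^ κ j) 0 := by
      simpa using (hasDerivAt_id (0 : ℝ)).mul_const (r ^ κ j)
    have h4 := hasDerivAt_line (smoothNear_of_contDiffOn hf hy).differentiableAt
      (EuclideanSpace.single j 1)
    rw [show (0 : ℝ) = 0 * r ^ κ j by simp] at h4
    exact h4.comp (0 : ℝ) h3
  have e : (fun s : ℝ => f (dilation κ r (x + s • EuclideanSpace.single j 1))) =ᶠ[𝓝 0]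
      fun s => r ^ d * f (x + s • EuclideanSpace.single j 1) := by
    have hc : ContinuousAt (fun s : ℝ => x + s • (EuclideanSpace.single j 1 : Plane)) 0 := by
      fun_prop
    filter_upwards [hc.eventually_ne (by simpa using hx : x + (0 : ℝ) • _ ≠ 0)] with s hs
    exact h _ hs r hr
  have h5 := (h2.congr_of_eventuallyEq e.symm).unique h1
  have hrj := (Real.rpow_pos_of_pos hr (κ j)).ne'
  rw [Real.rpow_sub hr, div_mul_eq_mul_div, eq_div_iff hrj, h5]
  rfl

/-- The infinitesimal generator of the dilations. -/
noncomputable def eulerField (κ : Fin 2 → ℝ) (x : Plane) : Plane :=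
  WithLp.toLp 2 fun i => κ i * x i

theorem hasDerivAt_dilation (κ : Fin 2 → ℝ) (x : Plane) :
    HasDerivAt (fun s : ℝ => dilation κ s x) (eulerField κ x) 1 := by
  have h : HasDerivAt (fun s : ℝ => fun i => s ^ κ i * x i) (fun i => κ i * x i) 1 := by
    rw [hasDerivAt_pi]
    intro i
    have := (Real.hasDerivAt_rpow_const (x := 1) (p := κ i) (Or.inl one_ne_zero)).mul_const (x i)
    simpa using this
  exact ((PiLp.continuousLinearEquiv 2 ℝ (fun _ : Fin 2 => ℝ)).symm.hasFDerivAt).comp_hasDerivAt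
    1 h

theorem hasDerivAt_comp_dilation {κ : Fin 2 → ℝ} {g : Plane → ℝ} {x : Plane}
    (hg : DifferentiableAt ℝ g x) :
    HasDerivAt (fun s : ℝ => g (dilation κ s x)) (fderiv ℝ g x (eulerField κ x)) 1 := by
  have h2 : HasFDerivAt g (fderiv ℝ g x) (dilation κ 1 x) := by
    rw [dilation_one]; exact hg.hasFDerivAt
  exact h2.comp_hasDerivAt 1 (hasDerivAt_dilation κ x)

theorem fderiv_eulerField (κ : Fin 2 → ℝ) (g : Plane → ℝ) (x : Plane) {j l : Fin 2}
    (hjl : j ≠ l) : fderiv ℝ g x (eulerField κ x) =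
      κ j * x j * pderiv j g x + κ l * x l * pderiv l g x := by
  have e : eulerField κ x = (κ j * x j) • EuclideanSpace.single j 1 +
      (κ l * x l) • EuclideanSpace.single l 1 := by
    ext i
    fin_cases i <;> fin_cases j <;> fin_cases l <;> simp_all [eulerField]
  rw [e, map_add, map_smul, map_smul]
  rfl

theorem IsKappaHomogeneous.fderiv_eulerField {κ : Fin 2 → ℝ} {d : ℝ} {f : Plane → ℝ}
    (h : IsKappaHomogeneous κ d f) {x : Plane} (hx : x ≠ 0) (hf : DifferentiableAt ℝ f x) :
    fderiv ℝ f x (eulerField κ x) = d * f x := by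
  have h1 := hasDerivAt_comp_dilation (κ := κ) hf
  have h2 : HasDerivAt (fun s : ℝ => s ^ d * f x) (d * f x) 1 := by
    simpa using (Real.hasDerivAt_rpow_const (x := 1) (p := d) (Or.inl one_ne_zero)).mul_const (f x)
  refine (h1.congr_of_eventuallyEq ?_).unique h2
  filter_upwards [lt_mem_nhds (zero_lt_one (α := ℝ))] with s hs
  exact (h x hx s hs).symm

theorem hess_eq {f : Plane → ℝ} {x : Plane} (hf : SmoothNear f x) {j l : Fin 2} (hjl : j ≠ l) :
    hess f x = hdet (EuclideanSpace.single j 1) (EuclideanSpace.single l 1) f x := by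
  obtain ⟨F, hF, hFf⟩ := hf.exists_contDiff
  have hc : ∀ v v', dv v' (dv v f) x = dv v (dv v' f) x := fun v v' => by
    rw [← (dv_eventuallyEq (dv_eventuallyEq hFf v) v').self_of_nhds,
      ← (dv_eventuallyEq (dv_eventuallyEq hFf v') v).self_of_nhds, dv_comm hF]
  have e : hess f x = dv (EuclideanSpace.single 0 1) (dv (EuclideanSpace.single 0 1) f) x *
      dv (EuclideanSpace.single 1 1) (dv (EuclideanSpace.single 1 1) f) x -
      dv (EuclideanSpace.single 0 1) (dv (EuclideanSpace.single 1 1) f) x *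
      dv (EuclideanSpace.single 1 1) (dv (EuclideanSpace.single 0 1) f) x := by
    rw [hess, Matrix.det_fin_two]
    rfl
  rw [e, hdet, hc (EuclideanSpace.single 1 1)]
  fin_cases j <;> fin_cases l <;> simp_all
  · ring
  · rw [hc (EuclideanSpace.single 0 1)]; ring

theorem contDiffOn_hess {f : Plane → ℝ} (hf : ContDiffOn ℝ ∞ f {0}ᶜ) :
    ContDiffOn ℝ ∞ (hess f) {0}ᶜ := by
  refine contDiffOn_of_smoothNear fun x hx => ?_
  have h := smoothNear_of_contDiffOn hf hx
  refine (h.hdet (EuclideanSpace.single 0 1) (EuclideanSpace.single 1 1)).congr ?_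
  filter_upwards [h.eventually] with y hy
  exact hess_eq hy (by decide)

theorem IsKappaHomogeneous.hess {κ : Fin 2 → ℝ} {d : ℝ} {f : Plane → ℝ}
    (hf : ContDiffOn ℝ ∞ f {0}ᶜ) (h : IsKappaHomogeneous κ d f) :
    IsKappaHomogeneous κ (2 * d - 2 * (κ 0 + κ 1)) (hess f) := by
  intro x hx r hr
  have hh : ∀ i j, MixedHom.pderiv i (MixedHom.pderiv j f) (dilation κ r x) =
      r ^ (d - κ j - κ i) * MixedHom.pderiv i (MixedHom.pderiv j f) x := fun i j =>
    (h.pderiv hf j).pderiv (contDiffOn_pderiv hf j) i x hx r hr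
  simp only [MixedHom.hess, Matrix.det_fin_two, Matrix.of_apply, hh]
  have e1 : r ^ (2 * d - 2 * (κ 0 + κ 1)) = r ^ (d - κ 0 - κ 0) * r ^ (d - κ 1 - κ 1) := by
    rw [← Real.rpow_add hr]; congr 1; ring
  have e2 : r ^ (d - κ 1 - κ 0) * r ^ (d - κ 0 - κ 1) =
      r ^ (d - κ 0 - κ 0) * r ^ (d - κ 1 - κ 1) := by
    rw [← Real.rpow_add hr, ← Real.rpow_add hr]; congr 1; ring
  rw [e1]
  linear_combination -(MixedHom.pderiv 0 (MixedHom.pderiv 1 f) x *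
    MixedHom.pderiv 1 (MixedHom.pderiv 0 f) x) * e2

/-! ### Coordinates adapted to the dilations -/

/-- Near `x₀`, every point is `δ_{ρ x} (x₀ + w x e_k)`. -/
structure IsDilationChart (κ : Fin 2 → ℝ) (x₀ : Plane) (k : Fin 2) (ρ w : Plane → ℝ) : Prop where
  smooth_ρ : SmoothNear ρ x₀
  smooth_w : SmoothNear w x₀
  w_base : w x₀ = 0
  ρ_base : ρ x₀ = 1
  dv_w : dv (EuclideanSpace.single k 1) w x₀ = 1
  euler_w : fderiv ℝ w x₀ (eulerField κ x₀) = 0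
  chart : ∀ᶠ x in 𝓝 x₀, 0 < ρ x ∧ dilation κ (ρ x) (x₀ + w x • EuclideanSpace.single k 1) = x
  line_ne_zero : ∀ s : ℝ, x₀ + s • EuclideanSpace.single k 1 ≠ 0

/-- Take a coordinate `i` with `x₀ i ≠ 0`. The dilation parameter `ρ` is read off from `x i`, and
`w` is the displacement in the other coordinate after dilating back. The curve `{w = 0}` contains
the orbit of `x₀`, hence is tangent to the Euler field there. -/
theorem exists_isDilationChart {κ : Fin 2 → ℝ} (hκ : ∀ i, 0 < κ i) {x₀ : Plane} (hx₀ : x₀ ≠ 0) :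
    ∃ k ρ w, IsDilationChart κ x₀ k ρ w := by
  obtain ⟨i, hi⟩ : ∃ i, x₀ i ≠ 0 := by
    by_contra hcon
    push Not at hcon
    exact hx₀ (by ext i; simpa using hcon i)
  obtain ⟨k, hk⟩ : ∃ k : Fin 2, k ≠ i := exists_ne i
  have hcoord : ∀ j : Fin 2, ContDiff ℝ ∞ fun x : Plane => x j := fun j =>
    (EuclideanSpace.proj (𝕜 := ℝ) j).contDiff
  set ρ : Plane → ℝ := fun x => (x i / x₀ i) ^ (κ i)⁻¹ with hρ
  set w : Plane → ℝ := fun x => x k * ρ x ^ (-κ k) - x₀ k with hw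
  have hpos : ∀ᶠ x : Plane in 𝓝 x₀, 0 < x i / x₀ i := by
    have : ContinuousAt (fun x : Plane => x i / x₀ i) x₀ :=
      ((hcoord i).continuous.div_const _).continuousAt
    exact this.eventually (lt_mem_nhds (by simp [hi]))
  have hρs : SmoothNear ρ x₀ := by
    filter_upwards [hpos] with x hx
    exact ((hcoord i).contDiffAt.div_const _).rpow_const_of_ne hx.ne'
  have hρ1 : ρ x₀ = 1 := by simp [hρ, hi]
  have hρpos : ∀ᶠ x in 𝓝 x₀, 0 < ρ x := hpos.mono fun x hx => Real.rpow_pos_of_pos hx _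
  have hws : SmoothNear w x₀ := by
    filter_upwards [hρs, hρpos] with x hx hx0
    exact ((hcoord k).contDiffAt.mul (hx.rpow_const_of_ne hx0.ne')).sub contDiffAt_const
  have hw0 : w x₀ = 0 := by simp [hw, hρ1]
  refine ⟨k, ρ, w, hρs, hws, hw0, hρ1, ?_, ?_, ?_, ?_⟩
  · refine (hasDerivAt_line hws.differentiableAt _).unique ?_
    have : (fun s : ℝ => w (x₀ + s • EuclideanSpace.single k 1)) = fun s => s := by
      funext s
      have : ρ (x₀ + s • EuclideanSpace.single k 1) = 1 := by
        simp [hρ, hk.symm, hi]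
      simp [hw, this]
    rw [this]
    exact hasDerivAt_id 0
  · refine (hasDerivAt_comp_dilation hws.differentiableAt).unique ?_
    refine (hasDerivAt_const (1 : ℝ) (0 : ℝ)).congr_of_eventuallyEq ?_
    filter_upwards [lt_mem_nhds (zero_lt_one (α := ℝ))] with s hs
    have e : ρ (dilation κ s x₀) = s := by
      simp only [hρ, dilation_apply]
      rw [mul_div_assoc, div_self hi, mul_one, Real.rpow_rpow_inv hs.le (hκ i).ne']
    simp only [hw, e, dilation_apply]
    rw [Real.rpow_neg hs.le]
    have := (Real.rpow_pos_of_pos hs (κ k)).ne'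
    field_simp
    ring
  · filter_upwards [hpos, hρpos] with x hx hx0
    refine ⟨hx0, ?_⟩
    rw [dilation_add_single]
    ext j
    by_cases hj : j = k
    · subst hj
      simp only [PiLp.add_apply, dilation_apply, PiLp.smul_apply, smul_eq_mul, hw]
      have := (Real.rpow_pos_of_pos hx0 (κ j)).ne'
      rw [Real.rpow_neg hx0.le]
      simp
      field_simp
      ring
    · have hji : j = i := by
        fin_cases j <;> fin_cases i <;> fin_cases k <;> simp_all
      subst hji
      simp only [PiLp.add_apply, dilation_apply, PiLp.smul_apply, smul_eq_mul, hρ]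
      rw [Real.rpow_inv_rpow hx.le (hκ j).ne']
      simp [hj]
      field_simp
  · intro s hs
    apply hi
    have := congrArg (fun y : Plane => y i) hs
    simpa [hk.symm] using this

/-- In the chart `h(x) = ρ^d H(w)`, where `H` is the restriction of `h` to a line. The dichotomy for
functions of one variable therefore applies to `h`. -/
theorem IsDilationChart.factor_or_flat {κ : Fin 2 → ℝ} {x₀ : Plane} {k : Fin 2} {ρ w : Plane → ℝ}
    (hc : IsDilationChart κ x₀ k ρ w) {h : Plane → ℝ} {d : ℝ} (hh : ContDiffOn ℝ ∞ h {0}ᶜ)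
    (hd : IsKappaHomogeneous κ d h) :
    (∃ (N : ℕ) (S : Plane → ℝ), SmoothNear S x₀ ∧ S x₀ ≠ 0 ∧
      ∀ᶠ x in 𝓝 x₀, h x = w x ^ N * S x) ∨
    ∀ N : ℕ, ∃ S : Plane → ℝ, SmoothNear S x₀ ∧ ∀ᶠ x in 𝓝 x₀, h x = w x ^ N * S x := by
  have hH : ContDiff ℝ ∞ fun s : ℝ => h (x₀ + s • EuclideanSpace.single k 1) := by
    rw [← contDiffOn_univ]
    exact hh.comp (contDiff_const.add (contDiff_id.smul contDiff_const)).contDiffOn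
      fun s _ => hc.line_ne_zero s
  have hS : ∀ e : ℝ → ℝ, ContDiff ℝ ∞ e → SmoothNear (fun x => ρ x ^ d * e (w x)) x₀ := by
    intro e he
    filter_upwards [hc.smooth_ρ, hc.smooth_w, hc.chart] with x h1 h2 h3
    exact (h1.rpow_const_of_ne h3.1.ne').mul (he.contDiffAt.comp x h2)
  have hfac : ∀ (e : ℝ → ℝ) (N : ℕ),
      (∀ s : ℝ, h (x₀ + s • EuclideanSpace.single k 1) = s ^ N * e s) →
      ∀ᶠ x in 𝓝 x₀, h x = w x ^ N * (ρ x ^ d * e (w x)) := by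
    intro e N he
    filter_upwards [hc.chart] with x hx
    conv_lhs => rw [← hx.2]
    rw [hd _ (hc.line_ne_zero _) _ hx.1, he]
    ring
  rcases exists_pow_factorization hH with ⟨N, e, he, he0, hs⟩ | hflat
  · exact Or.inl ⟨N, _, hS e he, by simpa [hc.ρ_base, hc.w_base] using he0, hfac e N hs⟩
  · refine Or.inr fun N => ?_
    obtain ⟨e, he, hs⟩ := hflat N
    exact ⟨_, hS e he, hfac e N hs⟩

theorem IsDilationChart.factor {κ : Fin 2 → ℝ} {x₀ : Plane} {k : Fin 2} {ρ w : Plane → ℝ}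
    (hc : IsDilationChart κ x₀ k ρ w) {h : Plane → ℝ} {d : ℝ} (hh : ContDiffOn ℝ ∞ h {0}ᶜ)
    (hd : IsKappaHomogeneous κ d h) (hord : orderAt h x₀ ≠ ⊤) :
    ∃ (N : ℕ) (S : Plane → ℝ), SmoothNear S x₀ ∧ S x₀ ≠ 0 ∧ ∀ᶠ x in 𝓝 x₀, h x = w x ^ N * S x :=
  (hc.factor_or_flat hh hd).resolve_right fun h =>
    hord (orderAt_eq_top_of_forall_eq_pow_mul hc.smooth_w hc.w_base h)

theorem orderAt_ne_top_of_order_lt {g : Plane → ℝ} (hg : order g < ⊤) {x : Plane} (hx : x ≠ 0) :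
    orderAt g x ≠ ⊤ :=
  (lt_of_le_of_lt (le_iSup₂_of_le x hx le_rfl) hg).ne

/-! ### Smoothness of the homogeneous radius -/

theorem norm_dilation_sq (κ : Fin 2 → ℝ) {r : ℝ} (hr : 0 < r) (x : Plane) :
    ‖dilation κ r⁻¹ x‖ ^ 2 = ∑ i, (r ^ (-κ i) * x i) ^ 2 := by
  rw [EuclideanSpace.norm_sq_eq]
  refine Finset.sum_congr rfl fun i _ => ?_
  rw [dilation_apply, Real.norm_eq_abs, sq_abs, Real.inv_rpow hr.le, Real.rpow_neg hr.le]

/-- The implicit function theorem applied to `‖δ_{1/r} x‖² = 1`, whose derivative in `r` is strictly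
negative because every `κ i` is positive. -/
theorem smoothNear_radius {κ : Fin 2 → ℝ} (hκ : ∀ i, 0 < κ i) {x₀ : Plane} (hx₀ : x₀ ≠ 0) :
    SmoothNear (radius κ) x₀ := by
  suffices h : ∀ y : Plane, y ≠ 0 → ContDiffAt ℝ ∞ (radius κ) y by
    filter_upwards [isOpen_compl_singleton.mem_nhds hx₀] with y hy
    exact h y hy
  intro y hy
  obtain ⟨hr0, hr1⟩ := radius_spec κ hκ hy
  set r₀ := radius κ y with hr₀
  set Φ : Plane × ℝ → ℝ := fun z => ∑ i, (z.2 ^ (-κ i) * z.1 i) ^ 2 with hΦ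
  have hcoord : ∀ j : Fin 2, ContDiff ℝ ∞ fun z : Plane × ℝ => z.1 j := fun j =>
    (EuclideanSpace.proj (𝕜 := ℝ) j).contDiff.comp contDiff_fst
  have hΦs : ContDiffAt ℝ ∞ Φ (y, r₀) := by
    refine ContDiffAt.sum fun i _ => ContDiffAt.pow (ContDiffAt.mul ?_ (hcoord i).contDiffAt) 2
    exact contDiffAt_snd.rpow_const_of_ne hr0.ne'
  have hd : HasDerivAt (fun r : ℝ => Φ (y, r)) (∑ i, 2 * (r₀ ^ (-κ i) * y i) *
      (-κ i * r₀ ^ (-κ i - 1) * y i)) r₀ := by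
    refine HasDerivAt.fun_sum fun i _ => ?_
    have := ((Real.hasDerivAt_rpow_const (x := r₀) (p := -κ i) (Or.inl hr0.ne')).mul_const
      (y i)).fun_pow 2
    refine this.congr_deriv ?_
    simp
  have hneg : (∑ i, 2 * (r₀ ^ (-κ i) * y i) * (-κ i * r₀ ^ (-κ i - 1) * y i)) < 0 := by
    obtain ⟨i, hi⟩ : ∃ i, y i ≠ 0 := by
      by_contra hcon
      push Not at hcon
      exact hy (by ext i; simpa using hcon i)
    have e : ∀ i, 2 * (r₀ ^ (-κ i) * y i) * (-κ i * r₀ ^ (-κ i - 1) * y i) =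
        -(2 * r₀ ^ (-κ i) * κ i * r₀ ^ (-κ i - 1) * y i ^ 2) := fun i => by ring
    have hp : ∀ i, 0 < 2 * r₀ ^ (-κ i) * κ i * r₀ ^ (-κ i - 1) := fun i => by
      have := hκ i
      positivity
    refine Finset.sum_neg' (fun j _ => ?_) ⟨i, Finset.mem_univ _, ?_⟩
    · rw [e]
      exact neg_nonpos.2 (mul_nonneg (hp j).le (sq_nonneg _))
    · rw [e]
      exact neg_neg_of_pos (mul_pos (hp i) (by positivity))
  set c := ∑ i, 2 * (r₀ ^ (-κ i) * y i) * (-κ i * r₀ ^ (-κ i - 1) * y i) with hc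
  have hinv : (fderiv ℝ Φ (y, r₀) ∘L .inr ℝ Plane ℝ).IsInvertible := by
    have h1 : HasDerivAt (fun r : ℝ => Φ (y, r)) (fderiv ℝ Φ (y, r₀) (0, 1)) r₀ := by
      have hz : HasDerivAt (fun r : ℝ => (y, r)) ((0, 1) : Plane × ℝ) r₀ :=
        (hasDerivAt_const r₀ y).prodMk (hasDerivAt_id r₀)
      exact (hΦs.differentiableAt (by simp)).hasFDerivAt.comp_hasDerivAt r₀ hz
    have h2 := h1.unique hd
    refine ⟨ContinuousLinearEquiv.unitsEquivAut ℝ (Units.mk0 c hneg.ne), ?_⟩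
    ext
    simp [h2]
  have hψ := hΦs.contDiffAt_implicitFunction (by simp) hinv
  set ψ := hΦs.implicitFunction (by simp) hinv
  have hψ0 : ψ y = r₀ := hΦs.implicitFunction_apply_self (by simp) hinv
  have hΦ1 : Φ (y, r₀) = 1 := by
    have := norm_dilation_sq κ hr0 y
    rw [hr1, one_pow] at this
    exact this.symm
  have hev : ∀ᶠ x in 𝓝 y, Φ (x, ψ x) = 1 := by
    filter_upwards [hΦs.eventually_apply_implicitFunction (by simp) hinv] with x hx
    exact hx.trans hΦ1
  refine hψ.congr_of_eventuallyEq ?_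
  filter_upwards [hev, isOpen_compl_singleton.mem_nhds hy,
    hψ.continuousAt.eventually (lt_mem_nhds (by rw [hψ0]; exact hr0))] with x h1 h2 h3
  refine radius_eq κ hκ h2 h3 ?_
  have h4 : ‖dilation κ (ψ x)⁻¹ x‖ ^ 2 = 1 := (norm_dilation_sq κ h3 x).trans h1
  exact (pow_eq_one_iff_of_nonneg (norm_nonneg _) two_ne_zero).1 h4

/-! ### The damping function near a point -/

theorem gradient_apply (f : Plane → ℝ) (x : Plane) (j : Fin 2) : (∇ f x) j = pderiv j f x := by
  have h : inner ℝ (∇ f x) (EuclideanSpace.single j 1) = pderiv j f x :=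
    InnerProductSpace.toDual_symm_apply
  rw [← h, EuclideanSpace.inner_single_right]
  simp

/-- The length of the vector with components `s j x`, transported to the unit circle. -/
noncomputable def circleNorm (κ : Fin 2 → ℝ) (s : Fin 2 → Plane → ℝ) (x : Plane) : ℝ :=
  √(∑ j, ((radius κ x)⁻¹ ^ (1 - κ j) * s j x) ^ 2)

/-- Homogeneity of the partial derivatives moves the gradient from the unit circle back to `x`, so a
common scalar factor of the partial derivatives at `x` can be pulled out. The factor is a power of
`w` at critical points and `1` elsewhere. -/
theorem damping_eq {κ : Fin 2 → ℝ} (hκ : ∀ i, 0 < κ i) {f : Plane → ℝ}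
    (hf : ContDiffOn ℝ ∞ f {0}ᶜ) (hhom : IsKappaHomogeneous κ 1 f) (n : ℕ) {x : Plane}
    (hx : x ≠ 0) {s : Fin 2 → Plane → ℝ} {m : ℝ} (hs : ∀ j, pderiv j f x = m * s j x) :
    damping κ f n x = radius κ x * (|m| * circleNorm κ s x) ^ ((n : ℝ) / ((n : ℝ) - 1)) := by
  have hr := (radius_spec κ hκ hx).1
  have e : ‖∇ f (dilation κ (radius κ x)⁻¹ x)‖ = |m| * circleNorm κ s x := by
    rw [EuclideanSpace.norm_eq, circleNorm, ← Real.sqrt_sq_eq_abs, ← Real.sqrt_mul (sq_nonneg m),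
      Finset.mul_sum]
    congr 1
    refine Finset.sum_congr rfl fun j _ => ?_
    rw [gradient_apply, (hhom.pderiv hf j) x hx _ (inv_pos.2 hr), hs, Real.norm_eq_abs, sq_abs]
    ring
  rw [damping, e]

theorem circleNorm_near {κ : Fin 2 → ℝ} (hκ : ∀ i, 0 < κ i) {x₀ : Plane} (hx₀ : x₀ ≠ 0)
    {s : Fin 2 → Plane → ℝ} (hs : ∀ j, SmoothNear (s j) x₀) {j : Fin 2} (hj : s j x₀ ≠ 0) :
    ∀ᶠ x in 𝓝 x₀, 0 < circleNorm κ s x ∧ ContDiffAt ℝ ∞ (circleNorm κ s) x := by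
  have hne : ∀ᶠ x in 𝓝 x₀, x ≠ 0 := isOpen_compl_singleton.mem_nhds hx₀
  have hev : ∀ᶠ x in 𝓝 x₀, ∀ j, ContDiffAt ℝ ∞ (s j) x := eventually_all.2 hs
  filter_upwards [hne, hev, smoothNear_radius hκ hx₀, (hs j).continuousAt.eventually_ne hj]
    with x h1 h2 h3 h4
  have hr := (radius_spec κ hκ h1).1
  have hpos : 0 < ∑ j, ((radius κ x)⁻¹ ^ (1 - κ j) * s j x) ^ 2 := by
    refine Finset.sum_pos' (fun _ _ => sq_nonneg _) ⟨j, Finset.mem_univ _, ?_⟩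
    have := Real.rpow_pos_of_pos (inv_pos.2 hr) (1 - κ j)
    positivity
  refine ⟨Real.sqrt_pos.2 hpos, ContDiffAt.sqrt ?_ hpos.ne'⟩
  refine ContDiffAt.sum fun i _ => ContDiffAt.pow (ContDiffAt.mul ?_ (h2 i)) 2
  exact (h3.inv hr.ne').rpow_const_of_ne (inv_pos.2 hr).ne'

theorem contDiffAt_damping_factor {κ : Fin 2 → ℝ} (hκ : ∀ i, 0 < κ i) {x : Plane} (hx : x ≠ 0)
    {Q : Plane → ℝ} (hQ0 : 0 < Q x) (hQ : ContDiffAt ℝ ∞ Q x) (β α : ℝ) :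
    ContDiffAt ℝ 1 (fun x => (radius κ x * Q x ^ β) ^ α) x := by
  have hr := (radius_spec κ hκ hx).1
  have h : ContDiffAt ℝ ∞ (fun x => (radius κ x * Q x ^ β) ^ α) x :=
    (((smoothNear_radius hκ hx).self_of_nhds).mul
      (hQ.rpow_const_of_ne hQ0.ne')).rpow_const_of_ne (mul_pos hr (Real.rpow_pos_of_pos hQ0 _)).ne'
  exact h.of_le (by norm_cast)

/-! ### Decay near points of the plane -/

/-- No power of `w` is needed in the determinant, so `M = 0` and any transversal `w` will do. For `w
= ∂_v' f - ∂_v' f(x₀)` the derivative along the Hamiltonian field is the determinant itself. -/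
theorem decayNear_of_hess_ne_zero {f : Plane → ℝ} {x₀ : Plane} (hf : SmoothNear f x₀)
    (hh : hess f x₀ ≠ 0) {V : Set Plane} (hV : V ∈ 𝓝 x₀) :
    DecayNear f (fun _ => 1) x₀ V := by
  have hc : ∀ v v', dv v' (dv v f) x₀ = dv v (dv v' f) x₀ := by
    obtain ⟨F, hF, hFf⟩ := hf.exists_contDiff
    intro v v'
    rw [← (dv_eventuallyEq (dv_eventuallyEq hFf v) v').self_of_nhds,
      ← (dv_eventuallyEq (dv_eventuallyEq hFf v') v).self_of_nhds, dv_comm hF]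
  have key : ∀ v v' : Plane, dv v (dv v f) x₀ ≠ 0 → hdet v v' f x₀ ≠ 0 →
      DecayNear f (fun _ => 1) x₀ V := by
    intro v v' h1 h2
    refine decayNear_one (w := fun x => dv v' f x - dv v' f x₀) (T := hdet v v' f) (M := 0)
      (v := v) (v' := v') hf ((hf.dv v').sub (smoothNear_const _ _)) (hf.hdet v v') h1 h2
      (sub_self _) (by simp) ?_ hV
    have e : ∀ u, dv u (fun x => dv v' f x - dv v' f x₀) x₀ = dv u (dv v' f) x₀ := by
      intro u
      rw [dv, fderiv_sub_const]
      rfl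
    rw [e, e, hc v' v]
    rwa [hdet, hc v v', sq, hc v' v] at h2
  set e₀ : Plane := EuclideanSpace.single 0 1
  set e₁ : Plane := EuclideanSpace.single 1 1
  have h01 : hess f x₀ = hdet e₀ e₁ f x₀ := hess_eq hf (by decide)
  have h10 : hess f x₀ = hdet e₁ e₀ f x₀ := hess_eq hf (by decide)
  by_cases h0 : dv e₀ (dv e₀ f) x₀ = 0
  · by_cases h1 : dv e₁ (dv e₁ f) x₀ = 0
    · have hadd : ∀ {g : Plane → ℝ} {x : Plane}, dv (e₀ + e₁) g x = dv e₀ g x + dv e₁ g x := by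
        intro g x
        simp only [dv, map_add]
      have hmix : dv e₁ (dv e₀ f) x₀ ≠ 0 := by
        intro h
        apply hh
        rw [h01, hdet, h0, h]
        ring
      have hadd' : ∀ u, dv u (dv (e₀ + e₁) f) x₀ = dv u (dv e₀ f) x₀ + dv u (dv e₁ f) x₀ := by
        intro u
        have : dv (e₀ + e₁) f = fun x => dv e₀ f x + dv e₁ f x := funext fun x => hadd
        rw [this, dv, fderiv_fun_add (hf.dv e₀).differentiableAt (hf.dv e₁).differentiableAt]
        rfl
      -- If both pure second derivatives vanish, the mixed one does not, and along the diagonal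
      -- `f_vv` is twice the mixed derivative.
      refine key (e₀ + e₁) e₁ ?_ ?_
      · rw [hadd, hadd', hadd', h0, h1, ← hc e₀ e₁]
        simpa using hmix
      · rw [hdet, hadd' e₁, h1]
        simpa using hmix
    · exact key e₁ e₀ h1 (h10 ▸ hh)
  · exact key e₀ e₁ h0 (h01 ▸ hh)

/-- Since `∂_j f` is homogeneous of degree `1 - κ_j ≠ 0`, the Euler field does not annihilate it at
`x₀`. As the determinant is zero, `f_jj = 0` would force the mixed derivative to vanish too, a
contradiction; so `f_jj ≠ 0`. The Hamiltonian field of `∂_j f` annihilates `∂_j f`, hence is not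
parallel to the Euler field, which spans the kernel of `dw`; it is thus transversal to `{w = 0}`. -/
theorem decayNear_of_hess_eq_zero {κ : Fin 2 → ℝ} (hκ : ∀ i, 0 < κ i) {f : Plane → ℝ}
    (hf : ContDiffOn ℝ ∞ f {0}ᶜ) (hhom : IsKappaHomogeneous κ 1 f) (hord : order (hess f) < ⊤)
    {x₀ : Plane} (hx₀ : x₀ ≠ 0) {j : Fin 2} (hκj : κ j ≠ 1) (hj : pderiv j f x₀ ≠ 0)
    (hh : hess f x₀ = 0) {V : Set Plane} (hV : V ∈ 𝓝 x₀) :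
    DecayNear f (fun _ => 1) x₀ V := by
  have hfs := smoothNear_of_contDiffOn hf hx₀
  obtain ⟨l, hl⟩ : ∃ l : Fin 2, l ≠ j := exists_ne j
  obtain ⟨k, ρ, w, hc⟩ := exists_isDilationChart hκ hx₀
  obtain ⟨M, T, hT, hT0, hfac⟩ := hc.factor (contDiffOn_hess hf) (hhom.hess hf)
    (orderAt_ne_top_of_order_lt hord hx₀)
  set ej : Plane := EuclideanSpace.single j 1 with hej
  set el : Plane := EuclideanSpace.single l 1 with hel
  have heul : κ j * x₀ j * dv ej (dv ej f) x₀ + κ l * x₀ l * dv el (dv ej f) x₀ ≠ 0 := by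
    have h1 := (hhom.pderiv hf j).fderiv_eulerField hx₀ (hfs.dv ej).differentiableAt
    rw [fderiv_eulerField κ _ x₀ hl.symm] at h1
    have h2 : (1 - κ j) * pderiv j f x₀ ≠ 0 := mul_ne_zero (sub_ne_zero.2 hκj.symm) hj
    rw [← h1] at h2
    exact h2
  have hdet0 : hdet ej el f x₀ = 0 := by rw [← hess_eq hfs hl.symm]; exact hh
  have hjj : dv ej (dv ej f) x₀ ≠ 0 := by
    intro h
    rw [hdet, h, zero_mul, zero_sub, neg_eq_zero] at hdet0
    exact heul (by rw [h, pow_eq_zero_iff two_ne_zero |>.1 hdet0]; ring)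
  refine decayNear_one (v := ej) (v' := el) (M := M) hfs hc.smooth_w hT hjj hT0 hc.w_base ?_ ?_ hV
  · filter_upwards [hfac, hfs.eventually] with x h1 h2
    rw [← h1, hess_eq h2 hl.symm]
  · intro hcon
    have hew := hc.euler_w
    rw [fderiv_eulerField κ _ x₀ hl.symm] at hew
    change κ j * x₀ j * dv ej w x₀ + κ l * x₀ l * dv el w x₀ = 0 at hew
    have h1 : dv ej w x₀ * (κ j * x₀ j * dv ej (dv ej f) x₀ +
        κ l * x₀ l * dv el (dv ej f) x₀) = 0 := by
      linear_combination dv ej (dv ej f) x₀ * hew - κ l * x₀ l * hcon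
    have hwj : dv ej w x₀ = 0 := (mul_eq_zero.1 h1).resolve_right heul
    have hwl : dv el w x₀ = 0 := by
      rw [hwj, mul_zero, sub_zero] at hcon
      exact (mul_eq_zero.1 hcon).resolve_left hjj
    have hk := hc.dv_w
    have : k = j ∨ k = l := by
      fin_cases k <;> fin_cases j <;> fin_cases l <;> simp_all
    rcases this with rfl | rfl
    · rw [hwj] at hk; exact zero_ne_one hk
    · rw [hwl] at hk; exact zero_ne_one hk

theorem decayNear_of_pderiv_ne_zero {κ : Fin 2 → ℝ} (hκ : ∀ i, 0 < κ i) {f : Plane → ℝ}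
    (hf : ContDiffOn ℝ ∞ f {0}ᶜ) (hhom : IsKappaHomogeneous κ 1 f) (hord : order (hess f) < ⊤)
    {x₀ : Plane} (hx₀ : x₀ ≠ 0) {j : Fin 2} (hκj : κ j ≠ 1) (hj : pderiv j f x₀ ≠ 0)
    {V : Set Plane} (hV : V ∈ 𝓝 x₀) : DecayNear f (fun _ => 1) x₀ V := by
  by_cases hh : hess f x₀ = 0
  · exact decayNear_of_hess_eq_zero hκ hf hhom hord hx₀ hκj hj hh hV
  · exact decayNear_of_hess_ne_zero (smoothNear_of_contDiffOn hf hx₀) hh hV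

theorem oscIntegral_eq {f G m : Plane → ℝ} {α : ℝ} {a : Plane → ℂ} {K : Set Plane}
    (ha : tsupport a ⊆ K) (hm : ∀ x ∈ K, G x ^ α = m x) (σ : Plane) (t : ℝ) :
    oscIntegral f G α a σ t = ∫ x, (m x • a x) * osc t (phase f σ) x := by
  rw [← integral_congr_on_tsupport ha hm (fun _ _ => rfl)]
  refine integral_congr_ae (Eventually.of_forall fun x => ?_)
  simp only [Complex.real_smul, mul_comm (a x)]
  rfl

/-! ### Critical points of `f` and the damped estimate. -/

theorem exists_eq_pow_mul_of_gradient_eq_zero {κ : Fin 2 → ℝ} {f : Plane → ℝ}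
    (hf : ContDiffOn ℝ ∞ f {0}ᶜ) (hhom : IsKappaHomogeneous κ 1 f) (hord : order (hess f) < ⊤)
    {x₀ : Plane} (hx₀ : x₀ ≠ 0) (hgrad : ∇ f x₀ = 0) {k : Fin 2} {ρ w : Plane → ℝ}
    (hc : IsDilationChart κ x₀ k ρ w) :
    ∃ (m : ℕ) (S : Plane → ℝ), SmoothNear S x₀ ∧ S x₀ ≠ 0 ∧
      ∀ᶠ x in 𝓝 x₀, f x = w x ^ (m + 2) * S x := by
  have hfs := smoothNear_of_contDiffOn hf hx₀
  have hp : ∀ j, pderiv j f x₀ = 0 := fun j => by rw [← gradient_apply, hgrad]; rfl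
  rcases hc.factor_or_flat hf hhom with ⟨N, S, hS, hS0, hfac⟩ | hflat
  -- Euler's identity gives `f(x₀) = 0`, which excludes `N = 0`; the vanishing of the derivative
  -- transversal to `{w = 0}` excludes `N = 1`.
  · match N, hfac with
    | 0, hfac =>
      exfalso
      have h1 := hhom.fderiv_eulerField hx₀ hfs.differentiableAt
      rw [fderiv_eulerField κ f x₀ (j := 0) (l := 1) (by decide), hp, hp,
        hfac.self_of_nhds] at h1
      simp at h1
      exact hS0 h1.symm
    | 1, hfac =>
      exfalso
      have h1 := (dv_eventuallyEq_pow_mul hc.smooth_w hS (N := 0) hfac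
        (EuclideanSpace.single k 1)).self_of_nhds
      have h2 : dv (EuclideanSpace.single k 1) f x₀ = 0 := hp k
      rw [h2, hc.dv_w, hc.w_base] at h1
      simp at h1
      exact hS0 h1.symm
    | m + 2, hfac => exact ⟨m, S, hS, hS0, hfac⟩
  -- If `f` were flat along `{w = 0}`, so would be its Hessian determinant, contrary to its finite
  -- order.
  · exfalso
    refine orderAt_ne_top_of_order_lt hord hx₀
      (orderAt_eq_top_of_forall_eq_pow_mul hc.smooth_w hc.w_base fun N => ?_)
    obtain ⟨S, hS, hfac⟩ := hflat (N + 2)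
    obtain ⟨T, hT, h⟩ := exists_hdet_eq_pow_mul hfs hc.smooth_w hS hfac
      (EuclideanSpace.single 0 1) (EuclideanSpace.single 1 1)
    refine ⟨T, hT, ?_⟩
    filter_upwards [h, hfs.eventually] with x h1 h2
    rw [hess_eq h2 (j := 0) (l := 1) (by decide), h1]

/-- Since `h ≥ ord f ≥ m + 2`, the hypothesis on `α` is at least as strong as `α > 1/2 - 1/(m+2)`;
multiply by `m + 2`. An infinite height is covered by the convention `1/∞ = 0`. -/
theorem half_lt_of_height {κ : Fin 2 → ℝ} {f : Plane → ℝ} {x₀ : Plane} (hx₀ : x₀ ≠ 0) {m : ℕ}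
    (hm : orderAt f x₀ = (m + 2 : ℕ)) {α : ℝ} (hα : 1 / 2 - ((height κ f)⁻¹).toReal < α) :
    (m : ℝ) / 2 < ((m : ℝ) + 2) * α := by
  have h1 : ((m + 2 : ℕ) : ℕ∞) ≤ order f := hm ▸ le_iSup₂_of_le x₀ hx₀ le_rfl
  have h2 : ((m + 2 : ℕ) : ℝ≥0∞) ≤ height κ f := by
    refine le_trans ?_ (le_max_right _ _)
    exact_mod_cast h1
  have h3 : ((height κ f)⁻¹).toReal ≤ ((m : ℝ) + 2)⁻¹ := by
    have h4 := ENNReal.inv_le_inv.2 h2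
    have h5 := ENNReal.toReal_mono (by simp) h4
    rw [ENNReal.toReal_inv, ENNReal.toReal_inv, ENNReal.toReal_natCast] at h5
    rw [ENNReal.toReal_inv]
    exact_mod_cast h5
  have h6 : 1 / 2 - ((m : ℝ) + 2)⁻¹ < α := by linarith
  have hm0 : (0 : ℝ) < m + 2 := by positivity
  calc (m : ℝ) / 2 = (m + 2) * (1 / 2 - ((m : ℝ) + 2)⁻¹) := by field_simp; ring
    _ < _ := by gcongr

/-- With `n = m + 2`, the exponent `n / (n - 1)` turns `|w|^(n-1)`, the size of the gradient, into
`|w|^n`, the size of `f`. -/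
theorem mul_rpow_weight {R w Q α : ℝ} (hR : 0 ≤ R) (hQ : 0 ≤ Q) (m : ℕ) :
    (R * (|w ^ (m + 1)| * Q) ^ (((m + 2 : ℕ) : ℝ) / (((m + 2 : ℕ) : ℝ) - 1))) ^ α =
      (R * Q ^ (((m + 2 : ℕ) : ℝ) / (((m + 2 : ℕ) : ℝ) - 1))) ^ α *
        |w| ^ (((m : ℝ) + 2) * α) := by
  set p := ((m + 2 : ℕ) : ℝ) / (((m + 2 : ℕ) : ℝ) - 1) with hp
  have hpm : ((m + 1 : ℕ) : ℝ) * p = m + 2 := by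
    rw [hp]
    push_cast
    have : (m : ℝ) + 2 - 1 ≠ 0 := by
      have : (0 : ℝ) < m + 2 - 1 := by linarith [(Nat.cast_nonneg m : (0 : ℝ) ≤ m)]
      exact this.ne'
    field_simp
    ring
  have e : (|w ^ (m + 1)| * Q) ^ p = |w| ^ ((m : ℝ) + 2) * Q ^ p := by
    rw [Real.mul_rpow (abs_nonneg _) hQ, abs_pow, ← Real.rpow_natCast, ← Real.rpow_mul (abs_nonneg _),
      hpm]
  have hQp := Real.rpow_nonneg hQ p
  rw [e, mul_left_comm, Real.mul_rpow (Real.rpow_nonneg (abs_nonneg _) _) (mul_nonneg hR hQp),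
    ← Real.rpow_mul (abs_nonneg _), mul_comm]

theorem exists_damped_bound_of_gradient_eq_zero {κ : Fin 2 → ℝ} (hκ : ∀ i, 0 < κ i)
    {f : Plane → ℝ} (hf : ContDiffOn ℝ ∞ f {0}ᶜ) (hhom : IsKappaHomogeneous κ 1 f)
    (hord : order (hess f) < ⊤) {x₀ : Plane} (hx₀ : x₀ ≠ 0) (hgrad : ∇ f x₀ = 0) {α : ℝ}
    (hα : 1 / 2 - ((height κ f)⁻¹).toReal < α) :
    ∃ ε : ℝ, 0 < ε ∧ ∃ K ∈ 𝓝 x₀, IsCompact K ∧ ∀ R : ℝ, ∃ C : ℝ, ∀ σ : Plane, ‖σ‖ ≤ R →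
      ∀ a : Plane → ℂ, ContDiff ℝ ∞ a → tsupport a ⊆ K → ∀ t : ℝ,
        ‖oscIntegral f (damping κ f (orderAt f x₀).toNat) α a σ t‖ ≤
          C * sobolevNorm a * (1 + |t|) ^ (-(1 / 2 + ε)) := by
  have hfs := smoothNear_of_contDiffOn hf hx₀
  obtain ⟨k, ρ, w, hc⟩ := exists_isDilationChart hκ hx₀
  obtain ⟨l, hl⟩ : ∃ l : Fin 2, l ≠ k := exists_ne k
  obtain ⟨m, S, hS, hS0, hfac⟩ :=
    exists_eq_pow_mul_of_gradient_eq_zero hf hhom hord hx₀ hgrad hc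
  obtain ⟨M, T, hT, hT0, hhess⟩ := hc.factor (contDiffOn_hess hf) (hhom.hess hf)
    (orderAt_ne_top_of_order_lt hord hx₀)
  have hw := hc.smooth_w
  have hn : orderAt f x₀ = (m + 2 : ℕ) :=
    orderAt_eq_of_eq_pow_mul hfs hw hS hc.w_base (by rw [hc.dv_w]; exact one_ne_zero) hS0 hfac
  set s : Fin 2 → Plane → ℝ := fun j x => ((m + 1 : ℕ) + 1) * dv (EuclideanSpace.single j 1) w x *
    S x + w x * dv (EuclideanSpace.single j 1) S x with hs
  have hss : ∀ j, SmoothNear (s j) x₀ := fun j => hw.dv_factor hS (m + 1) _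
  have hsf : ∀ j, ∀ᶠ x in 𝓝 x₀, pderiv j f x = w x ^ (m + 1) * s j x := fun j =>
    dv_eventuallyEq_pow_mul hw hS hfac _
  have hsk : s k x₀ ≠ 0 := by
    simp only [hs, hc.dv_w, hc.w_base, zero_mul, add_zero, mul_one]
    exact mul_ne_zero (by positivity) hS0
  have hQ := circleNorm_near hκ hx₀ hss hsk
  set V : Set Plane := {x | x ≠ 0 ∧ (∀ j, pderiv j f x = w x ^ (m + 1) * s j x) ∧
    0 < circleNorm κ s x ∧ ContDiffAt ℝ ∞ (circleNorm κ s) x} with hVdef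
  have hV : V ∈ 𝓝 x₀ := by
    filter_upwards [isOpen_compl_singleton.mem_nhds hx₀, eventually_all.2 hsf, hQ] with x h1 h2 h3
    exact ⟨h1, h2, h3⟩
  -- Two derivatives of `f = w^(m+2) S` in the direction transversal to `{w = 0}` leave `w^m` times
  -- a unit, so `k = m`; the damping contributes `β = (m + 2) α`.
  obtain ⟨ε, hε, K, hK, hKc, hKV, H⟩ := decayNear_abs_rpow (v := EuclideanSpace.single k 1)
    (v' := EuclideanSpace.single l 1) (k := m) (M := M) hfs hw
    (hw.dv_factor (hss k) m (EuclideanSpace.single k 1)) hT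
    (by
      rw [hc.dv_w, hc.w_base, zero_mul, add_zero, mul_one]
      exact mul_ne_zero (by positivity) hsk)
    hT0 hc.w_base (dv_eventuallyEq_pow_mul hw (hss k) (hsf k) _)
    (by
      filter_upwards [hhess, hfs.eventually] with x h1 h2
      rw [← h1, hess_eq h2 hl.symm])
    (by rw [hc.dv_w]; exact one_ne_zero) (half_lt_of_height hx₀ hn hα) hV
  refine ⟨ε, hε, K, hK, hKc, fun R => ?_⟩
  obtain ⟨C, hC⟩ := H R (fun x => (radius κ x *
    circleNorm κ s x ^ (((m + 2 : ℕ) : ℝ) / (((m + 2 : ℕ) : ℝ) - 1))) ^ α)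
    (fun x hx => contDiffAt_damping_factor hκ hx.1 hx.2.2.1 hx.2.2.2 _ _)
  refine ⟨C, fun σ hσ a ha haK t => ?_⟩
  rw [hn, ENat.toNat_natCast, oscIntegral_eq haK (fun x hx => ?_)]
  · exact hC σ hσ a ha haK t
  · have hxV := hKV hx
    rw [damping_eq hκ hf hhom (m + 2) hxV.1 hxV.2.1,
      mul_rpow_weight (radius_spec κ hκ hxV.1).1.le hxV.2.2.1.le]

/-- Near a noncritical point the damping function is smooth and positive, so each of its powers is
an admissible smooth factor. The exponent and the compact set are found before `G` and `α` are
chosen; only the constant depends on these. -/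
theorem exists_bound_of_pderiv_ne_zero {κ : Fin 2 → ℝ} (hκ : ∀ i, 0 < κ i)
    {f : Plane → ℝ} (hf : ContDiffOn ℝ ∞ f {0}ᶜ) (hhom : IsKappaHomogeneous κ 1 f)
    (hord : order (hess f) < ⊤) {x₀ : Plane} (hx₀ : x₀ ≠ 0) {j : Fin 2} (hκj : κ j ≠ 1)
    (hj : pderiv j f x₀ ≠ 0) :
    ∃ ε : ℝ, 0 < ε ∧ ∃ K ∈ 𝓝 x₀, IsCompact K ∧ ∀ (R : ℝ) (G : Plane → ℝ),
      (G = (fun _ => 1) ∨ ∃ n : ℕ, 2 ≤ n ∧ G = damping κ f n) → ∀ α : ℝ,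
      ∃ C : ℝ, ∀ σ : Plane, ‖σ‖ ≤ R →
      ∀ a : Plane → ℂ, ContDiff ℝ ∞ a → tsupport a ⊆ K → ∀ t : ℝ,
        ‖oscIntegral f G α a σ t‖ ≤ C * sobolevNorm a * (1 + |t|) ^ (-(1 / 2 + ε)) := by
  have hfs := smoothNear_of_contDiffOn hf hx₀
  set s : Fin 2 → Plane → ℝ := fun j => pderiv j f with hs
  have hQ := circleNorm_near hκ hx₀ (s := s) (fun j => hfs.dv _) hj
  set V : Set Plane := {x | x ≠ 0 ∧ 0 < circleNorm κ s x ∧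
    ContDiffAt ℝ ∞ (circleNorm κ s) x} with hVdef
  have hV : V ∈ 𝓝 x₀ := by
    filter_upwards [isOpen_compl_singleton.mem_nhds hx₀, hQ] with x h1 h2
    exact ⟨h1, h2⟩
  obtain ⟨ε, hε, K, hK, hKc, hKV, H⟩ :=
    decayNear_of_pderiv_ne_zero hκ hf hhom hord hx₀ hκj hj hV
  refine ⟨ε, hε, K, hK, hKc, fun R G hG α => ?_⟩
  obtain ⟨g, hg, hGg⟩ : ∃ g : Plane → ℝ, (∀ x ∈ V, ContDiffAt ℝ 1 g x) ∧
      ∀ x ∈ V, G x ^ α = g x * 1 := by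
    rcases hG with rfl | ⟨n, -, rfl⟩
    · exact ⟨fun _ => 1, fun x _ => contDiffAt_const, fun x _ => by simp⟩
    · refine ⟨fun x => (radius κ x * circleNorm κ s x ^ ((n : ℝ) / ((n : ℝ) - 1))) ^ α,
        fun x hx => contDiffAt_damping_factor hκ hx.1 hx.2.1 hx.2.2 _ _, fun x hx => ?_⟩
      rw [damping_eq hκ hf hhom n hx.1 (s := s) (m := 1) fun j => (one_mul _).symm]
      simp
  obtain ⟨C, hC⟩ := H R g hg
  refine ⟨C, fun σ hσ a ha haK t => ?_⟩
  rw [oscIntegral_eq haK fun x hx => hGg x (hKV hx)]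
  exact hC σ hσ a ha haK t

end MixedHom

/-! ### The two cases assembled. -/

theorem theorem4p3 (κ : Fin 2 → ℝ) (hκ : ∀ i, 0 < κ i) (f : MixedHom.Plane → ℝ)
    (hf : ContDiffOn ℝ ∞ f {0}ᶜ) (hhom : MixedHom.IsKappaHomogeneous κ 1 f)
    (hord : MixedHom.order (MixedHom.hess f) < ⊤)
    (x₀ : MixedHom.Plane) (hx₀ : x₀ ≠ 0) :
    (∀ j : Fin 2, κ j ≠ 1 → MixedHom.pderiv j f x₀ ≠ 0 →
      ∃ ε : ℝ, 0 < ε ∧ ∃ K ∈ 𝓝 x₀, IsCompact K ∧ ∃ U ∈ 𝓝 (-∇ f x₀),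
        ∀ G : MixedHom.Plane → ℝ,
          (G = (fun _ => 1) ∨ ∃ n : ℕ, 2 ≤ n ∧ G = MixedHom.damping κ f n) →
        ∀ α : ℝ, 0 ≤ α → ∃ C : ℝ, ∀ σ ∈ U, ∀ a : MixedHom.Plane → ℂ,
          ContDiff ℝ ∞ a → tsupport a ⊆ K → ∀ t : ℝ,
            ‖MixedHom.oscIntegral f G α a σ t‖ ≤
              C * MixedHom.sobolevNorm a * (1 + |t|) ^ (-(1 / 2 + ε))) ∧
    (∇ f x₀ = 0 → ∀ α : ℝ, 1 / 2 - ((MixedHom.height κ f)⁻¹).toReal < α →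
      ∃ ε : ℝ, 0 < ε ∧ ∃ K ∈ 𝓝 x₀, IsCompact K ∧ ∃ U ∈ 𝓝 (0 : MixedHom.Plane),
        ∃ C : ℝ, ∀ σ ∈ U, ∀ a : MixedHom.Plane → ℂ,
          ContDiff ℝ ∞ a → tsupport a ⊆ K → ∀ t : ℝ,
            ‖MixedHom.oscIntegral f
                (MixedHom.damping κ f (MixedHom.orderAt f x₀).toNat) α a σ t‖ ≤
              C * MixedHom.sobolevNorm a * (1 + |t|) ^ (-(1 / 2 + ε))) := by
  constructor
  · intro j hκj hj
    obtain ⟨ε, hε, K, hK, hKc, H⟩ :=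
      MixedHom.exists_bound_of_pderiv_ne_zero hκ hf hhom hord hx₀ hκj hj
    -- The estimates are uniform over every bounded set of `σ`, so the radius of the neighbourhood
    -- is immaterial; the unit ball is contained in `‖σ‖ ≤ 1 + ‖∇ f x₀‖`.
    refine ⟨ε, hε, K, hK, hKc, Metric.ball (-∇ f x₀) 1, Metric.ball_mem_nhds _ one_pos,
      fun G hG α _ => ?_⟩
    obtain ⟨C, hC⟩ := H (1 + ‖∇ f x₀‖) G hG α
    refine ⟨C, fun σ hσ => hC σ ?_⟩
    rw [mem_ball_iff_norm, sub_neg_eq_add] at hσ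
    calc ‖σ‖ = ‖σ + ∇ f x₀ - ∇ f x₀‖ := by rw [add_sub_cancel_right]
      _ ≤ ‖σ + ∇ f x₀‖ + ‖∇ f x₀‖ := norm_sub_le _ _
      _ ≤ 1 + ‖∇ f x₀‖ := by gcongr
  · intro hgrad α hα
    obtain ⟨ε, hε, K, hK, hKc, H⟩ :=
      MixedHom.exists_damped_bound_of_gradient_eq_zero hκ hf hhom hord hx₀ hgrad hα
    obtain ⟨C, hC⟩ := H 1
    refine ⟨ε, hε, K, hK, hKc, Metric.ball 0 1, Metric.ball_mem_nhds _ one_pos, C,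
      fun σ hσ => hC σ ?_⟩
    exact (mem_ball_zero_iff.1 hσ).le
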